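/- All hypergraphs below are $3$-uniform and simple (triple systems) on a vertex set of size $n$; $ijk$ denotes the triple $\{i,j,k\}$, and $X$ denotes the vertex $10$. Consider the configurations $\mathbf A=\{124,135,236\}$ (six vertices), $\mathbf B=\{125,134,234\}$ and $\mathbf D=\{123,134,235\}$ (five vertices each). A triple system is $\mathbf{ABD}$-free if it contains no subsystem (induced or not) isomorphic to $\mathbf A$, $\mathbf B$ or $\mathbf D$. Let $\mathrm{ex}(n,\mathbf{ABD})$ be the maximum number of triples in an $\mathbf{ABD}$-free triple system on $n$ vertices, and call an $\mathbf{ABD}$-free triple system on $n$ vertices with $\mathrm{ex}(n,\mathbf{ABD})$ triples extremal. For $k\ge 1$ with $2k<n$, let $\mathcal F_{n,k}$ be the triple system obtained by partitioning the $n$ vertices into $k$ pairs $A_1,\dots,A_k$ and a set $B$ of size $n-2k$, and taking all triples $A_i\cup\{b\}$ with $1\le i\le k$ and $b\in B$. Let $K^3_4$ be the complete triple system on four vertices, and let $\mathcal Q^{4\times4}$ be the triple system on the $16$ points of a $4\times 4$ lattice consisting of all triples contained in a row or in a column. **Theorem.** For all $n\ge 8$, $$\mathrm{ex}(n,\mathbf{ABD})=\left\lfloor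 \tfrac18 n^2\right\rfloor .$$ Moreover, up to isomorphism, the extremal systems are exactly the following. * For $n\ge 11$: the systems $\mathcal F_{n,k}$ with $k$ as close as possible to $n/4$ (one value of $k$, except that for $n\equiv 2 \pmod 4$ there are two, $k=(n\pm2)/4$), and, if $n=16$, also $\mathcal Q^{4\times 4}$. * For $n=8$: $\mathcal F_{8,2}$; two copies of $K^3_4$ sharing exactly one vertex, together with an isolated vertex; and two vertex-disjoint copies of $K^3_4$. * For $n=9$: $\mathcal F_{9,2}$; and the system consisting of the complete triple systems on $\{1,2,3,4\}$ and $\{1,5,6,7\}$ and the two further triples $289$ and $589$. * For $n=10$: $\mathcal F_{10,2}$; $\mathcal F_{10,3}$; three copies of $K^3_4$ sharing one common vertex and otherwise disjoint; and three copies of $K^3_4$ forming a path, on the vertex sets $\{1,2,3,4\}$, $\{4,5,6,7\}$, $\{7,8,9,X\}$. -/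

import Mathlib

namespace TripleSystems

/-- The four triangle configurations of three triples. -/
inductive Config
  | A | B | C | D

/-- The number of vertices of a configuration. -/
def Config.order : Config → ℕ
  | .A => 6
  | .B => 5
  | .C => 4
  | .D => 5

/-- The three triples of a configuration. The vertex called `i` in the usual description
(`A = {124, 135, 236}`, `B = {125, 134, 234}`, `C = {124, 134, 234}`, `D = {123, 134, 235}`)
is represented by `i - 1`. -/
def Config.triples : (X : Config) → Finset (Finset (Fin X.order))
  | .A => ({{0, 1, 3}, {0, 2, 4}, {1, 2, 5}} : Finset (Finset (Fin 6)))
  | .B => ({{0, 1, 4}, {0, 2, 3}, {1, 2, 3}} : Finset (Finset (Fin 5)))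
  | .C => ({{0, 1, 3}, {0, 2, 3}, {1, 2, 3}} : Finset (Finset (Fin 4)))
  | .D => ({{0, 1, 2}, {0, 2, 3}, {1, 2, 4}} : Finset (Finset (Fin 5)))

/-- A triple system on `V`, given by its set of edges: every edge has three elements. -/
def IsTripleSystem {V : Type*} (F : Finset (Finset V)) : Prop :=
  ∀ e ∈ F, e.card = 3

/-- `F` contains a (not necessarily induced) copy of the configuration `X`. -/
def Contains {V : Type*} (F : Finset (Finset V)) (X : Config) : Prop :=
  ∃ f : Fin X.order ↪ V, ∀ e ∈ X.triples, e.map f ∈ F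

/-- `F` contains none of the configurations in `S`. -/
def IsFree {V : Type*} (S : Set Config) (F : Finset (Finset V)) : Prop :=
  ∀ X ∈ S, ¬ Contains F X

/-- `ex(n, S)`: the maximum number of triples of an `S`-free triple system on `n` vertices.
(The maximum is attained: see `isGreatest_ex`.) -/
noncomputable def ex (n : ℕ) (S : Set Config) : ℕ :=
  sSup {m : ℕ | ∃ F : Finset (Finset (Fin n)), IsTripleSystem F ∧ IsFree S F ∧ F.card = m}

theorem isGreatest_ex (n : ℕ) (S : Set Config) :
    IsGreatest {m : ℕ | ∃ F : Finset (Finset (Fin n)),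
      IsTripleSystem F ∧ IsFree S F ∧ F.card = m} (ex n S) := by
  have hb : BddAbove {m : ℕ | ∃ F : Finset (Finset (Fin n)),
      IsTripleSystem F ∧ IsFree S F ∧ F.card = m} := by
    refine ⟨Fintype.card (Finset (Fin n)), ?_⟩
    rintro m ⟨F, -, -, rfl⟩
    exact Finset.card_le_univ F
  refine ⟨Nat.sSup_mem ⟨0, ∅, ?_, ?_, rfl⟩ hb, fun m hm => le_csSup hb hm⟩
  · intro e he
    simp at he
  · rintro X - ⟨f, hf⟩
    have h : ∀ Y : Config, Y.triples.Nonempty := by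
      intro Y
      cases Y <;> exact Finset.insert_nonempty _ _
    obtain ⟨e, he⟩ := h X
    simpa using hf e he

/-- `F` is an extremal system for `ex(n, S)`: an `S`-free triple system on `n` vertices with
`ex(n, S)` triples. -/
def IsExtremal {n : ℕ} (S : Set Config) (F : Finset (Finset (Fin n))) : Prop :=
  IsTripleSystem F ∧ IsFree S F ∧ F.card = ex n S

/-- Isomorphism of set systems. -/
def Iso {V W : Type*} (F : Finset (Finset V)) (G : Finset (Finset W)) : Prop :=
  ∃ σ : V ≃ W, ∀ e : Finset V, e ∈ F ↔ e.map σ.toEmbedding ∈ G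

/-- `F` is of the form `F_{n,k}`: the `n` vertices are partitioned into `k` pairs
`A₁, …, A_k` and a set of `n - 2k` further vertices, where `k ≥ 1` and `2k < n`, and the triples
are all sets `A_i ∪ {b}` with `b` a vertex outside the pairs. -/
def IsF {n : ℕ} (k : ℕ) (F : Finset (Finset (Fin n))) : Prop :=
  1 ≤ k ∧ 2 * k < n ∧ ∃ A : Fin k → Finset (Fin n),
    (∀ i, (A i).card = 2) ∧ (∀ i j, i ≠ j → Disjoint (A i) (A j)) ∧
    ∀ e : Finset (Fin n), e ∈ F ↔ ∃ i, ∃ b, (∀ j, b ∉ A j) ∧ e = insert b (A i)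

/-- Among the admissible parameters, `k` is as close as possible to `n / 4`. -/
def IsOptimal (n k : ℕ) : Prop :=
  ∀ j : ℕ, 1 ≤ j → 2 * j < n → |(k : ℚ) - n / 4| ≤ |(j : ℚ) - n / 4|

/-- The union of the complete triple systems on the given vertex sets. -/
def completeOn {V : Type*} [DecidableEq V] (Q : Finset (Finset V)) : Finset (Finset V) :=
  Q.biUnion fun q => q.powersetCard 3

/-- The 8 rows and columns of the `4 × 4` lattice, each carrying a complete triple system. -/
def Q44 : Finset (Finset (Fin 4 × Fin 4)) :=
  completeOn
    ((Finset.univ.image fun i : Fin 4 => Finset.univ.filter fun p : Fin 4 × Fin 4 => p.1 = i) ∪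
      (Finset.univ.image fun j : Fin 4 => Finset.univ.filter fun p : Fin 4 × Fin 4 => p.2 = j))

/-- Two complete triple systems on four vertices sharing a vertex, and an isolated vertex. -/
def Q8two : Finset (Finset (Fin 8)) :=
  completeOn {{0, 1, 2, 3}, {0, 4, 5, 6}}

/-- Two vertex-disjoint complete triple systems on four vertices. -/
def Q8three : Finset (Finset (Fin 8)) :=
  completeOn {{0, 1, 2, 3}, {4, 5, 6, 7}}

/-- In the vertices `1, …, 9` (represented by `0, …, 8`): the complete triple systems on `1234`
and `1567` together with the triples `289` and `589`. -/
def Q9two : Finset (Finset (Fin 9)) :=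
  completeOn {{0, 1, 2, 3}, {0, 4, 5, 6}} ∪ {{1, 7, 8}, {4, 7, 8}}

/-- Three complete triple systems on four vertices sharing a vertex. -/
def Q10three : Finset (Finset (Fin 10)) :=
  completeOn {{0, 1, 2, 3}, {0, 4, 5, 6}, {0, 7, 8, 9}}

/-- Three complete triple systems on four vertices forming a path. -/
def Q10four : Finset (Finset (Fin 10)) :=
  completeOn {{0, 1, 2, 3}, {3, 4, 5, 6}, {6, 7, 8, 9}}

end TripleSystems

open TripleSystems

/-!
Systems with the maximum number of triples are *closed*: whenever three distinct triples form a
triangle, that is, contain the three pairs of some three vertices, they lie in a *block*, a set of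
four vertices carrying all four triples. Indeed `A`, `B` and `D` are exactly the triangles spanning
more than four vertices (`weak_iff`), so three triples of a triangle lie in a four-set, and the
fourth triple of that set can always be added (`Weak.closed`). The problem becomes one about closed
systems. Two blocks share at most one vertex, a vertex outside a block is joined to at most one of
its vertices (`Closed.eq_of_adj_block`), and a triple in no block has a *centre*: a vertex both of
whose pairs are covered by this triple only (`Closed.exists_center`). These *private pairs* form a
triangle-free graph with two edges for every triple outside the blocks.

If there is no block, Mantel's theorem bounds the number of triples by `n ^ 2 / 8`, and a stability
version (`exists_bipartition`: at most one pair is missing from a complete bipartite graph) makes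
the system one of the `F_{n,k}` (`Closed.exists_isPairSystem`). It remains to see which extremal
systems have blocks.

* A single block is impossible: outside it Mantel's theorem applies, and its vertices have too few
  neighbours (`Closed.card_lt_of_unique_block`).
* On eight, nine and ten vertices two blocks leave room for few further triples, and a direct
  analysis gives the sporadic systems (`Closed.eight_with_block`, `Closed.nine_with_block`,
  `Closed.ten_with_block`).
* From eleven to fifteen vertices the absence of blocks (`ExtremalBlockFree`) follows by induction.
  Deleting a vertex `x` of a block `Q` leaves the triple `Q \ {x}`, which shares no pair with another
  triple; this does not happen in extremal systems without blocks, so `x` has large degree. Deleting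
  all of `Q` and applying the bound for `n - 4` vertices, one contradicts the inequality that the
  vertices of `Q` have at most `n + 8` neighbours altogether.
* For `n ≥ 16` let `d` be the degree in the graph of private pairs and block pairs. A private pair
  `xy` satisfies `d(x) + d(y) ≤ n`, and a block satisfies `∑ d ≤ n + 8`. Weighting these inequalities
  suitably and summing gives `∑ excess ≤ n * (n ^ 2 - 8 * |F|)` (`Closed.sum_excess_le`), where the
  excess is a quadratic form in the defect `n - 2 * d` and the number of blocks at a vertex. For
  `n ≥ 17` it is positive at the vertices of blocks, by enough to rule out blocks in extremal
  systems. For `n = 16` it is nonnegative and vanishes at a vertex of a block only if the vertex is in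
  two blocks and in no other triple. The blocks meeting a given block then partition the vertices,
  and two such partitions are the coordinates of the `4 × 4` lattice (`Closed.iso_lattice`).
-/

namespace TripleSystems

section

/-! ### Closed triple systems and their blocks -/

variable {V : Type*}

/-- A block of `F`: a set of four vertices all of whose triples belong to `F`. -/
def IsBlock (F : Finset (Finset V)) (Q : Finset V) : Prop :=
  Q.card = 4 ∧ Q.powersetCard 3 ⊆ F

theorem eq_of_subset_card {e f : Finset V} {n : ℕ} (he : e.card = n) (hf : f.card = n)
    (h : e ⊆ f) : e = f :=
  Finset.eq_of_subset_of_card_le h (by omega)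

theorem IsBlock.mem {F : Finset (Finset V)} {Q e : Finset V} (hQ : IsBlock F Q) (he : e ⊆ Q)
    (h3 : e.card = 3) : e ∈ F :=
  hQ.2 (Finset.mem_powersetCard.2 ⟨he, h3⟩)

theorem card_block_triples {F : Finset (Finset V)} {Q : Finset V} (hQ : IsBlock F Q) :
    (Q.powersetCard 3).card = 4 := by
  rw [Finset.card_powersetCard, hQ.1]; rfl

variable [DecidableEq V]

/-- Triple systems in which every triangle (three distinct triples covering the three pairs of
a set of three vertices) lies inside a block. -/
structure Closed (F : Finset (Finset V)) : Prop where
  card_eq : ∀ e ∈ F, e.card = 3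
  exists_block : ∀ x y z e f g, x ≠ y → y ≠ z → x ≠ z → e ∈ F → f ∈ F → g ∈ F →
    e ≠ f → f ≠ g → e ≠ g → x ∈ e → y ∈ e → y ∈ f → z ∈ f → x ∈ g → z ∈ g →
    ∃ Q, IsBlock F Q ∧ e ⊆ Q ∧ f ⊆ Q ∧ g ⊆ Q

theorem mem_triple {a b d y : V} : y ∈ ({a, b, d} : Finset V) ↔ y = a ∨ y = b ∨ y = d := by
  simp

theorem exists_third {e : Finset V} (he : e.card = 3) {x y : V} (hx : x ∈ e) (hy : y ∈ e)
    (hxy : x ≠ y) : ∃ u, u ≠ x ∧ u ≠ y ∧ e = {x, y, u} := by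
  have h1 : ((e.erase x).erase y).card = 1 := by
    rw [Finset.card_erase_of_mem (by simp [hy, hxy.symm]), Finset.card_erase_of_mem hx, he]
  obtain ⟨u, hu⟩ := Finset.card_eq_one.1 h1
  have hu' : u ∈ (e.erase x).erase y := by simp [hu]
  simp only [Finset.mem_erase] at hu'
  refine ⟨u, hu'.2.1, hu'.1, ?_⟩
  ext t
  have := Finset.ext_iff.1 hu t
  simp only [Finset.mem_erase, Finset.mem_singleton] at this
  simp only [Finset.mem_insert, Finset.mem_singleton]
  grind

theorem exists_two_of_mem {e : Finset V} (he : e.card = 3) {x : V} (hx : x ∈ e) :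
    ∃ y z, y ≠ x ∧ z ≠ x ∧ y ≠ z ∧ e = {x, y, z} := by
  obtain ⟨y, hy, hyx⟩ := Finset.exists_mem_ne (by omega : 1 < e.card) x
  obtain ⟨u, h1, h2, h3⟩ := exists_third he hx hy hyx.symm
  exact ⟨y, u, hyx, h1, h2.symm, h3⟩

theorem exists_other_two {Q : Finset V} (hQ : Q.card = 4) {x y : V} (hx : x ∈ Q) (hy : y ∈ Q)
    (hxy : x ≠ y) : ∃ u v, u ≠ x ∧ u ≠ y ∧ v ≠ x ∧ v ≠ y ∧ u ≠ v ∧ Q = {x, y, u, v} := by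
  have h1 : (Q.erase x).card = 3 := by rw [Finset.card_erase_of_mem hx, hQ]
  obtain ⟨u, v, hu, hv, huv, h⟩ := exists_two_of_mem h1 (x := y) (by simp [hy, hxy.symm])
  have hu' : u ∈ Q.erase x := by simp [h]
  have hv' : v ∈ Q.erase x := by simp [h]
  refine ⟨u, v, (Finset.mem_erase.1 hu').1, hu, (Finset.mem_erase.1 hv').1, hv, huv, ?_⟩
  rw [← Finset.insert_erase hx, h]

variable {F : Finset (Finset V)}

theorem IsBlock.triple_mem {Q : Finset V} (hQ : IsBlock F Q) {a b c : V} (ha : a ∈ Q) (hb : b ∈ Q)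
    (hc : c ∈ Q) (hab : a ≠ b) (hac : a ≠ c) (hbc : b ≠ c) : ({a, b, c} : Finset V) ∈ F :=
  hQ.mem (by simp [Finset.insert_subset_iff, ha, hb, hc]) (Finset.card_eq_three.2
    ⟨a, b, c, hab, hac, hbc, rfl⟩)

/-- A triple with two vertices in a block is contained in it. -/
theorem Closed.subset_of_two_mem (hF : Closed F) {Q e : Finset V} (hQ : IsBlock F Q) (he : e ∈ F)
    {a b : V} (hab : a ≠ b) (hae : a ∈ e) (hbe : b ∈ e) (haQ : a ∈ Q) (hbQ : b ∈ Q) : e ⊆ Q := by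
  intro u hu
  by_contra huQ
  obtain ⟨c, d, hca, hcb, hda, hdb, hcd, rfl⟩ := exists_other_two hQ.1 haQ hbQ hab
  have h1 : ({b, c, d} : Finset V) ∈ F := hQ.triple_mem (by simp) (by simp) (by simp)
    hcb.symm hdb.symm hcd
  have h2 : ({a, c, d} : Finset V) ∈ F := hQ.triple_mem (by simp) (by simp) (by simp)
    hca.symm hda.symm hcd
  obtain ⟨Q', hQ', h3, h4, h5⟩ := hF.exists_block a b c e {b, c, d} {a, c, d} hab hcb.symm hca.symm
    he h1 h2 (by rintro rfl; grind) (by intro h; have := Finset.ext_iff.1 h a; grind)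
    (by rintro rfl; grind) hae hbe (by simp) (by simp) (by simp) (by simp)
  have h6 : insert u ({a, b, c, d} : Finset V) ⊆ Q' := by
    intro t ht
    simp only [Finset.mem_insert, Finset.mem_singleton] at ht
    rcases ht with rfl | rfl | rfl | rfl | rfl
    · exact h3 hu
    · exact h3 hae
    · exact h3 hbe
    · exact h4 (by simp)
    · exact h4 (by simp)
  have := Finset.card_le_card h6
  rw [Finset.card_insert_of_notMem huQ, hQ.1, hQ'.1] at this
  omega

theorem Closed.block_eq (hF : Closed F) {Q Q' : Finset V} (hQ : IsBlock F Q) (hQ' : IsBlock F Q')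
    {a b : V} (hab : a ≠ b) (ha : a ∈ Q) (hb : b ∈ Q) (ha' : a ∈ Q') (hb' : b ∈ Q') : Q = Q' := by
  refine (eq_of_subset_card hQ'.1 hQ.1 fun u hu => ?_).symm
  by_cases h1 : u = a
  · rwa [h1]
  by_cases h2 : u = b
  · rwa [h2]
  exact hF.subset_of_two_mem hQ (hQ'.triple_mem ha' hb' hu hab (Ne.symm h1) (Ne.symm h2)) hab
    (by simp) (by simp) ha hb (by simp)

/-- A vertex outside a block is joined to at most one of its vertices. -/
theorem Closed.eq_of_adj_block (hF : Closed F) {Q f g : Finset V} (hQ : IsBlock F Q) {x a b : V}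
    (hx : x ∉ Q) (ha : a ∈ Q) (hb : b ∈ Q) (hf : f ∈ F) (hg : g ∈ F) (hxf : x ∈ f) (haf : a ∈ f)
    (hxg : x ∈ g) (hbg : b ∈ g) : a = b := by
  by_contra hab
  have hfg : f ≠ g := by
    rintro rfl
    exact hx (hF.subset_of_two_mem hQ hf hab haf hbg ha hb hxf)
  obtain ⟨c, d, hca, hcb, hda, hdb, hcd, hQe⟩ := exists_other_two hQ.1 ha hb hab
  have hc : c ∈ Q := by simp [hQe]
  have he : ({a, b, c} : Finset V) ∈ F := hQ.triple_mem ha hb hc hab hca.symm hcb.symm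
  have hxe : x ∉ ({a, b, c} : Finset V) := by
    intro h
    simp only [Finset.mem_insert, Finset.mem_singleton] at h
    rcases h with rfl | rfl | rfl <;> contradiction
  have hxa : x ≠ a := by rintro rfl; exact hx ha
  have hxb : x ≠ b := by rintro rfl; exact hx hb
  obtain ⟨Q', hQ', h3, h4, h5⟩ := hF.exists_block a b x {a, b, c} g f hab hxb.symm hxa.symm
    he hg hf (by rintro rfl; exact hxe hxg) hfg.symm
    (by rintro rfl; exact hxe hxf) (by simp) (by simp) hbg hxg haf hxf
  have := hF.block_eq hQ hQ' hab ha hb (h3 (by simp)) (h3 (by simp))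
  exact hx (this ▸ h4 hxg)

/-- The blocks of `F`, as a finite set. -/
def blocks (F : Finset (Finset V)) : Finset (Finset V) :=
  ((F.biUnion id).powersetCard 4).filter fun Q => Q.powersetCard 3 ⊆ F

theorem IsBlock.exists_triple {Q : Finset V} (hQ : IsBlock F Q) {x : V} (hx : x ∈ Q) :
    ∃ e ∈ F, x ∈ e ∧ e ⊆ Q := by
  obtain ⟨y, hy, hyx⟩ := Finset.exists_mem_ne (by have := hQ.1; omega : 1 < Q.card) x
  obtain ⟨u, v, h1, h2, -, -, -, h3⟩ := exists_other_two hQ.1 hx hy hyx.symm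
  have hu : u ∈ Q := by simp [h3]
  exact ⟨{x, y, u}, hQ.triple_mem hx hy hu hyx.symm h1.symm h2.symm, by simp,
    by simp [Finset.insert_subset_iff, hx, hy, hu]⟩

theorem IsBlock.exists_triple_pair {Q : Finset V} (hQ : IsBlock F Q) {x y : V} (hx : x ∈ Q)
    (hy : y ∈ Q) (hxy : x ≠ y) : ∃ e ∈ F, x ∈ e ∧ y ∈ e ∧ e ⊆ Q := by
  obtain ⟨u, v, h1, h2, -, -, -, h3⟩ := exists_other_two hQ.1 hx hy hxy
  have hu : u ∈ Q := by simp [h3]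
  exact ⟨{x, y, u}, hQ.triple_mem hx hy hu hxy h1.symm h2.symm, by simp, by simp,
    by simp [Finset.insert_subset_iff, hx, hy, hu]⟩

theorem mem_blocks {Q : Finset V} : Q ∈ blocks F ↔ IsBlock F Q := by
  constructor
  · intro h
    simp only [blocks, Finset.mem_filter, Finset.mem_powersetCard] at h
    exact ⟨h.1.2, h.2⟩
  · intro h
    simp only [blocks, Finset.mem_filter, Finset.mem_powersetCard]
    refine ⟨⟨fun x hx => ?_, h.1⟩, h.2⟩
    obtain ⟨e, he, hxe, -⟩ := h.exists_triple hx
    exact Finset.mem_biUnion.2 ⟨e, he, hxe⟩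

theorem IsBlock.subset {S Q : Finset V} (hQ : IsBlock F Q) (hS : ∀ e ∈ F, e ⊆ S) : Q ⊆ S := by
  intro x hx
  obtain ⟨e, he, hxe, -⟩ := hQ.exists_triple hx
  exact hS e he hxe

/-- The triples of `F` that lie in no block. -/
def normal (F : Finset (Finset V)) : Finset (Finset V) :=
  F.filter fun e => ∀ Q ∈ blocks F, ¬ e ⊆ Q

theorem mem_normal {e : Finset V} :
    e ∈ normal F ↔ e ∈ F ∧ ∀ Q, IsBlock F Q → ¬ e ⊆ Q := by
  simp [normal, mem_blocks]

/-- `c` is a centre of the triple `e`: both pairs of `e` at `c` are private, that is, contained in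
no other triple. -/
def IsCenter (F : Finset (Finset V)) (e : Finset V) (c : V) : Prop :=
  c ∈ e ∧ ∀ f ∈ F, c ∈ f → ∀ u ∈ e, u ≠ c → u ∈ f → f = e

/-- At most one pair of a triple outside all blocks is covered by another triple: two such pairs
would give a triangle. The vertex opposite that pair is a centre. -/
theorem Closed.exists_center (hF : Closed F) {e : Finset V} (he : e ∈ normal F) :
    ∃ c, IsCenter F e c := by
  rw [mem_normal] at he
  obtain ⟨heF, hen⟩ := he
  have h3 := hF.card_eq e heF
  have key : ∀ x y z f g, x ≠ y → x ≠ z → y ≠ z → x ∈ e → y ∈ e → z ∈ e → f ∈ F → g ∈ F →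
      f ≠ e → g ≠ e → x ∈ f → y ∈ f → x ∈ g → z ∈ g → False := by
    intro x y z f g hxy hxz hyz hx hy hz hf hg hfe hge h1 h2 h3 h4
    have hfg : f ≠ g := by
      rintro rfl
      obtain ⟨u, hux, huy, he⟩ := exists_third (hF.card_eq e heF) hx hy hxy
      have : z = u := by rw [he] at hz; grind
      subst this
      exact hfe (eq_of_subset_card (hF.card_eq _ heF) (hF.card_eq _ hf)
        (by simp [he, Finset.insert_subset_iff, h1, h2, h4])).symm
    obtain ⟨Q, hQ, -, -, h⟩ := hF.exists_block y x z f g e hxy.symm hxz hyz hf hg heF hfg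
      hge hfe h2 h1 h3 h4 hy hz
    exact hen Q hQ h
  obtain ⟨x, y, z, hxy, hxz, hyz, he⟩ := Finset.card_eq_three.1 h3
  have hx : x ∈ e := by simp [he]
  have hy : y ∈ e := by simp [he]
  have hz : z ∈ e := by simp [he]
  have hcase : ∀ u ∈ e, u = x ∨ u = y ∨ u = z := by
    intro u hu
    simpa [he] using hu
  by_cases s1 : ∃ f ∈ F, f ≠ e ∧ x ∈ f ∧ y ∈ f
  · obtain ⟨f, hf, hfe, hxf, hyf⟩ := s1
    refine ⟨z, hz, fun g hg hzg u hu huz hug => ?_⟩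
    by_contra hge
    rcases hcase u hu with rfl | rfl | rfl
    · exact key u y z f g hxy hxz hyz hx hy hz hf hg hfe hge hxf hyf hug hzg
    · exact key u x z f g hxy.symm hyz hxz hy hx hz hf hg hfe hge hyf hxf hug hzg
    · exact huz rfl
  · by_cases s2 : ∃ f ∈ F, f ≠ e ∧ x ∈ f ∧ z ∈ f
    · obtain ⟨f, hf, hfe, hxf, hzf⟩ := s2
      refine ⟨y, hy, fun g hg hyg u hu huz hug => ?_⟩
      by_contra hge
      rcases hcase u hu with rfl | rfl | rfl
      · exact s1 ⟨g, hg, hge, hug, hyg⟩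
      · exact huz rfl
      · exact key u x y f g hxz.symm hyz.symm hxy hz hx hy hf hg hfe hge hzf hxf hug hyg
    · refine ⟨x, hx, fun g hg hxg u hu huz hug => ?_⟩
      by_contra hge
      rcases hcase u hu with rfl | rfl | rfl
      · exact huz rfl
      · exact s1 ⟨g, hg, hge, hxg, hug⟩
      · exact s2 ⟨g, hg, hge, hxg, hug⟩

theorem Closed.not_block_pair (hF : Closed F) {e Q : Finset V} (he : e ∈ normal F)
    (hQ : IsBlock F Q) {x y : V} (hxy : x ≠ y) (hx : x ∈ e) (hy : y ∈ e) (hxQ : x ∈ Q)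
    (hyQ : y ∈ Q) : False := by
  rw [mem_normal] at he
  exact he.2 Q hQ (hF.subset_of_two_mem hQ he.1 hxy hx hy hxQ hyQ)

/-- A vertex joined to all three vertices of a triple lies in a block together with it. -/
theorem Closed.block_of_adj_triple (hF : Closed F) {g : Finset V} (hg : g ∈ F) {a : V} (ha : a ∉ g)
    (h : ∀ x ∈ g, ∃ f ∈ F, a ∈ f ∧ x ∈ f) : ∃ Q, IsBlock F Q ∧ g ⊆ Q ∧ a ∈ Q := by
  have key : ∀ x ∈ g, ∀ y ∈ g, x ≠ y → ∀ f ∈ F, ∀ f' ∈ F, f ≠ f' → a ∈ f → x ∈ f → a ∈ f' →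
      y ∈ f' → ∃ Q, IsBlock F Q ∧ g ⊆ Q ∧ a ∈ Q := by
    intro x hx y hy hxy f hf f' hf' hff h1 h2 h3 h4
    obtain ⟨Q, hQ, i1, i2, i3⟩ := hF.exists_block x a y f f' g (by rintro rfl; exact ha hx)
      (by rintro rfl; exact ha hy) hxy hf hf' hg hff (by rintro rfl; exact ha h3)
      (by rintro rfl; exact ha h1) h2 h1 h3 h4 hx hy
    exact ⟨Q, hQ, i3, i1 h1⟩
  obtain ⟨x, y, z, hxy, hxz, hyz, rfl⟩ := Finset.card_eq_three.1 (hF.card_eq g hg)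
  obtain ⟨f1, hf1, ha1, hx1⟩ := h x (by simp)
  obtain ⟨f2, hf2, ha2, hx2⟩ := h y (by simp)
  obtain ⟨f3, hf3, ha3, hx3⟩ := h z (by simp)
  by_cases h12 : f1 = f2
  · by_cases h13 : f1 = f3
    · subst h12; subst h13
      have : ({x, y, z} : Finset V) = f1 := eq_of_subset_card (hF.card_eq _ hg)
        (hF.card_eq _ hf1) (by simp [Finset.insert_subset_iff, hx1, hx2, hx3])
      exact absurd (this ▸ ha1) ha
    · exact key x (by simp) z (by simp) hxz f1 hf1 f3 hf3 h13 ha1 hx1 ha3 hx3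
  · exact key x (by simp) y (by simp) hxy f1 hf1 f2 hf2 h12 ha1 hx1 ha2 hx2

/-- If two triples outside the blocks share the pair `xy`, then every further triple that has two
vertices in their union contains `x` and `y`. -/
theorem Closed.pair_subset (hF : Closed F) {e e' f : Finset V} {x y : V} (he : e ∈ normal F)
    (he' : e' ∈ normal F) (hee : e ≠ e') (hxy : x ≠ y) (hx : x ∈ e) (hy : y ∈ e) (hx' : x ∈ e')
    (hy' : y ∈ e') (hf : f ∈ F) (hfe : f ≠ e) (hfe' : f ≠ e') {p q : V} (hpq : p ≠ q)
    (hp : p ∈ e ∪ e') (hq : q ∈ e ∪ e') (hpf : p ∈ f) (hqf : q ∈ f) : x ∈ f ∧ y ∈ f := by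
  have heF := (mem_normal.1 he).1
  have heF' := (mem_normal.1 he').1
  obtain ⟨c, hc, hce⟩ := hF.exists_center he
  obtain ⟨c', hc', hce'⟩ := hF.exists_center he'
  obtain ⟨z, hzx, hzy, rfl⟩ := exists_third (hF.card_eq e heF) hx hy hxy
  obtain ⟨w, hwx, hwy, rfl⟩ := exists_third (hF.card_eq e' heF') hx' hy' hxy
  have hzw : z ≠ w := by rintro rfl; exact hee rfl
  have hcz : c = z := by
    have := hce _ heF'
    simp only [Finset.mem_insert, Finset.mem_singleton] at hc this
    grind
  have hcw : c' = w := by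
    have := hce' _ heF
    simp only [Finset.mem_insert, Finset.mem_singleton] at hc' this
    grind
  subst hcz hcw
  have k1 := hce f hf
  have k2 := hce' f hf
  have k3 : ¬ (c ∈ f ∧ c' ∈ f) := by
    rintro ⟨h1, h2⟩
    obtain ⟨Q, hQ, -, h, -⟩ := hF.exists_block c c' x f {x, y, c'} {x, y, c} hzw hwx hzx hf heF' heF
      hfe' (Ne.symm hee) hfe h1 h2 (by simp) (by simp) (by simp) (by simp)
    exact (mem_normal.1 he').2 Q hQ h
  simp only [Finset.mem_union, Finset.mem_insert, Finset.mem_singleton] at hp hq k1 k2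
  grind

/-- The triples of `F` that avoid the set `T` of vertices. -/
def del (F : Finset (Finset V)) (T : Finset V) : Finset (Finset V) :=
  F.filter fun e => Disjoint e T

theorem mem_del {T e : Finset V} : e ∈ del F T ↔ e ∈ F ∧ Disjoint e T := by
  simp [del]

theorem isBlock_del {T Q : Finset V} : IsBlock (del F T) Q ↔ IsBlock F Q ∧ Disjoint Q T := by
  constructor
  · intro h
    refine ⟨⟨h.1, fun e he => (mem_del.1 (h.2 he)).1⟩, Finset.disjoint_left.2 fun x hx => ?_⟩
    obtain ⟨e, he, hxe, -⟩ := h.exists_triple hx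
    exact Finset.disjoint_left.1 (mem_del.1 he).2 hxe
  · rintro ⟨h, hd⟩
    refine ⟨h.1, fun e he => mem_del.2 ⟨h.2 he, ?_⟩⟩
    exact Finset.disjoint_of_subset_left (Finset.mem_powersetCard.1 he).1 hd

theorem Closed.closed_del (hF : Closed F) (T : Finset V) : Closed (del F T) := by
  refine ⟨fun e he => hF.card_eq e (mem_del.1 he).1, ?_⟩
  intro x y z e f g hxy hyz hxz he hf hg hef hfg heg h1 h2 h3 h4 h5 h6
  rw [mem_del] at he hf hg
  obtain ⟨Q, hQ, i1, i2, i3⟩ := hF.exists_block x y z e f g hxy hyz hxz he.1 hf.1 hg.1 hef hfg heg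
    h1 h2 h3 h4 h5 h6
  refine ⟨Q, isBlock_del.2 ⟨hQ, ?_⟩, i1, i2, i3⟩
  have hU : e ∪ f = Q := by
    refine Finset.eq_of_subset_of_card_le (Finset.union_subset i1 i2) ?_
    by_contra hlt
    have h7 : e = e ∪ f := Finset.eq_of_subset_of_card_le Finset.subset_union_left
      (by rw [hF.card_eq e he.1]; have := hQ.1; omega)
    have h8 : f = e ∪ f := Finset.eq_of_subset_of_card_le Finset.subset_union_right
      (by rw [hF.card_eq f hf.1]; have := hQ.1; omega)
    exact hef (h7.trans h8.symm)
  rw [← hU, Finset.disjoint_union_left]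
  exact ⟨he.2, hf.2⟩

theorem del_subset_sdiff {S T : Finset V} (hS : ∀ e ∈ F, e ⊆ S) : ∀ e ∈ del F T, e ⊆ S \ T := by
  intro e he x hx
  rw [mem_del] at he
  exact Finset.mem_sdiff.2 ⟨hS e he.1 hx, Finset.disjoint_left.1 he.2 hx⟩

theorem Closed.eq_normal_union (hF : Closed F) :
    F = normal F ∪ (blocks F).biUnion fun Q => Q.powersetCard 3 := by
  ext e
  simp only [Finset.mem_union, Finset.mem_biUnion, mem_normal, mem_blocks]
  constructor
  · intro he
    by_cases h : ∃ Q, IsBlock F Q ∧ e ⊆ Q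
    · obtain ⟨Q, hQ, h1⟩ := h
      exact Or.inr ⟨Q, hQ, Finset.mem_powersetCard.2 ⟨h1, hF.card_eq e he⟩⟩
    · exact Or.inl ⟨he, fun Q hQ hs => h ⟨Q, hQ, hs⟩⟩
  · rintro (h | ⟨Q, hQ, h⟩)
    · exact h.1
    · exact hQ.2 h

theorem Closed.block_eq_of_triple (hF : Closed F) {Q Q' e : Finset V} (hQ : IsBlock F Q)
    (hQ' : IsBlock F Q') (h3 : e.card = 3) (h : e ⊆ Q) (h' : e ⊆ Q') : Q = Q' := by
  obtain ⟨a, ha, b, hb, hab⟩ := Finset.one_lt_card.1 (by omega : 1 < e.card)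
  exact hF.block_eq hQ hQ' hab (h ha) (h hb) (h' ha) (h' hb)

theorem Closed.card_eq_normal_add (hF : Closed F) :
    F.card = (normal F).card + 4 * (blocks F).card := by
  conv_lhs => rw [hF.eq_normal_union]
  rw [Finset.card_union_of_disjoint, Finset.card_biUnion]
  · rw [Finset.sum_congr rfl fun Q hQ => card_block_triples (mem_blocks.1 hQ)]
    simp [mul_comm]
  · intro Q hQ Q' hQ' hne
    refine Finset.disjoint_left.2 fun e he he' => hne ?_
    rw [Finset.mem_powersetCard] at he he'
    exact hF.block_eq_of_triple (mem_blocks.1 hQ) (mem_blocks.1 hQ') he.2 he.1 he'.1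
  · refine Finset.disjoint_left.2 fun e he he' => ?_
    obtain ⟨Q, hQ, h⟩ := Finset.mem_biUnion.1 he'
    exact (mem_normal.1 he).2 Q (mem_blocks.1 hQ) (Finset.mem_powersetCard.1 h).1

/-- The triples through `x`. -/
def star (F : Finset (Finset V)) (x : V) : Finset (Finset V) := F.filter fun e => x ∈ e

theorem mem_star {x : V} {e : Finset V} : e ∈ star F x ↔ e ∈ F ∧ x ∈ e := by simp [star]

theorem card_block_triples_at {Q : Finset V} (hQ : Q.card = 4) {x : V} (hx : x ∈ Q) :
    ((Q.powersetCard 3).filter fun e => x ∈ e).card = 3 := by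
  have h1 : (Q.powersetCard 3).filter (fun e => ¬ x ∈ e) = {Q.erase x} := by
    ext e
    simp only [Finset.mem_filter, Finset.mem_powersetCard, Finset.mem_singleton]
    constructor
    · rintro ⟨⟨h1, h2⟩, h3⟩
      refine eq_of_subset_card h2 (by rw [Finset.card_erase_of_mem hx, hQ]) fun u hu => ?_
      exact Finset.mem_erase.2 ⟨by rintro rfl; exact h3 hu, h1 hu⟩
    · rintro rfl
      exact ⟨⟨Finset.erase_subset _ _, by rw [Finset.card_erase_of_mem hx, hQ]⟩,
        Finset.notMem_erase _ _⟩
  have h2 := Finset.card_filter_add_card_filter_not (s := Q.powersetCard 3) (fun e => x ∈ e)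
  rw [h1, Finset.card_singleton, Finset.card_powersetCard, hQ] at h2
  have : Nat.choose 4 3 = 4 := rfl
  omega

/-- The blocks through `x`. -/
def blocksAt (F : Finset (Finset V)) (x : V) : Finset (Finset V) :=
  (blocks F).filter fun Q => x ∈ Q

theorem mem_blocksAt {x : V} {Q : Finset V} : Q ∈ blocksAt F x ↔ IsBlock F Q ∧ x ∈ Q := by
  simp [blocksAt, mem_blocks]

theorem Closed.card_star (hF : Closed F) (x : V) :
    (star F x).card = ((normal F).filter fun e => x ∈ e).card + 3 * (blocksAt F x).card := by
  have h1 : star F x = ((normal F).filter fun e => x ∈ e) ∪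
      (blocksAt F x).biUnion fun Q => (Q.powersetCard 3).filter fun e => x ∈ e := by
    ext e
    rw [mem_star]
    conv_lhs => rw [hF.eq_normal_union]
    simp only [Finset.mem_union, Finset.mem_biUnion, Finset.mem_filter, mem_blocksAt, mem_blocks,
      Finset.mem_powersetCard]
    constructor
    · rintro ⟨h | ⟨Q, hQ, h⟩, hx⟩
      · exact Or.inl ⟨h, hx⟩
      · exact Or.inr ⟨Q, ⟨hQ, h.1 hx⟩, h, hx⟩
    · rintro (h | ⟨Q, hQ, h, hx⟩)
      · exact ⟨Or.inl h.1, h.2⟩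
      · exact ⟨Or.inr ⟨Q, hQ.1, h⟩, hx⟩
  rw [h1, Finset.card_union_of_disjoint, Finset.card_biUnion]
  · rw [Finset.sum_congr rfl fun Q hQ => card_block_triples_at (mem_blocksAt.1 hQ).1.1
      (mem_blocksAt.1 hQ).2]
    simp [mul_comm]
  · intro Q hQ Q' hQ' hne
    refine Finset.disjoint_left.2 fun e he he' => hne ?_
    rw [Finset.mem_filter, Finset.mem_powersetCard] at he he'
    exact hF.block_eq_of_triple (mem_blocksAt.1 hQ).1 (mem_blocksAt.1 hQ').1 he.1.2 he.1.1 he'.1.1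
  · refine Finset.disjoint_left.2 fun e he he' => ?_
    obtain ⟨Q, hQ, h⟩ := Finset.mem_biUnion.1 he'
    exact (mem_normal.1 (Finset.mem_filter.1 he).1).2 Q (mem_blocksAt.1 hQ).1
      (Finset.mem_powersetCard.1 (Finset.mem_filter.1 h).1).1

/-- The vertices joined to `x` by a triple. -/
def nbr (F : Finset (Finset V)) (x : V) : Finset V := ((star F x).biUnion id).erase x

theorem mem_nbr {x y : V} : y ∈ nbr F x ↔ y ≠ x ∧ ∃ e ∈ F, x ∈ e ∧ y ∈ e := by
  simp only [nbr, Finset.mem_erase, Finset.mem_biUnion, mem_star, id]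
  grind

/-- A vertex lies in at most as many triples as it has neighbours, and in fewer if one of the
triples is in no block: a triple outside the blocks has a neighbour of `x` of its own, and a triple
of a block is sent to the fourth vertex of the block. -/
theorem Closed.card_star_le (hF : Closed F) (x : V) :
    (star F x).card ≤ (nbr F x).card ∧
      (((normal F).filter fun e => x ∈ e).Nonempty → (star F x).card < (nbr F x).card) := by
  have hex : ∀ e ∈ star F x, ∃ p, p ≠ x ∧ p ∈ nbr F x ∧
      ((e ∈ normal F ∧ p ∈ e ∧ ∀ f ∈ F, x ∈ f → p ∈ f → f = e) ∨
       (p ∉ e ∧ ∃ Q, IsBlock F Q ∧ e ⊆ Q ∧ p ∈ Q)) := by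
    intro e he
    rw [mem_star] at he
    by_cases hn : e ∈ normal F
    · obtain ⟨c, hc, hce⟩ := hF.exists_center hn
      by_cases hcx : c = x
      · subst hcx
        obtain ⟨y, z, hy, -, -, hyz⟩ := exists_two_of_mem (hF.card_eq e he.1) hc
        have hye : y ∈ e := by simp [hyz]
        exact ⟨y, hy, mem_nbr.2 ⟨hy, e, he.1, hc, hye⟩, Or.inl ⟨hn, hye, fun f hf h1 h2 =>
          hce f hf h1 y hye hy h2⟩⟩
      · exact ⟨c, hcx, mem_nbr.2 ⟨hcx, e, he.1, he.2, hc⟩, Or.inl ⟨hn, hc, fun f hf h1 h2 =>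
          hce f hf h2 x he.2 (Ne.symm hcx) h1⟩⟩
    · rw [mem_normal] at hn
      push Not at hn
      obtain ⟨Q, hQ, heQ⟩ := hn he.1
      obtain ⟨p, hpQ, hpe⟩ := Finset.exists_mem_notMem_of_card_lt_card
        (by rw [hF.card_eq e he.1, hQ.1]; omega : e.card < Q.card)
      have hpx : p ≠ x := by rintro rfl; exact hpe he.2
      obtain ⟨f, hf, h1, h2, -⟩ := hQ.exists_triple_pair (heQ he.2) hpQ hpx.symm
      exact ⟨p, hpx, mem_nbr.2 ⟨hpx, f, hf, h1, h2⟩, Or.inr ⟨hpe, Q, hQ, heQ, hpQ⟩⟩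
  have : Nonempty V := ⟨x⟩
  choose! φ hφx hφn hφ using hex
  have hnb : ∀ e ∈ normal F, x ∈ e → ∀ p ∈ e, p ≠ x → ∀ Q, IsBlock F Q → p ∈ Q → x ∈ Q → False :=
    fun e he hxe p hp hpx Q hQ hpQ hxQ => hF.not_block_pair he hQ hpx hp hxe hpQ hxQ
  have hinj : Set.InjOn φ (star F x : Set (Finset V)) := by
    intro e he f hf hef
    have he' : e ∈ star F x := Finset.mem_coe.1 he
    have hf' : f ∈ star F x := Finset.mem_coe.1 hf
    rcases hφ e he' with ⟨h1, h2, h3⟩ | ⟨h1, Q, hQ, h2, h3⟩ <;>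
      rcases hφ f hf' with ⟨i1, i2, i3⟩ | ⟨i1, Q', hQ', i2, i3⟩
    · exact (h3 f (mem_star.1 hf').1 (mem_star.1 hf').2 (hef ▸ i2)).symm
    · exact (hnb e h1 (mem_star.1 he').2 _ h2 (hφx e he') Q' hQ' (hef ▸ i3)
        (i2 (mem_star.1 hf').2)).elim
    · exact (hnb f i1 (mem_star.1 hf').2 _ i2 (hφx f hf') Q hQ (hef ▸ h3)
        (h2 (mem_star.1 he').2)).elim
    · have hQQ : Q = Q' := hF.block_eq hQ hQ' (hφx e he') h3 (h2 (mem_star.1 he').2) (hef ▸ i3)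
        (i2 (mem_star.1 hf').2)
      subst hQQ
      have k1 : e = Q.erase (φ e) := eq_of_subset_card (hF.card_eq e (mem_star.1 he').1)
        (by rw [Finset.card_erase_of_mem h3, hQ.1]) fun u hu =>
          Finset.mem_erase.2 ⟨by rintro rfl; exact h1 hu, h2 hu⟩
      have k2 : f = Q.erase (φ f) := eq_of_subset_card (hF.card_eq f (mem_star.1 hf').1)
        (by rw [Finset.card_erase_of_mem i3, hQ.1]) fun u hu =>
          Finset.mem_erase.2 ⟨by rintro rfl; exact i1 hu, i2 hu⟩
      rw [k1, k2, hef]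
  have himg : (star F x).image φ ⊆ nbr F x := by
    intro p hp
    obtain ⟨e, he, rfl⟩ := Finset.mem_image.1 hp
    exact hφn e he
  rw [← Finset.card_image_of_injOn hinj]
  refine ⟨Finset.card_le_card himg, fun ⟨e, he⟩ => Finset.card_lt_card ?_⟩
  rw [Finset.mem_filter] at he
  have heF := (mem_normal.1 he.1).1
  have hes : e ∈ star F x := mem_star.2 ⟨heF, he.2⟩
  have hpe : φ e ∈ e := by
    rcases hφ e hes with h | ⟨-, Q, hQ, h, -⟩
    · exact h.2.1
    · exact ((mem_normal.1 he.1).2 Q hQ h).elim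
  obtain ⟨v, hvx, hvp, hev⟩ := exists_third (hF.card_eq e heF) he.2 hpe (hφx e hes).symm
  have hve : v ∈ e := by rw [hev]; simp
  refine (Finset.ssubset_iff_of_subset himg).2 ⟨v, mem_nbr.2 ⟨hvx, e, heF, he.2, hve⟩, fun h => ?_⟩
  obtain ⟨f, hf, hfv⟩ := Finset.mem_image.1 h
  rcases hφ f hf with ⟨-, h2, h3⟩ | ⟨-, Q, hQ, h2, h3⟩
  · have := h3 e heF he.2 (hfv ▸ hve)
    subst this
    exact hvp hfv.symm
  · exact hnb e he.1 he.2 v hve hvx Q hQ (hfv ▸ h3) (h2 (mem_star.1 hf).2)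

end

section

/-! ### The graph of private pairs -/

variable {V : Type*} [DecidableEq V] {F : Finset (Finset V)}

/-- A choice of a centre for each triple outside the blocks. -/
def IsCenters (F : Finset (Finset V)) (c : Finset V → V) : Prop :=
  ∀ e ∈ normal F, IsCenter F e (c e)

theorem Closed.exists_centers [Nonempty V] (hF : Closed F) : ∃ c, IsCenters F c := by
  have h : ∀ e ∈ normal F, ∃ c, IsCenter F e c := fun e he => hF.exists_center he
  choose! c hc using h
  exact ⟨c, hc⟩

/-- The graph whose edges join the centre of each triple outside the blocks to the two other
vertices of the triple. Each of these pairs is covered by this triple only. -/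
def HAdj (F : Finset (Finset V)) (c : Finset V → V) (x y : V) : Prop :=
  x ≠ y ∧ ∃ e ∈ normal F, x ∈ e ∧ y ∈ e ∧ (c e = x ∨ c e = y)

instance (F : Finset (Finset V)) (c : Finset V → V) (x y : V) : Decidable (HAdj F c x y) := by
  unfold HAdj; infer_instance

variable {c : Finset V → V}

theorem HAdj.symm {x y : V} (h : HAdj F c x y) : HAdj F c y x := by
  obtain ⟨hxy, e, he, hx, hy, hc⟩ := h
  exact ⟨hxy.symm, e, he, hy, hx, hc.symm⟩

theorem IsCenters.unique (hc : IsCenters F c) {e f : Finset V} {x y : V} (he : e ∈ normal F)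
    (hxy : x ≠ y) (hx : x ∈ e) (hy : y ∈ e) (h : c e = x ∨ c e = y) (hf : f ∈ F) (hxf : x ∈ f)
    (hyf : y ∈ f) : f = e := by
  rcases h with rfl | rfl
  · exact (hc e he).2 f hf hxf y hy hxy.symm hyf
  · exact (hc e he).2 f hf hyf x hx hxy hxf

/-- The neighbours of `x` in the graph of private pairs. -/
def hnbr (F : Finset (Finset V)) (c : Finset V → V) (x : V) : Finset V :=
  (nbr F x).filter (HAdj F c x)

theorem mem_hnbr {x y : V} : y ∈ hnbr F c x ↔ HAdj F c x y := by
  rw [hnbr, Finset.mem_filter, and_iff_right_iff_imp]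
  rintro ⟨hxy, e, he, hx, hy, -⟩
  exact mem_nbr.2 ⟨hxy.symm, e, (mem_normal.1 he).1, hx, hy⟩

theorem hnbr_subset (x : V) : hnbr F c x ⊆ nbr F x := Finset.filter_subset _ _

theorem nbr_subset {S : Finset V} (hS : ∀ e ∈ F, e ⊆ S) (x : V) : nbr F x ⊆ S := by
  intro y hy
  obtain ⟨-, e, he, -, h⟩ := mem_nbr.1 hy
  exact hS e he h

theorem card_hnbr (hF : Closed F) (hc : IsCenters F c) (x : V) :
    (hnbr F c x).card =
      ∑ e ∈ normal F, if x ∈ e then (if c e = x then 2 else 1) else 0 := by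
  have h1 : hnbr F c x = ((normal F).filter (x ∈ ·)).biUnion fun e =>
      (e.erase x).filter fun u => c e = x ∨ c e = u := by
    ext y
    simp only [mem_hnbr, HAdj, Finset.mem_biUnion, Finset.mem_filter, Finset.mem_erase]
    grind
  rw [h1, Finset.card_biUnion, Finset.sum_filter]
  · refine Finset.sum_congr rfl fun e he => ?_
    by_cases hx : x ∈ e
    · simp only [hx, if_true]
      have h3 := hF.card_eq e (mem_normal.1 he).1
      split_ifs with h
      · simp [h, Finset.card_erase_of_mem hx, h3]
      · have : (e.erase x).filter (fun u => c e = x ∨ c e = u) = {c e} := by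
          ext u
          simp only [Finset.mem_filter, Finset.mem_erase, Finset.mem_singleton, h, false_or]
          have := (hc e he).1
          grind
        rw [this, Finset.card_singleton]
    · simp [hx]
  · intro e he f hf hef
    refine Finset.disjoint_left.2 fun y hy hy' => hef ?_
    rw [Finset.mem_coe, Finset.mem_filter] at he hf
    simp only [Finset.mem_filter, Finset.mem_erase] at hy hy'
    exact hc.unique hf.1 hy.1.1.symm hf.2 hy'.1.2 hy'.2 (mem_normal.1 he.1).1 he.2 hy.1.2

theorem sum_card_hnbr (hF : Closed F) (hc : IsCenters F c) {S : Finset V}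
    (hS : ∀ e ∈ F, e ⊆ S) : ∑ x ∈ S, (hnbr F c x).card = 4 * (normal F).card := by
  simp_rw [card_hnbr hF hc]
  rw [Finset.sum_comm, mul_comm, ← smul_eq_mul]
  refine Finset.sum_eq_card_nsmul fun e he => ?_
  have heF := (mem_normal.1 he).1
  rw [← Finset.sum_filter, Finset.filter_mem_eq_inter, Finset.inter_eq_right.2 (hS e heF)]
  have : ∀ x ∈ e, (if c e = x then 2 else 1) = 1 + if c e = x then 1 else 0 := by
    intro x _; split_ifs <;> rfl
  rw [Finset.sum_congr rfl this, Finset.sum_add_distrib, Finset.sum_ite_eq, if_pos (hc e he).1]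
  simp [hF.card_eq e heF]

/-- The neighbours of `x` by private pairs or within a block. -/
def gnbr (F : Finset (Finset V)) (c : Finset V → V) (x : V) : Finset V :=
  hnbr F c x ∪ (blocksAt F x).biUnion fun Q => Q.erase x

theorem mem_gnbr {x y : V} : y ∈ gnbr F c x ↔
    HAdj F c x y ∨ (y ≠ x ∧ ∃ Q, IsBlock F Q ∧ x ∈ Q ∧ y ∈ Q) := by
  simp only [gnbr, Finset.mem_union, mem_hnbr, Finset.mem_biUnion, mem_blocksAt, Finset.mem_erase]
  grind

theorem card_gnbr (hF : Closed F) (x : V) :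
    (gnbr F c x).card = (hnbr F c x).card + 3 * (blocksAt F x).card := by
  rw [gnbr, Finset.card_union_of_disjoint, Finset.card_biUnion]
  · rw [Finset.sum_congr rfl fun Q hQ => show (Q.erase x).card = 3 by
      rw [Finset.card_erase_of_mem (mem_blocksAt.1 hQ).2, (mem_blocksAt.1 hQ).1.1]]
    simp [mul_comm]
  · intro Q hQ Q' hQ' hne
    refine Finset.disjoint_left.2 fun y hy hy' => hne ?_
    have h1 := mem_blocksAt.1 hQ
    have h2 := mem_blocksAt.1 hQ'
    rw [Finset.mem_erase] at hy hy'
    exact hF.block_eq h1.1 h2.1 hy.1 hy.2 h1.2 hy'.2 h2.2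
  · refine Finset.disjoint_left.2 fun y hy hy' => ?_
    obtain ⟨hxy, e, he, hx, hye, -⟩ := mem_hnbr.1 hy
    obtain ⟨Q, hQ, hyQ⟩ := Finset.mem_biUnion.1 hy'
    have h1 := mem_blocksAt.1 hQ
    exact hF.not_block_pair he h1.1 hxy hx hye h1.2 (Finset.mem_erase.1 hyQ).2

theorem gnbr_subset (x : V) : gnbr F c x ⊆ nbr F x := by
  intro y hy
  rcases mem_gnbr.1 hy with h | ⟨hyx, Q, hQ, hx, hyQ⟩
  · exact hnbr_subset x (mem_hnbr.2 h)
  · obtain ⟨e, he, h1, h2, -⟩ := hQ.exists_triple_pair hx hyQ hyx.symm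
    exact mem_nbr.2 ⟨hyx, e, he, h1, h2⟩

/-- Vertices joined by a private pair have no common neighbour. -/
theorem HAdj.disjoint_gnbr (hF : Closed F) (hc : IsCenters F c) {x y : V} (h : HAdj F c x y) :
    Disjoint (gnbr F c x) (gnbr F c y) := by
  refine Finset.disjoint_left.2 fun z hzx hzy => ?_
  obtain ⟨hxy, e, he, hx, hy, hce⟩ := h
  have heF := (mem_normal.1 he).1
  have hx' := mem_nbr.1 (gnbr_subset x hzx)
  have hy' := mem_nbr.1 (gnbr_subset y hzy)
  by_cases hze : z ∈ e
  · have key : ∀ w ∈ e, z ≠ w → z ∈ gnbr F c w → c e = w ∨ c e = z := by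
      intro w hw hzw hg
      rcases mem_gnbr.1 hg with ⟨-, f, hf, h1, h2, h3⟩ | ⟨-, Q, hQ, h1, h2⟩
      · have := hc.unique hf hzw.symm h1 h2 h3 heF hw hze
        rwa [this]
      · exact (hF.not_block_pair he hQ hzw hze hw h2 h1).elim
    have h1 := key x hx hx'.1 hzx
    have h2 := key y hy hy'.1 hzy
    have h3 := hx'.1
    have h4 := hy'.1
    grind
  · obtain ⟨-, f, hf, hxf, hzf⟩ := id hx'
    obtain ⟨-, g, hg, hyg, hzg⟩ := id hy'
    have hfg : f ≠ g := by
      rintro rfl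
      exact hze (hc.unique he hxy hx hy hce hf hxf hyg ▸ hzf)
    obtain ⟨Q, hQ, h1, -, -⟩ := hF.exists_block x y z e g f hxy hy'.1.symm hx'.1.symm heF hg hf
      (by rintro rfl; exact hze hzg) hfg.symm (by rintro rfl; exact hze hzf) hx hy hyg hzg hxf hzf
    exact (mem_normal.1 he).2 Q hQ h1

theorem HAdj.card_add_le (hF : Closed F) (hc : IsCenters F c) {S : Finset V}
    (hS : ∀ e ∈ F, e ⊆ S) {x y : V} (h : HAdj F c x y) :
    (gnbr F c x).card + (gnbr F c y).card ≤ S.card := by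
  rw [← Finset.card_union_of_disjoint (h.disjoint_gnbr hF hc)]
  exact Finset.card_le_card (Finset.union_subset ((gnbr_subset x).trans (nbr_subset hS x))
    ((gnbr_subset y).trans (nbr_subset hS y)))

theorem IsBlock.erase_subset_nbr {Q : Finset V} (hQ : IsBlock F Q) {x : V} (hx : x ∈ Q) :
    Q.erase x ⊆ nbr F x := by
  intro y hy
  rw [Finset.mem_erase] at hy
  obtain ⟨e, he, h1, h2, -⟩ := hQ.exists_triple_pair hx hy.2 hy.1.symm
  exact mem_nbr.2 ⟨hy.1, e, he, h1, h2⟩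

theorem Closed.disjoint_nbr_sdiff (hF : Closed F) {Q : Finset V} (hQ : IsBlock F Q) {x y : V}
    (hx : x ∈ Q) (hy : y ∈ Q) (hxy : x ≠ y) : Disjoint (nbr F x \ Q) (nbr F y \ Q) := by
  refine Finset.disjoint_left.2 fun z hz hz' => hxy ?_
  rw [Finset.mem_sdiff, mem_nbr] at hz hz'
  obtain ⟨⟨-, f, hf, hxf, hzf⟩, hzQ⟩ := hz
  obtain ⟨⟨-, g, hg, hyg, hzg⟩, -⟩ := hz'
  exact hF.eq_of_adj_block hQ hzQ hx hy hf hg hzf hxf hzg hyg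

theorem IsBlock.card_nbr {Q : Finset V} (hQ : IsBlock F Q) {x : V} (hx : x ∈ Q) :
    (nbr F x).card = 3 + (nbr F x \ Q).card := by
  have h : nbr F x ∩ Q = Q.erase x := by
    ext y
    have h1 : y ∈ Q.erase x → y ∈ nbr F x := fun h => hQ.erase_subset_nbr hx h
    simp only [Finset.mem_inter, Finset.mem_erase, mem_nbr] at h1 ⊢
    grind
  rw [← Finset.card_inter_add_card_sdiff (nbr F x) Q, h, Finset.card_erase_of_mem hx, hQ.1]

/-- The four vertices of a block have few neighbours in total. -/
theorem Closed.sum_card_nbr_le (hF : Closed F) {S : Finset V} (hS : ∀ e ∈ F, e ⊆ S) {Q : Finset V}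
    (hQ : IsBlock F Q) : ∑ x ∈ Q, (nbr F x).card ≤ S.card + 8 := by
  rw [Finset.sum_congr rfl fun x hx => hQ.card_nbr hx, Finset.sum_add_distrib,
    ← Finset.card_biUnion fun x hx y hy hxy => hF.disjoint_nbr_sdiff hQ hx hy hxy]
  have h1 : Q.biUnion (fun x => nbr F x \ Q) ⊆ S \ Q := by
    intro y hy
    obtain ⟨x, -, hx⟩ := Finset.mem_biUnion.1 hy
    rw [Finset.mem_sdiff] at hx ⊢
    exact ⟨nbr_subset hS x hx.1, hx.2⟩
  have h2 := Finset.card_le_card h1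
  have h3 := hQ.subset hS
  have h4 := Finset.card_le_card h3
  rw [Finset.card_sdiff_of_subset h3] at h2
  simp only [Finset.sum_const, hQ.1, smul_eq_mul] at *
  omega

theorem sum_mul_card_blocksAt {S : Finset V} (hS : ∀ e ∈ F, e ⊆ S) (g : V → ℕ) :
    ∑ x ∈ S, g x * (blocksAt F x).card = ∑ Q ∈ blocks F, ∑ x ∈ Q, g x := by
  have h1 : ∀ x ∈ S, g x * (blocksAt F x).card = ∑ Q ∈ blocksAt F x, g x := by
    intro x _
    rw [Finset.sum_const, smul_eq_mul, mul_comm]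
  rw [Finset.sum_congr rfl h1]
  refine Finset.sum_comm' fun x Q => ?_
  rw [mem_blocksAt, mem_blocks]
  exact ⟨fun h => ⟨h.2.2, h.2.1⟩, fun h => ⟨h.2.subset hS h.1, h.2, h.1⟩⟩

theorem sum_card_blocksAt {S : Finset V} (hS : ∀ e ∈ F, e ⊆ S) :
    ∑ x ∈ S, (blocksAt F x).card = 4 * (blocks F).card := by
  have h := sum_mul_card_blocksAt hS fun _ => 1
  simp only [one_mul, Finset.sum_const, smul_eq_mul, mul_one] at h
  rw [h, mul_comm, ← smul_eq_mul]
  exact Finset.sum_eq_card_nsmul fun Q hQ => (mem_blocks.1 hQ).1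

/-- Each private pair `xy` contributes `d(x) + d(y) ≤ |S|` to the sum of `d(x) h(x)`. -/
theorem Closed.sum_gnbr_mul_hnbr_le (hF : Closed F) (hc : IsCenters F c) {S : Finset V}
    (hS : ∀ e ∈ F, e ⊆ S) :
    2 * ∑ x ∈ S, (gnbr F c x).card * (hnbr F c x).card ≤ S.card * ∑ x ∈ S, (hnbr F c x).card := by
  have h1 : ∀ g : V → ℕ, ∑ x ∈ S, g x * (hnbr F c x).card =
      ∑ p ∈ (S ×ˢ S).filter (fun p => HAdj F c p.1 p.2), g p.1 := by
    intro g
    rw [Finset.sum_filter, Finset.sum_product]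
    refine Finset.sum_congr rfl fun x hx => ?_
    rw [← Finset.sum_filter, Finset.sum_const (g x), smul_eq_mul, mul_comm]
    congr 2
    ext y
    simp only [mem_hnbr, Finset.mem_filter]
    exact ⟨fun h => ⟨nbr_subset hS x (hnbr_subset x (mem_hnbr.2 h)), h⟩, fun h => h.2⟩
  have h2 : ∑ p ∈ (S ×ˢ S).filter (fun p => HAdj F c p.1 p.2), (gnbr F c p.1).card =
      ∑ p ∈ (S ×ˢ S).filter (fun p => HAdj F c p.1 p.2), (gnbr F c p.2).card := by
    refine Finset.sum_nbij' Prod.swap Prod.swap ?_ ?_ ?_ ?_ ?_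
    · intro p hp
      simp only [Finset.mem_filter, Finset.mem_product, Prod.fst_swap, Prod.snd_swap] at hp ⊢
      exact ⟨hp.1.symm, hp.2.symm⟩
    · intro p hp
      simp only [Finset.mem_filter, Finset.mem_product, Prod.fst_swap, Prod.snd_swap] at hp ⊢
      exact ⟨hp.1.symm, hp.2.symm⟩
    · simp
    · simp
    · simp
  have h3 := h1 fun _ => 1
  simp only [one_mul] at h3
  have h4 : 2 * ∑ x ∈ S, (gnbr F c x).card * (hnbr F c x).card =
      ∑ p ∈ (S ×ˢ S).filter (fun p => HAdj F c p.1 p.2),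
        ((gnbr F c p.1).card + (gnbr F c p.2).card) := by
    rw [Finset.sum_add_distrib, ← h2, h1, two_mul]
  rw [h4, h3, Finset.mul_sum]
  refine Finset.sum_le_sum fun p hp => ?_
  rw [mul_one]
  exact (Finset.mem_filter.1 hp).2.card_add_le hF hc hS

theorem Closed.sum_gnbr_mul_blocksAt_le (hF : Closed F) {S : Finset V}
    (hS : ∀ e ∈ F, e ⊆ S) :
    ∑ x ∈ S, (gnbr F c x).card * (blocksAt F x).card ≤ (S.card + 8) * (blocks F).card := by
  rw [sum_mul_card_blocksAt hS, mul_comm, ← smul_eq_mul]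
  refine Finset.sum_le_card_nsmul _ _ _ fun Q hQ => ?_
  exact (Finset.sum_le_sum fun x _ => Finset.card_le_card (gnbr_subset x)).trans
    (hF.sum_card_nbr_le hS (mem_blocks.1 hQ))

end

section

/-! ### Mantel's theorem and near-extremal triangle-free graphs -/

variable {V : Type*} [DecidableEq V]

/-- Mantel's bound with its error terms, where `N` is the neighbourhood of a vertex of maximum
degree: the slack is accounted for by the edges outside `N` and by the vertices outside `N` of
smaller degree. -/
theorem mantel_identity (S : Finset V) (H : V → V → Prop) [DecidableRel H]
    (hsymm : ∀ x y, H x y → H y x) (htri : ∀ x y z, H x y → H y z → H x z → False) :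
    ∃ N ⊆ S, (∀ x ∈ N, ∀ y ∈ N, ¬ H x y) ∧
      (∀ x ∈ S, (S.filter (H x)).card ≤ N.card) ∧
      ∑ x ∈ S, (S.filter (H x)).card + ∑ z ∈ S \ N, ((S \ N).filter (H z)).card +
        2 * ∑ z ∈ S \ N, (N.card - (S.filter (H z)).card) = 2 * ((S \ N).card * N.card) := by
  rcases S.eq_empty_or_nonempty with rfl | hne
  · exact ⟨∅, by simp⟩
  obtain ⟨v, hv, hmax⟩ := S.exists_max_image (fun x => (S.filter (H x)).card) hne
  refine ⟨S.filter (H v), Finset.filter_subset _ _, ?_, hmax, ?_⟩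
  · intro x hx y hy hxy
    exact htri v x y (Finset.mem_filter.1 hx).2 hxy (Finset.mem_filter.1 hy).2
  set N := S.filter (H v) with hN
  have hNS : N ⊆ S := Finset.filter_subset _ _
  have h1 : ∀ x ∈ S, (S.filter (H x)).card =
      (N.filter (H x)).card + ((S \ N).filter (H x)).card := by
    intro x _
    rw [← Finset.card_union_of_disjoint, ← Finset.filter_union, Finset.union_sdiff_of_subset hNS]
    exact Finset.disjoint_filter_filter Finset.disjoint_sdiff
  have h2 : ∑ x ∈ N, (S.filter (H x)).card = ∑ z ∈ S \ N, (N.filter (H z)).card := by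
    have h3 : ∀ x ∈ N, (S.filter (H x)).card = ((S \ N).filter (H x)).card := by
      intro x hx
      rw [h1 x (hNS hx), Finset.card_eq_zero.2, zero_add]
      refine Finset.filter_eq_empty_iff.2 fun y hy hxy => ?_
      exact htri v x y (Finset.mem_filter.1 hx).2 hxy (Finset.mem_filter.1 hy).2
    rw [Finset.sum_congr rfl h3]
    simp_rw [Finset.card_filter]
    rw [Finset.sum_comm]
    refine Finset.sum_congr rfl fun z _ => Finset.sum_congr rfl fun x _ => ?_
    simp only [show H x z ↔ H z x from ⟨hsymm x z, hsymm z x⟩]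
  have h4 : ∑ z ∈ S \ N, (S.filter (H z)).card =
      ∑ z ∈ S \ N, (N.filter (H z)).card + ∑ z ∈ S \ N, ((S \ N).filter (H z)).card := by
    rw [← Finset.sum_add_distrib]
    exact Finset.sum_congr rfl fun z hz => h1 z (Finset.mem_sdiff.1 hz).1
  have h5 : ∑ z ∈ S \ N, (S.filter (H z)).card + ∑ z ∈ S \ N, (N.card - (S.filter (H z)).card) =
      (S \ N).card * N.card := by
    rw [← Finset.sum_add_distrib, ← smul_eq_mul, ← Finset.sum_const]
    refine Finset.sum_congr rfl fun z hz => ?_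
    have := hmax z (Finset.mem_sdiff.1 hz).1
    omega
  have h6 := Finset.sum_sdiff hNS (f := fun x => (S.filter (H x)).card)
  omega

theorem mantel (S : Finset V) (H : V → V → Prop) [DecidableRel H]
    (hsymm : ∀ x y, H x y → H y x) (htri : ∀ x y z, H x y → H y z → H x z → False) :
    2 * ∑ x ∈ S, (S.filter (H x)).card ≤ S.card ^ 2 := by
  obtain ⟨N, hN, -, -, h⟩ := mantel_identity S H hsymm htri
  have h1 := Finset.card_sdiff_add_card_eq_card hN
  have h2 : 4 * ((S \ N).card * N.card) ≤ S.card ^ 2 := by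
    rw [← h1, ← mul_assoc]
    exact four_mul_le_sq_add _ _
  omega

/-- A triangle-free graph with at most one edge less than the maximum is bipartite with at most
one pair missing. -/
theorem exists_bipartition (S : Finset V) (H : V → V → Prop) [DecidableRel H]
    (hsymm : ∀ x y, H x y → H y x) (htri : ∀ x y z, H x y → H y z → H x z → False)
    (hn : 8 ≤ S.card) (hcard : S.card ^ 2 ≤ 2 * ∑ x ∈ S, (S.filter (H x)).card + 4) :
    ∃ X Y, Disjoint X Y ∧ X ∪ Y = S ∧ (∀ x ∈ X, ∀ y ∈ X, ¬ H x y) ∧ (∀ x ∈ Y, ∀ y ∈ Y, ¬ H x y) ∧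
      2 ≤ X.card ∧ 2 ≤ Y.card ∧
      ∀ x ∈ X, ∀ y ∈ Y, ∀ x' ∈ X, ∀ y' ∈ Y, ¬ H x y → ¬ H x' y' → x = x' ∧ y = y' := by
  obtain ⟨N, hN, hNi, hmax, h⟩ := mantel_identity S H hsymm htri
  have h1 := Finset.card_sdiff_add_card_eq_card hN
  have h2 : 4 * ((S \ N).card * N.card) ≤ S.card ^ 2 := by
    rw [← h1, ← mul_assoc]
    exact four_mul_le_sq_add _ _
  have hN3 : 3 ≤ N.card ∧ 3 ≤ (S \ N).card := by
    have h3 : S.card ^ 2 ≤ 4 * ((S \ N).card * N.card) + 4 := by omega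
    rw [← h1] at h3 hn
    generalize (S \ N).card = a at *
    generalize N.card = b at *
    constructor
    · by_contra hb
      have : b = 0 ∨ b = 1 ∨ b = 2 := by omega
      rcases this with rfl | rfl | rfl <;> nlinarith
    · by_contra hb
      have : a = 0 ∨ a = 1 ∨ a = 2 := by omega
      rcases this with rfl | rfl | rfl <;> nlinarith
  have hirr : ∀ x, ¬ H x x := fun x hx => htri x x x hx hx hx
  have hslack : ∑ z ∈ S \ N, ((S \ N).filter (H z)).card +
        2 * ∑ z ∈ S \ N, (N.card - (S.filter (H z)).card) ≤ 2 := by omega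
  have hsplit : ∀ x ∈ S, (S.filter (H x)).card =
      (N.filter (H x)).card + ((S \ N).filter (H x)).card := by
    intro x _
    rw [← Finset.card_union_of_disjoint, ← Finset.filter_union, Finset.union_sdiff_of_subset hN]
    exact Finset.disjoint_filter_filter Finset.disjoint_sdiff
  have hZi : ∀ x ∈ S \ N, ∀ y ∈ S \ N, ¬ H x y := by
    intro x hx y hy hxy
    have hxy' : x ≠ y := by rintro rfl; exact hirr x hxy
    have i1 : 1 ≤ ((S \ N).filter (H x)).card :=
      Finset.card_pos.2 ⟨y, Finset.mem_filter.2 ⟨hy, hxy⟩⟩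
    have i2 : 1 ≤ ((S \ N).filter (H y)).card :=
      Finset.card_pos.2 ⟨x, Finset.mem_filter.2 ⟨hx, hsymm _ _ hxy⟩⟩
    have hsub : ({x, y} : Finset V) ⊆ S \ N := by
      simp only [Finset.insert_subset_iff, Finset.singleton_subset_iff]; exact ⟨hx, hy⟩
    -- An edge `xy` outside `N` uses up the slack. But `x` and `y` have no common neighbour in `N`,
    -- so both degrees cannot be close to `|N| ≥ 3`.
    have i3 := Finset.sum_le_sum_of_subset (f := fun z => ((S \ N).filter (H z)).card) hsub
    have i4 := Finset.sum_le_sum_of_subset (f := fun z => (N.card - (S.filter (H z)).card)) hsub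
    rw [Finset.sum_pair hxy'] at i3 i4
    have j1 := hsplit x (Finset.mem_sdiff.1 hx).1
    have j2 := hsplit y (Finset.mem_sdiff.1 hy).1
    have hd : Disjoint (N.filter (H x)) (N.filter (H y)) := by
      refine Finset.disjoint_left.2 fun z hz hz' => ?_
      exact htri x y z hxy (Finset.mem_filter.1 hz').2 (Finset.mem_filter.1 hz).2
    have j3 := Finset.card_le_card (Finset.union_subset (Finset.filter_subset (H x) N)
      (Finset.filter_subset (H y) N))
    rw [Finset.card_union_of_disjoint hd] at j3
    omega
  refine ⟨N, S \ N, Finset.disjoint_sdiff, Finset.union_sdiff_of_subset hN, hNi, hZi, by omega,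
    by omega, ?_⟩
  have hdef : ∀ z ∈ S \ N, N.card - (S.filter (H z)).card = (N.filter fun x => ¬ H z x).card := by
    intro z hz
    have j1 := hsplit z (Finset.mem_sdiff.1 hz).1
    have j2 : ((S \ N).filter (H z)).card = 0 :=
      Finset.card_eq_zero.2 (Finset.filter_eq_empty_iff.2 fun y hy => hZi z hz y hy)
    have j3 := Finset.card_filter_add_card_filter_not (s := N) (H z)
    omega
  rw [Finset.sum_congr rfl hdef] at hslack
  intro x hx y hy x' hx' y' hy' hxy hxy'
  have k1 : x ∈ N.filter fun x => ¬ H y x := Finset.mem_filter.2 ⟨hx, fun h => hxy (hsymm _ _ h)⟩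
  have k2 : x' ∈ N.filter fun x => ¬ H y' x :=
    Finset.mem_filter.2 ⟨hx', fun h => hxy' (hsymm _ _ h)⟩
  by_cases hyy : y = y'
  · subst hyy
    refine ⟨?_, rfl⟩
    have := Finset.single_le_sum (f := fun z => (N.filter fun x => ¬ H z x).card)
      (fun _ _ => Nat.zero_le _) hy
    exact Finset.card_le_one.1 (by omega) x k1 x' k2
  · have hsub : ({y, y'} : Finset V) ⊆ S \ N := by
      simp only [Finset.insert_subset_iff, Finset.singleton_subset_iff]; exact ⟨hy, hy'⟩
    have i3 := Finset.sum_le_sum_of_subset (f := fun z => (N.filter fun x => ¬ H z x).card) hsub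
    rw [Finset.sum_pair hyy] at i3
    have := Finset.card_pos.2 ⟨x, k1⟩
    have := Finset.card_pos.2 ⟨x', k2⟩
    omega

/-! ### Systems without blocks -/

/-- The triples of `F` are the sets `A ∪ {b}` with `A` in the family `P` of disjoint pairs and `b`
a vertex of `S` outside these pairs. -/
structure IsPairSystem (S : Finset V) (P F : Finset (Finset V)) : Prop where
  card_eq : ∀ A ∈ P, A.card = 2
  subset : ∀ A ∈ P, A ⊆ S
  disjoint : ∀ A ∈ P, ∀ A' ∈ P, A ≠ A' → Disjoint A A'
  mem_iff : ∀ e, e ∈ F ↔ ∃ A ∈ P, ∃ b ∈ S, (∀ A' ∈ P, b ∉ A') ∧ e = insert b A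

variable {F : Finset (Finset V)} {c : Finset V → V}

theorem normal_eq_self (hb : ∀ Q, ¬ IsBlock F Q) : normal F = F := by
  ext e
  rw [mem_normal, and_iff_left_iff_imp]
  exact fun _ Q hQ => (hb Q hQ).elim

theorem HAdj.triangle_free (hF : Closed F) (hc : IsCenters F c) (x y z : V) (h1 : HAdj F c x y)
    (h2 : HAdj F c y z) (h3 : HAdj F c x z) : False :=
  Finset.disjoint_left.1 (h1.disjoint_gnbr hF hc) (mem_gnbr.2 (Or.inl h3)) (mem_gnbr.2 (Or.inl h2))

theorem filter_hadj_eq {S : Finset V} (hS : ∀ e ∈ F, e ⊆ S) (x : V) :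
    S.filter (HAdj F c x) = hnbr F c x := by
  ext y
  rw [mem_hnbr, Finset.mem_filter, and_iff_right_iff_imp]
  exact fun h => nbr_subset hS x (hnbr_subset x (mem_hnbr.2 h))

/-- If the vertex `a'` is joined by private pairs to both non-central vertices `b`, `d` of a
triple, then `a'bd` is a triple as well. -/
theorem triple_mem_of_hadj (hF : Closed F) (hb : ∀ Q, ¬ IsBlock F Q) (hc : IsCenters F c)
    {e : Finset V} (he : e ∈ F) {a' b d : V} (hbd : b ≠ d) (hbe : b ∈ e) (hde : d ∈ e)
    (h1 : HAdj F c a' b) (h2 : HAdj F c a' d) :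
    ∃ f ∈ F, f = {a', b, d} ∧ c f = a' := by
  have hn := normal_eq_self hb
  obtain ⟨hab, f, hf, ha'f, hbf, hcf⟩ := h1
  obtain ⟨had, g, hg, ha'g, hdg, hcg⟩ := h2
  have hfF := (mem_normal.1 hf).1
  have hgF := (mem_normal.1 hg).1
  have hfg : f = g := by
    by_contra hfg
    by_cases hef : e = f
    · subst hef
      exact hfg (hc.unique hg had ha'g hdg hcg hfF ha'f hde)
    · by_cases heg : e = g
      · subst heg
        exact hfg (hc.unique hf hab ha'f hbf hcf he ha'g hbe).symm
      · obtain ⟨Q, hQ, -⟩ := hF.exists_block a' b d f e g hab hbd had hfF he hgF (Ne.symm hef) heg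
          hfg ha'f hbf hbe hde ha'g hdg
        exact hb Q hQ
  subst hfg
  refine ⟨f, hfF, ?_, by grind⟩
  exact (eq_of_subset_card (Finset.card_eq_three.2 ⟨a', b, d, hab, had, hbd, rfl⟩)
    (hF.card_eq f hfF) (by simp [Finset.insert_subset_iff, ha'f, hbf, hdg])).symm

theorem exists_center_eq (hF : Closed F) (hc : IsCenters F c) {e : Finset V} (he : e ∈ normal F) :
    ∃ b d, b ≠ c e ∧ d ≠ c e ∧ b ≠ d ∧ e = {c e, b, d} ∧ HAdj F c (c e) b ∧ HAdj F c (c e) d := by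
  obtain ⟨b, d, h1, h2, h3, h4⟩ := exists_two_of_mem (hF.card_eq e (mem_normal.1 he).1) (hc e he).1
  have hb : b ∈ e := by rw [h4]; simp
  have hd : d ∈ e := by rw [h4]; simp
  exact ⟨b, d, h1, h2, h3, h4, ⟨h1.symm, e, he, (hc e he).1, hb, Or.inl rfl⟩,
    ⟨h2.symm, e, he, (hc e he).1, hd, Or.inl rfl⟩⟩

/-- In a bipartite graph with at most one missing pair, the non-central vertices of two triples lie on
the same side. Otherwise a private pair between `{p, q}` and `{b, d}` would be contained in two
triples. -/
theorem centers_same_side (hF : Closed F) (hb : ∀ Q, ¬ IsBlock F Q) (hc : IsCenters F c)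
    {X Y : Finset V} (hXY : Disjoint X Y)
    (hmiss : ∀ x ∈ X, ∀ y ∈ Y, ∀ x' ∈ X, ∀ y' ∈ Y, ¬ HAdj F c x y → ¬ HAdj F c x' y' →
      x = x' ∧ y = y')
    {e f : Finset V} (he : e ∈ F) (hf : f ∈ F) {b d p q : V} (hbd : b ≠ d) (hpq : p ≠ q)
    (hbe : b ∈ e) (hde : d ∈ e) (hpf : p ∈ f) (hqf : q ∈ f) (hbY : b ∈ Y) (hdY : d ∈ Y)
    (hpX : p ∈ X) (hqX : q ∈ X) : False := by
  -- one of the four pairs between `{p, q}` and `{b, d}` meets no missing pair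
  have key : ∀ p q b d, p ≠ q → b ≠ d → p ∈ X → q ∈ X → b ∈ Y → d ∈ Y → b ∈ e → d ∈ e → p ∈ f →
      q ∈ f → HAdj F c p b → HAdj F c p d → HAdj F c q b → False := by
    intro p q b d hpq hbd hp hq hb' hd hbe hde hpf hqf h1 h2 h3
    obtain ⟨g, hg, hge, -⟩ := triple_mem_of_hadj hF hb hc he hbd hbe hde h1 h2
    obtain ⟨g', hg', hge', -⟩ := triple_mem_of_hadj hF hb hc hf hpq hpf hqf h1.symm h3.symm
    obtain ⟨hpb, k, hk, hpk, hbk, hck⟩ := h1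
    have e1 : g = k := hc.unique hk hpb hpk hbk hck hg (by simp [hge]) (by simp [hge])
    have e2 : g' = k := hc.unique hk hpb hpk hbk hck hg' (by simp [hge']) (by simp [hge'])
    have h4 : q ∈ g := by rw [e1, ← e2, hge']; simp
    rw [hge] at h4
    simp only [Finset.mem_insert, Finset.mem_singleton] at h4
    rcases h4 with h | h | h
    · exact hpq h.symm
    · exact Finset.disjoint_left.1 hXY hq (h ▸ hb')
    · exact Finset.disjoint_left.1 hXY hq (h ▸ hd)
  have m1 := hmiss p hpX b hbY
  have m2 := hmiss p hpX d hdY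
  have m3 := hmiss q hqX b hbY
  by_cases h1 : HAdj F c p b
  · by_cases h2 : HAdj F c p d
    · by_cases h3 : HAdj F c q b
      · exact key p q b d hpq hbd hpX hqX hbY hdY hbe hde hpf hqf h1 h2 h3
      · refine key p q d b hpq hbd.symm hpX hqX hdY hbY hde hbe hpf hqf h2 h1 ?_
        by_contra h4
        exact hbd (m3 q hqX d hdY h3 h4).2
    · refine key q p b d hpq.symm hbd hqX hpX hbY hdY hbe hde hqf hpf ?_ ?_ h1
      · by_contra h4
        exact hpq (m2 q hqX b hbY h2 h4).1
      · by_contra h4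
        exact hpq (m2 q hqX d hdY h2 h4).1
  · refine key q p d b hpq.symm hbd.symm hqX hpX hdY hbY hde hbe hqf hpf ?_ ?_ ?_
    · by_contra h4
      exact hpq (m1 q hqX d hdY h1 h4).1
    · by_contra h4
      exact hpq (m1 q hqX b hbY h1 h4).1
    · by_contra h4
      exact hbd (m1 p hpX d hdY h1 h4).2

/-- If the centres are on one side `X` of the almost complete bipartite graph of private pairs, then
the graph is complete, and the non-central pairs of the triples partition the other side. -/
theorem isPairSystem_of_bipartition (hF : Closed F) (hb : ∀ Q, ¬ IsBlock F Q)
    (hc : IsCenters F c) {S : Finset V} (hS : ∀ e ∈ F, e ⊆ S) {X Y : Finset V}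
    (hXY : Disjoint X Y) (hU : X ∪ Y = S)
    (hX : ∀ x ∈ X, ∀ y ∈ X, ¬ HAdj F c x y) (hX2 : 2 ≤ X.card) (hY2 : 2 ≤ Y.card)
    (hmiss : ∀ x ∈ X, ∀ y ∈ Y, ∀ x' ∈ X, ∀ y' ∈ Y, ¬ HAdj F c x y → ¬ HAdj F c x' y' →
      x = x' ∧ y = y')
    (hcX : ∀ e ∈ F, c e ∈ X) :
    ∃ P, IsPairSystem S P F ∧ 1 ≤ P.card ∧ 2 * P.card + 2 ≤ S.card := by
  have hn := normal_eq_self hb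
  have hXS : X ⊆ S := hU ▸ Finset.subset_union_left
  have hYS : Y ⊆ S := hU ▸ Finset.subset_union_right
  have hshape : ∀ e ∈ F, ∃ b d, b ≠ c e ∧ d ≠ c e ∧ b ≠ d ∧ e = {c e, b, d} ∧
      HAdj F c (c e) b ∧ HAdj F c (c e) d ∧ b ∈ Y ∧ d ∈ Y := by
    intro e he
    obtain ⟨b, d, h1, h2, h3, h4, h5, h6⟩ := exists_center_eq hF hc (hn.symm ▸ he)
    have hin : ∀ u, HAdj F c (c e) u → u ∈ Y := by
      intro u hu
      have h7 : u ∈ X ∪ Y := hU ▸ nbr_subset hS _ (hnbr_subset _ (mem_hnbr.2 hu))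
      rcases Finset.mem_union.1 h7 with h | h
      · exact (hX _ (hcX e he) u h hu).elim
      · exact h
    exact ⟨b, d, h1, h2, h3, h4, h5, h6, hin b h5, hin d h6⟩
  -- a pair `x ∈ X`, `y ∈ Y` of the graph lies in a triple with centre `x`
  have hedge : ∀ x ∈ X, ∀ y ∈ Y, HAdj F c x y → ∃ e ∈ F, ∃ d ∈ Y, d ≠ y ∧ e = {x, y, d} ∧
      c e = x ∧ HAdj F c x d := by
    intro x hx y hy h
    obtain ⟨hxy, e, he, hxe, hye, hce⟩ := id h
    have heF := (mem_normal.1 he).1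
    have hce' : c e = x := by
      rcases hce with h | h
      · exact h
      · exact (Finset.disjoint_left.1 hXY (h ▸ hcX e heF) hy).elim
    obtain ⟨b, d, h1, h2, h3, h4, h5, h6, h7, h8⟩ := hshape e heF
    rw [hce'] at h1 h2 h4 h5 h6
    have : y = b ∨ y = d := (mem_triple.1 (h4 ▸ hye)).resolve_left hxy.symm
    rcases this with rfl | rfl
    · exact ⟨e, heF, d, h8, h3.symm, h4, hce', h6⟩
    · exact ⟨e, heF, b, h7, h3, by rw [h4, Finset.pair_comm], hce', h5⟩
  -- If `xy` is missing, follow the triples `{a, y, d}` and `{x, d, d'}`: the private pair `ad` is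
  -- also in `{a, d, d'}`.
  have hfull : ∀ x ∈ X, ∀ y ∈ Y, HAdj F c x y := by
    intro x hx y hy
    by_contra hxy
    have hm : ∀ x' ∈ X, ∀ y' ∈ Y, x' ≠ x ∨ y' ≠ y → HAdj F c x' y' := by
      intro x' hx' y' hy' hne
      by_contra h
      have := hmiss x' hx' y' hy' x hx y hy h hxy
      exact hne.elim (fun h => h this.1) fun h => h this.2
    obtain ⟨a, ha, hax⟩ := Finset.exists_mem_ne (by omega : 1 < X.card) x
    obtain ⟨e, he, d, hd, hdy, hee, -, -⟩ := hedge a ha y hy (hm a ha y hy (Or.inl hax))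
    obtain ⟨g, hg, d', hd', hdd, hge, -, hxd'⟩ := hedge x hx d hd (hm x hx d hd (Or.inr hdy))
    have hd'y : d' ≠ y := by rintro rfl; exact hxy hxd'
    have had := hm a ha d hd (Or.inl hax)
    obtain ⟨g', hg', hge', -⟩ := triple_mem_of_hadj hF hb hc hg hdd.symm (by simp [hge])
      (by simp [hge]) had (hm a ha d' hd' (Or.inl hax))
    obtain ⟨hne, k, hk, hak, hdk, hck⟩ := had
    have e1 : e = k := hc.unique hk hne hak hdk hck he (by simp [hee]) (by simp [hee])
    have e2 : g' = k := hc.unique hk hne hak hdk hck hg' (by simp [hge']) (by simp [hge'])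
    have h4 : d' ∈ e := by rw [e1, ← e2, hge']; simp
    rw [hee] at h4
    simp only [Finset.mem_insert, Finset.mem_singleton] at h4
    rcases h4 with h | h | h
    · exact Finset.disjoint_left.1 hXY (h ▸ ha) hd'
    · exact hd'y h
    · exact hdd h
  have hPY : ∀ A ∈ F.image (fun e => e.erase (c e)), A ⊆ Y ∧ A.card = 2 := by
    intro A hA
    obtain ⟨e, he, rfl⟩ := Finset.mem_image.1 hA
    obtain ⟨b, d, h1, h2, h3, h4, h5, h6, h7, h8⟩ := hshape e he
    refine ⟨fun u hu => ?_, ?_⟩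
    · rw [Finset.mem_erase] at hu
      rcases mem_triple.1 (h4 ▸ hu.2) with h | h | h
      · exact (hu.1 h).elim
      · exact h ▸ h7
      · exact h ▸ h8
    · rw [Finset.card_erase_of_mem (hc e (hn.symm ▸ he)).1, hF.card_eq e he]
  have hcover : ∀ y ∈ Y, ∃ A ∈ F.image (fun e => e.erase (c e)), y ∈ A := by
    intro y hy
    obtain ⟨x, hx⟩ := Finset.card_pos.1 (by omega : 0 < X.card)
    obtain ⟨e, he, d, hd, hdy, hee, hce, -⟩ := hedge x hx y hy (hfull x hx y hy)
    refine ⟨_, Finset.mem_image.2 ⟨e, he, rfl⟩, Finset.mem_erase.2 ⟨?_, by simp [hee]⟩⟩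
    rw [hce]
    rintro rfl
    exact Finset.disjoint_left.1 hXY hx hy
  have hdisj : ∀ A ∈ F.image (fun e => e.erase (c e)), ∀ A' ∈ F.image (fun e => e.erase (c e)),
      A ≠ A' → Disjoint A A' := by
    intro A hA A' hA' hne
    refine Finset.disjoint_left.2 fun y hy hy' => hne ?_
    obtain ⟨e, he, rfl⟩ := Finset.mem_image.1 hA
    obtain ⟨e', he', rfl⟩ := Finset.mem_image.1 hA'
    have hY := hPY _ hA
    have hY' := hPY _ hA'
    obtain ⟨d, hd, hdy⟩ := Finset.exists_mem_ne (by omega : 1 < (e.erase (c e)).card) y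
    have hye' := (Finset.mem_erase.1 hy').2
    obtain ⟨g, hg, hge, hcg⟩ := triple_mem_of_hadj hF hb hc he hdy.symm (Finset.mem_erase.1 hy).2
      (Finset.mem_erase.1 hd).2 (hfull _ (hcX e' he') y (hY.1 hy))
      (hfull _ (hcX e' he') d (hY.1 hd))
    have hge' : g = e' := hc.unique (hn.symm ▸ he') (Finset.mem_erase.1 hy').1
      hye' (hc e' (hn.symm ▸ he')).1 (Or.inr rfl) hg (by simp [hge]) (by simp [hge])
    refine eq_of_subset_card hY.2 hY'.2 fun u hu => ?_
    have : u = y ∨ u = d := by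
      by_contra! hu'
      have h3 : ({u, y, d} : Finset V) ⊆ e.erase (c e) := by
        simp only [Finset.insert_subset_iff, Finset.singleton_subset_iff]
        exact ⟨hu, hy, hd⟩
      have := Finset.card_le_card h3
      rw [Finset.card_eq_three.2 ⟨u, y, d, hu'.1, hu'.2, hdy.symm, rfl⟩] at this
      omega
    rcases this with rfl | rfl
    · exact hy'
    · refine Finset.mem_erase.2 ⟨?_, by rw [← hge', hge]; simp⟩
      rintro rfl
      exact Finset.disjoint_left.1 hXY (hcX e' he') (hY.1 hd)
  have hnotX : ∀ b ∈ S, (∀ A ∈ F.image (fun e => e.erase (c e)), b ∉ A) ↔ b ∈ X := by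
    intro b hbS
    constructor
    · intro h
      rcases Finset.mem_union.1 (hU.symm ▸ hbS) with h' | h'
      · exact h'
      · obtain ⟨A, hA, hbA⟩ := hcover b h'
        exact (h A hA hbA).elim
    · intro hbX A hA hbA
      exact Finset.disjoint_left.1 hXY hbX ((hPY A hA).1 hbA)
  refine ⟨F.image fun e => e.erase (c e), ⟨fun A hA => (hPY A hA).2,
    fun A hA => (hPY A hA).1.trans hYS, hdisj, fun e => ⟨fun he => ?_, ?_⟩⟩, ?_, ?_⟩
  · have hce := (hc e (hn.symm ▸ he)).1
    exact ⟨_, Finset.mem_image_of_mem _ he, c e, hS e he hce,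
      (hnotX _ (hS e he hce)).2 (hcX e he), (Finset.insert_erase hce).symm⟩
  · rintro ⟨A, hA, b, hbS, hbA, rfl⟩
    have hbX := (hnotX b hbS).1 hbA
    obtain ⟨e, he, rfl⟩ := Finset.mem_image.1 hA
    obtain ⟨p, q, h1, h2, h3, h4, h5, h6, h7, h8⟩ := hshape e he
    obtain ⟨g, hg, hge, -⟩ := triple_mem_of_hadj hF hb hc he h3 (by rw [h4]; simp)
      (by rw [h4]; simp) (hfull b hbX p h7) (hfull b hbX q h8)
    have : insert b (e.erase (c e)) = g := by
      rw [hge]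
      congr 1
      rw [← Finset.erase_insert (a := c e) (s := {p, q}) (by simp [h1.symm, h2.symm]), ← h4]
    rw [this]
    exact hg
  · obtain ⟨y, hy⟩ := Finset.card_pos.1 (by omega : 0 < Y.card)
    obtain ⟨A, hA, -⟩ := hcover y hy
    exact Finset.card_pos.2 ⟨A, hA⟩
  · have h1 : (F.image fun e => e.erase (c e)).biUnion id = Y := by
      ext y
      simp only [Finset.mem_biUnion, id]
      exact ⟨fun ⟨A, hA, hy⟩ => (hPY A hA).1 hy, hcover y⟩
    have h2 := Finset.card_biUnion (s := F.image fun e => e.erase (c e)) (t := id)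
      fun A hA A' hA' hne => hdisj A hA A' hA' hne
    rw [h1, Finset.sum_congr rfl (fun A hA => show (id A).card = 2 from (hPY A hA).2)] at h2
    rw [← hU, Finset.card_union_of_disjoint hXY, h2, Finset.sum_const, smul_eq_mul]
    omega

/-- Mantel's theorem for the graph of private pairs bounds the number of triples outside the
blocks. -/
theorem Closed.card_normal_le (hF : Closed F) {S : Finset V} (hS : ∀ e ∈ F, e ⊆ S) :
    8 * (normal F).card ≤ S.card ^ 2 := by
  rcases S.eq_empty_or_nonempty with rfl | ⟨v, -⟩
  · have : normal F = ∅ := by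
      refine Finset.eq_empty_of_forall_notMem fun e he => ?_
      have h1 := hF.card_eq e (mem_normal.1 he).1
      have h2 := Finset.card_le_card (hS e (mem_normal.1 he).1)
      simp at h2
      simp [h2] at h1
    simp [this]
  have : Nonempty V := ⟨v⟩
  obtain ⟨c, hc⟩ := hF.exists_centers
  have h1 := mantel S (HAdj F c) (fun x y h => h.symm) (HAdj.triangle_free hF hc)
  simp_rw [filter_hadj_eq hS, sum_card_hnbr hF hc hS] at h1
  omega

/-- The extremal systems without blocks. -/
theorem Closed.exists_isPairSystem (hF : Closed F) (hb : ∀ Q, ¬ IsBlock F Q) {S : Finset V}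
    (hS : ∀ e ∈ F, e ⊆ S) (hn : 8 ≤ S.card) (hcard : S.card ^ 2 / 8 ≤ F.card) :
    ∃ P, IsPairSystem S P F ∧ 1 ≤ P.card ∧ 2 * P.card + 2 ≤ S.card := by
  obtain ⟨v, -⟩ := Finset.card_pos.1 (by omega : 0 < S.card)
  have : Nonempty V := ⟨v⟩
  obtain ⟨c, hc⟩ := hF.exists_centers
  have hn' := normal_eq_self hb
  have hsum := sum_card_hnbr hF hc hS
  rw [hn'] at hsum
  have hmod : S.card ^ 2 ≤ 8 * (S.card ^ 2 / 8) + 4 := by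
    have h1 : S.card ^ 2 % 8 ≤ 4 := by
      have : S.card % 8 < 8 := Nat.mod_lt _ (by norm_num)
      rw [Nat.pow_mod]
      generalize S.card % 8 = r at *
      interval_cases r <;> norm_num
    omega
  obtain ⟨X, Y, hXY, hU, hX, hY, hX2, hY2, hmiss⟩ := exists_bipartition S (HAdj F c)
    (fun x y h => h.symm) (HAdj.triangle_free hF hc) hn
    (by simp_rw [filter_hadj_eq hS, hsum]; omega)
  by_cases hcX : ∀ e ∈ F, c e ∈ X
  · exact isPairSystem_of_bipartition hF hb hc hS hXY hU hX hX2 hY2 hmiss hcX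
  · push Not at hcX
    obtain ⟨e, he, hce⟩ := hcX
    have hside : ∀ f ∈ F, c f ∈ X ∨ c f ∈ Y := fun f hf =>
      Finset.mem_union.1 (hU.symm ▸ hS f hf (hc f (hn'.symm ▸ hf)).1)
    have hother : ∀ x u, HAdj F c x u → (x ∈ X → u ∈ Y) ∧ (x ∈ Y → u ∈ X) := by
      intro x u hu
      have h7 : u ∈ X ∪ Y := hU ▸ nbr_subset hS _ (hnbr_subset _ (mem_hnbr.2 hu))
      rcases Finset.mem_union.1 h7 with h | h
      · exact ⟨fun h' => (hX _ h' _ h hu).elim, fun _ => h⟩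
      · exact ⟨fun _ => h, fun h' => (hY _ h' _ h hu).elim⟩
    refine isPairSystem_of_bipartition hF hb hc hS hXY.symm (by rw [Finset.union_comm, hU]) hY hY2
      hX2 (fun y hy x hx y' hy' x' hx' h h' => (hmiss x hx y hy x' hx' y' hy'
        (fun i => h i.symm) (fun i => h' i.symm)).symm) fun f hf => ?_
    by_contra hcf
    have hcf' := (hside f hf).resolve_right hcf
    have hce' := (hside e he).resolve_left hce
    obtain ⟨b, d, h1, h2, h3, h4, h5, h6⟩ := exists_center_eq hF hc (hn'.symm ▸ hf)
    obtain ⟨p, q, i1, i2, i3, i4, i5, i6⟩ := exists_center_eq hF hc (hn'.symm ▸ he)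
    exact centers_same_side hF hb hc hXY hmiss hf he h3 i3 (by rw [h4]; simp) (by rw [h4]; simp)
      (by rw [i4]; simp) (by rw [i4]; simp) ((hother _ _ h5).1 hcf') ((hother _ _ h6).1 hcf')
      ((hother _ _ i5).2 hce') ((hother _ _ i6).2 hce')

end

section

variable {V : Type*} [DecidableEq V] {F : Finset (Finset V)} {c : Finset V → V}

/-! ### Systems built from disjoint pairs -/

theorem IsPairSystem.card_support {S : Finset V} {P : Finset (Finset V)} (h : IsPairSystem S P F) :
    (P.biUnion id).card = 2 * P.card := by
  rw [Finset.card_biUnion (t := id) fun A hA A' hA' hne => h.disjoint A hA A' hA' hne,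
    Finset.sum_congr rfl (fun A hA => show (id A).card = 2 from h.card_eq A hA), Finset.sum_const,
    smul_eq_mul, mul_comm]

theorem IsPairSystem.support_subset {S : Finset V} {P : Finset (Finset V)}
    (h : IsPairSystem S P F) : P.biUnion id ⊆ S := by
  intro x hx
  obtain ⟨A, hA, hxA⟩ := Finset.mem_biUnion.1 hx
  exact h.subset A hA hxA

theorem IsPairSystem.card_triples {S : Finset V} {P : Finset (Finset V)}
    (h : IsPairSystem S P F) : F.card = P.card * (S.card - 2 * P.card) := by
  have h1 : F = (P ×ˢ (S \ P.biUnion id)).image fun p => insert p.2 p.1 := by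
    ext e
    rw [h.mem_iff]
    simp only [Finset.mem_image, Finset.mem_product, Finset.mem_sdiff, Finset.mem_biUnion, id]
    constructor
    · rintro ⟨A, hA, b, hbS, hb, rfl⟩
      exact ⟨(A, b), ⟨hA, hbS, fun ⟨A', hA', hb'⟩ => hb A' hA' hb'⟩, rfl⟩
    · rintro ⟨⟨A, b⟩, ⟨hA, hbS, hb⟩, rfl⟩
      exact ⟨A, hA, b, hbS, fun A' hA' hb' => hb ⟨A', hA', hb'⟩, rfl⟩
  rw [h1, Finset.card_image_of_injOn, Finset.card_product, Finset.card_sdiff_of_subset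
    h.support_subset, h.card_support]
  rintro ⟨A, b⟩ hp ⟨A', b'⟩ hp' heq
  replace heq : insert b A = insert b' A' := heq
  simp only [Finset.coe_product, Set.mem_prod, Finset.mem_coe, Finset.mem_sdiff,
    Finset.mem_biUnion, id, not_exists, not_and] at hp hp'
  have hbb : b = b' := by
    have : b ∈ insert b' A' := heq ▸ Finset.mem_insert_self b A
    rcases Finset.mem_insert.1 this with h | h
    · exact h
    · exact (hp.2.2 A' hp'.1 h).elim
  subst hbb
  have hA : A = A' := by
    rw [← Finset.erase_insert (hp.2.2 A hp.1), ← Finset.erase_insert (hp'.2.2 A' hp'.1)]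
    exact congrArg (fun s => Finset.erase s b) heq
  rw [hA]

theorem IsPairSystem.exists_sharing {S : Finset V} {P : Finset (Finset V)}
    (h : IsPairSystem S P F) (hk : 2 * P.card + 2 ≤ S.card) {g : Finset V} (hg : g ∈ F) :
    ∃ f ∈ F, f ≠ g ∧ ∃ x y, x ≠ y ∧ x ∈ f ∧ y ∈ f ∧ x ∈ g ∧ y ∈ g := by
  obtain ⟨A, hA, b, hbS, hb, rfl⟩ := (h.mem_iff g).1 hg
  have h1 : 1 < (S \ P.biUnion id).card := by
    rw [Finset.card_sdiff_of_subset h.support_subset, h.card_support]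
    omega
  obtain ⟨b', hb', hbb⟩ := Finset.exists_mem_ne h1 b
  rw [Finset.mem_sdiff, Finset.mem_biUnion] at hb'
  have hb'' : ∀ A ∈ P, b' ∉ A := fun A' hA' h => hb'.2 ⟨A', hA', h⟩
  obtain ⟨x, y, hxy, rfl⟩ := Finset.card_eq_two.1 (h.card_eq A hA)
  refine ⟨_, (h.mem_iff _).2 ⟨{x, y}, hA, b', hb'.1, hb'', rfl⟩, fun heq => ?_, x, y, hxy,
    by simp, by simp, by simp, by simp⟩
  have : b' ∈ insert b {x, y} := heq ▸ Finset.mem_insert_self b' {x, y}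
  rcases Finset.mem_insert.1 this with h | h
  · exact hbb h
  · exact hb'' _ hA h

/-! ### Systems with a single block -/

/-- The triples meeting a block, counted through the degrees of its vertices. -/
theorem Closed.card_add_eight (hF : Closed F) {Q : Finset V} (hQ : IsBlock F Q) :
    F.card + 8 = (del F Q).card + ∑ x ∈ Q, (star F x).card := by
  have h1 : ∑ x ∈ Q, (star F x).card = ∑ e ∈ F, (Q.filter (· ∈ e)).card := by
    simp_rw [star, Finset.card_filter]
    exact Finset.sum_comm
  have h2 : ∀ e ∈ F, (Q.filter (· ∈ e)).card + (if Disjoint e Q then 1 else 0) =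
      1 + 2 * if e ⊆ Q then 1 else 0 := by
    intro e he
    by_cases hd : Disjoint e Q
    · have h3 : ¬ e ⊆ Q := by
        intro h
        have := Finset.disjoint_of_subset_left (le_refl e) (Finset.disjoint_of_subset_right h hd)
        rw [Finset.disjoint_self_iff_empty] at this
        have h3 := hF.card_eq e he
        simp [this] at h3
      have h4 : Q.filter (· ∈ e) = ∅ := Finset.filter_eq_empty_iff.2 fun x hx hxe =>
        Finset.disjoint_left.1 hd hxe hx
      simp [hd, h3, h4]
    · by_cases hs : e ⊆ Q
      · have : Q.filter (· ∈ e) = e := by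
          rw [Finset.filter_mem_eq_inter, Finset.inter_eq_right.2 hs]
        simp [hd, hs, this, hF.card_eq e he]
      · have h3 : (Q.filter (· ∈ e)).card ≤ 1 := by
          refine Finset.card_le_one.2 fun x hx y hy => ?_
          rw [Finset.mem_filter] at hx hy
          by_contra hxy
          exact hs (hF.subset_of_two_mem hQ he hxy hx.2 hy.2 hx.1 hy.1)
        obtain ⟨x, hx, hxQ⟩ := Finset.not_disjoint_iff.1 hd
        have : 0 < (Q.filter (· ∈ e)).card := Finset.card_pos.2 ⟨x, Finset.mem_filter.2 ⟨hxQ, hx⟩⟩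
        simp only [hd, hs, if_false]
        omega
  have h3 := Finset.sum_congr rfl h2
  rw [Finset.sum_add_distrib, Finset.sum_add_distrib, ← Finset.mul_sum, ← Finset.card_filter,
    ← Finset.card_filter, ← h1] at h3
  have h4 : F.filter (fun e => e ⊆ Q) = Q.powersetCard 3 := by
    ext e
    rw [Finset.mem_filter, Finset.mem_powersetCard]
    exact ⟨fun h => ⟨h.2, hF.card_eq e h.1⟩, fun h => ⟨hQ.mem h.1 h.2, h.1⟩⟩
  rw [h4, card_block_triples hQ, Finset.sum_const, smul_eq_mul, mul_one] at h3
  rw [del]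
  omega

theorem blocksAt_of_unique {Q : Finset V} (hQ : IsBlock F Q) (hu : ∀ Q', IsBlock F Q' → Q' = Q)
    {x : V} (hx : x ∈ Q) : blocksAt F x = {Q} := by
  ext Q'
  rw [mem_blocksAt, Finset.mem_singleton]
  exact ⟨fun h => hu Q' h.1, by rintro rfl; exact ⟨hQ, hx⟩⟩

theorem blocks_of_unique {Q : Finset V} (hQ : IsBlock F Q) (hu : ∀ Q', IsBlock F Q' → Q' = Q) :
    blocks F = {Q} := by
  ext Q'
  rw [mem_blocks, Finset.mem_singleton]
  exact ⟨hu Q', by rintro rfl; exact hQ⟩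

/-- A system with exactly one block is not extremal: the vertices of the block have at most one
neighbour in total for each vertex outside, and Mantel's theorem applies outside the block. -/
theorem Closed.card_lt_of_unique_block (hF : Closed F) {S : Finset V} (hS : ∀ e ∈ F, e ⊆ S)
    {Q : Finset V} (hQ : IsBlock F Q) (hu : ∀ Q', IsBlock F Q' → Q' = Q) (hn : 9 ≤ S.card) :
    F.card < S.card ^ 2 / 8 := by
  obtain ⟨v, -⟩ := Finset.card_pos.1 (by omega : 0 < S.card)
  have : Nonempty V := ⟨v⟩
  obtain ⟨c, hc⟩ := hF.exists_centers
  have hQS := hQ.subset hS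
  -- The block contributes `3` to the number of neighbours of each of its vertices.
  have h1 : ∑ x ∈ Q, (hnbr F c x).card + 4 ≤ S.card := by
    have h2 : ∑ x ∈ Q, ((hnbr F c x).card + 3) ≤ ∑ x ∈ Q, (nbr F x).card := by
      refine Finset.sum_le_sum fun x hx => ?_
      have := Finset.card_le_card (gnbr_subset (F := F) (c := c) x)
      rwa [card_gnbr hF, blocksAt_of_unique hQ hu hx, Finset.card_singleton] at this
    have h3 := hF.sum_card_nbr_le hS hQ
    rw [Finset.sum_add_distrib, Finset.sum_const, hQ.1, smul_eq_mul] at h2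
    omega
  have hcard := hF.card_eq_normal_add
  rw [blocks_of_unique hQ hu, Finset.card_singleton] at hcard
  have hsum := sum_card_hnbr hF hc hS
  rw [← Finset.sum_sdiff hQS] at hsum
  have hR := mantel (S \ Q) (HAdj F c) (fun x y h => h.symm) (HAdj.triangle_free hF hc)
  have hRc := Finset.card_sdiff_add_card_eq_card hQS
  rw [hQ.1] at hRc
  have h5 : ∀ x, (hnbr F c x).card = ((S \ Q).filter (HAdj F c x)).card +
      (Q.filter (HAdj F c x)).card := by
    intro x
    rw [← filter_hadj_eq hS, ← Finset.card_union_of_disjoint, ← Finset.filter_union,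
      Finset.sdiff_union_of_subset hQS]
    exact Finset.disjoint_filter_filter Finset.sdiff_disjoint
  have h6 : ∑ x ∈ S \ Q, (Q.filter (HAdj F c x)).card ≤ ∑ x ∈ Q, (hnbr F c x).card := by
    have : ∑ x ∈ S \ Q, (Q.filter (HAdj F c x)).card =
        ∑ x ∈ Q, ((S \ Q).filter (HAdj F c x)).card := by
      simp_rw [Finset.card_filter]
      rw [Finset.sum_comm]
      refine Finset.sum_congr rfl fun x _ => Finset.sum_congr rfl fun y _ => ?_
      simp only [show HAdj F c y x ↔ HAdj F c x y from ⟨HAdj.symm, HAdj.symm⟩]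
    rw [this]
    refine Finset.sum_le_sum fun x _ => ?_
    rw [h5 x]
    omega
  rw [Finset.sum_congr rfl fun x _ => h5 x, Finset.sum_add_distrib] at hsum
  obtain ⟨r, hr⟩ : ∃ r, (S \ Q).card = r := ⟨_, rfl⟩
  rw [hr] at hR hRc
  rw [← hRc] at h1 ⊢
  have h7 : 8 * F.card ≤ r ^ 2 + 4 * r + 32 := by omega
  rw [Nat.lt_div_iff_mul_lt (by norm_num)]
  have h8 : (r + 4) ^ 2 = r ^ 2 + 8 * r + 16 := by ring
  by_cases hr6 : 6 ≤ r
  · omega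
  · have : r = 5 := by omega
    subst this
    omega

/-- The case of eight vertices needs a closer look at the four vertices outside the block `Q`. Two
triples among these share a pair, which excludes almost all other triples. If there is at most one,
then a single vertex `a` of `Q` is joined to all vertices outside `Q`, so `a` and the triple avoiding
`Q` lie in a second block. -/
theorem Closed.card_lt_of_unique_block_eight (hF : Closed F) {S : Finset V} (hS : ∀ e ∈ F, e ⊆ S)
    {Q : Finset V} (hQ : IsBlock F Q) (hu : ∀ Q', IsBlock F Q' → Q' = Q) (hn : S.card = 8) :
    F.card < 8 := by
  by_contra! h8
  have hQS := hQ.subset hS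
  have hcard := hF.card_eq_normal_add
  rw [blocks_of_unique hQ hu, Finset.card_singleton] at hcard
  have hRc := Finset.card_sdiff_add_card_eq_card hQS
  rw [hQ.1, hn] at hRc
  have hdel : ∀ e ∈ del F Q, e ∈ normal F ∧ e ⊆ S \ Q := by
    intro e he
    have h1 := del_subset_sdiff hS e he
    refine ⟨mem_normal.2 ⟨(mem_del.1 he).1, fun Q' hQ' hs => ?_⟩, h1⟩
    obtain ⟨x, hx⟩ := Finset.card_pos.1
      (by rw [hF.card_eq e (mem_del.1 he).1]; norm_num : 0 < e.card)
    exact (Finset.mem_sdiff.1 (h1 hx)).2 (hu Q' hQ' ▸ hs hx)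
  have hinQ : ∀ f ∈ normal F, ∀ x ∈ f, ∀ y ∈ f, x ∈ Q → y ∈ Q → x = y := by
    intro f hf x hx y hy hxQ hyQ
    by_contra hxy
    exact hF.not_block_pair hf hQ hxy hx hy hxQ hyQ
  by_cases hd : 1 < (del F Q).card
  · obtain ⟨e, he, e', he', hee⟩ := Finset.one_lt_card.1 hd
    have hen := (hdel e he).1
    have hen' := (hdel e' he').1
    have he3 := hF.card_eq e (mem_normal.1 hen).1
    have he3' := hF.card_eq e' (mem_normal.1 hen').1
    have hU : e ∪ e' = S \ Q := by
      refine Finset.eq_of_subset_of_card_le (Finset.union_subset (hdel e he).2 (hdel e' he').2) ?_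
      by_contra hlt
      have i1 : e = e ∪ e' := Finset.eq_of_subset_of_card_le Finset.subset_union_left (by omega)
      have i2 : e' = e ∪ e' := Finset.eq_of_subset_of_card_le Finset.subset_union_right (by omega)
      exact hee (i1.trans i2.symm)
    have hI := Finset.card_union_add_card_inter e e'
    rw [hU] at hI
    obtain ⟨x, hx, y, hy, hxy⟩ := Finset.one_lt_card.1 (by omega : 1 < (e ∩ e').card)
    rw [Finset.mem_inter] at hx hy
    have hrest : ((normal F \ {e, e'})).card ≤ 1 := by
      have hshape : ∀ f ∈ normal F \ {e, e'}, x ∈ f ∧ y ∈ f ∧ ∃ q ∈ Q, q ∈ f := by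
        intro f hf
        rw [Finset.mem_sdiff, Finset.mem_insert, Finset.mem_singleton, not_or] at hf
        have hfF := (mem_normal.1 hf.1).1
        have hf3 := hF.card_eq f hfF
        have hfQ : (f ∩ Q).card ≤ 1 := Finset.card_le_one.2 fun a ha b hb => by
          rw [Finset.mem_inter] at ha hb
          exact hinQ f hf.1 a ha.1 b hb.1 ha.2 hb.2
        have hfR := Finset.card_inter_add_card_sdiff f Q
        obtain ⟨p, hp, r, hr, hpr⟩ := Finset.one_lt_card.1 (by omega : 1 < (f \ Q).card)
        rw [Finset.mem_sdiff] at hp hr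
        have hxyf := hF.pair_subset hen hen' hee hxy hx.1 hy.1 hx.2 hy.2 hfF hf.2.1 hf.2.2 hpr
          (hU ▸ Finset.mem_sdiff.2 ⟨hS f hfF hp.1, hp.2⟩)
          (hU ▸ Finset.mem_sdiff.2 ⟨hS f hfF hr.1, hr.2⟩) hp.1 hr.1
        obtain ⟨u, hux, huy, hfu⟩ := exists_third hf3 hxyf.1 hxyf.2 hxy
        have huf : u ∈ f := by rw [hfu]; simp
        refine ⟨hxyf.1, hxyf.2, u, ?_, huf⟩
        by_contra huQ
        have hue : u ∈ e ∪ e' := hU ▸ Finset.mem_sdiff.2 ⟨hS f hfF huf, huQ⟩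
        rcases Finset.mem_union.1 hue with h | h
        · exact hf.2.1 (eq_of_subset_card hf3 he3
            (by rw [hfu]; simp [Finset.insert_subset_iff, hx.1, hy.1, h]))
        · exact hf.2.2 (eq_of_subset_card hf3 he3'
            (by rw [hfu]; simp [Finset.insert_subset_iff, hx.2, hy.2, h]))
      refine Finset.card_le_one.2 fun f hf f' hf' => ?_
      obtain ⟨h1, h2, q, hq, h3⟩ := hshape f hf
      obtain ⟨i1, i2, q', hq', i3⟩ := hshape f' hf'
      have hfF := (mem_normal.1 (Finset.mem_sdiff.1 hf).1).1
      have hfF' := (mem_normal.1 (Finset.mem_sdiff.1 hf').1).1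
      have hxR : x ∈ S \ Q := (hdel e he).2 hx.1
      have hyR : y ∈ S \ Q := (hdel e he).2 hy.1
      rw [Finset.mem_sdiff] at hxR hyR
      have hqq := hF.eq_of_adj_block hQ hxR.2 hq hq' hfF hfF' h1 h3 i1 i3
      subst hqq
      have h4 : ({x, y, q} : Finset V).card = 3 := Finset.card_eq_three.2 ⟨x, y, q, hxy,
        by rintro rfl; exact hxR.2 hq, by rintro rfl; exact hyR.2 hq, rfl⟩
      rw [← eq_of_subset_card h4 (hF.card_eq f hfF)
          (by simp [Finset.insert_subset_iff, h1, h2, h3]),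
        ← eq_of_subset_card h4 (hF.card_eq f' hfF')
          (by simp [Finset.insert_subset_iff, i1, i2, i3])]
    have h1 := Finset.card_le_card_sdiff_add_card (s := normal F) (t := {e, e'})
    have h2 := Finset.card_le_two (a := e) (b := e')
    omega
  · have h1 := hF.card_add_eight hQ
    have hst : ∀ x ∈ Q, (star F x).card = ((normal F).filter (x ∈ ·)).card + 3 := by
      intro x hx
      rw [hF.card_star, blocksAt_of_unique hQ hu hx, Finset.card_singleton]
    have h2 : ∑ x ∈ Q, ((star F x).card +
        if ((normal F).filter (x ∈ ·)).Nonempty then 1 else 0) ≤ ∑ x ∈ Q, (nbr F x).card := by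
      refine Finset.sum_le_sum fun x _ => ?_
      have := hF.card_star_le x
      split_ifs with h
      · exact this.2 h
      · exact this.1
    have h3 := hF.sum_card_nbr_le hS hQ
    rw [Finset.sum_add_distrib, ← Finset.card_filter] at h2
    have h4 := Finset.sum_congr rfl hst
    rw [Finset.sum_add_distrib, Finset.sum_const, hQ.1, smul_eq_mul] at h4
    have h5 : ∑ x ∈ Q, ((normal F).filter (x ∈ ·)).card =
        ∑ x ∈ Q.filter (fun x => ((normal F).filter (x ∈ ·)).Nonempty),
          ((normal F).filter (x ∈ ·)).card := by
      rw [Finset.sum_filter_of_ne]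
      intro x _ h
      exact Finset.card_pos.1 (Nat.pos_of_ne_zero h)
    -- Only one vertex of `Q` is in triples outside the block: such a vertex has fewer triples than
    -- neighbours, and the slack in the count is `1`.
    have h6 : (Q.filter (fun x => ((normal F).filter (x ∈ ·)).Nonempty)).card = 1 := by
      have : (Q.filter (fun x => ((normal F).filter (x ∈ ·)).Nonempty)).card ≠ 0 := by
        intro h
        rw [Finset.card_eq_zero.1 h, Finset.sum_empty] at h5
        omega
      omega
    obtain ⟨a, ha⟩ := Finset.card_eq_one.1 h6
    rw [ha, Finset.sum_singleton] at h5
    have haQ : a ∈ Q.filter (fun x => ((normal F).filter (x ∈ ·)).Nonempty) := by simp [ha]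
    rw [Finset.mem_filter] at haQ
    have h7 := (hF.card_star_le a).2 haQ.2
    rw [hst a haQ.1] at h7
    have haS := hQS haQ.1
    have h8 : nbr F a = S.erase a := by
      refine Finset.eq_of_subset_of_card_le (fun x hx => Finset.mem_erase.2
        ⟨(mem_nbr.1 hx).1, nbr_subset hS a hx⟩) ?_
      rw [Finset.card_erase_of_mem haS, hn]
      omega
    obtain ⟨g, hg⟩ := Finset.card_pos.1 (by omega : 0 < (del F Q).card)
    have hgR := (hdel g hg).2
    have hag : a ∉ g := fun h => (Finset.mem_sdiff.1 (hgR h)).2 haQ.1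
    obtain ⟨Q', hQ', hgQ, -⟩ := hF.block_of_adj_triple (mem_del.1 hg).1 hag fun x hx => by
      have hxS := (Finset.mem_sdiff.1 (hgR hx)).1
      have : x ∈ nbr F a := h8 ▸ Finset.mem_erase.2 ⟨by rintro rfl; exact hag hx, hxS⟩
      obtain ⟨-, f, hf, h9, h10⟩ := mem_nbr.1 this
      exact ⟨f, hf, h9, h10⟩
    exact (mem_normal.1 (hdel g hg).1).2 Q' hQ' hgQ

end

section

variable {V : Type*} [DecidableEq V] {F : Finset (Finset V)} {c : Finset V → V}

/-! ### Two blocks sharing a vertex -/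

/-- No triple joins two blocks sharing the vertex `a`, except at `a`. -/
theorem Closed.not_joined (hF : Closed F) {Q B f : Finset V} (hQ : IsBlock F Q) (hB : IsBlock F B)
    {a x y : V} (haQ : a ∈ Q) (haB : a ∈ B) (hf : f ∈ F) (hxf : x ∈ f) (hyf : y ∈ f) (hx : x ∈ Q)
    (hy : y ∈ B) (hxB : x ∉ B) (hyQ : y ∉ Q) : False := by
  have hya : y ≠ a := by rintro rfl; exact hyQ haQ
  obtain ⟨g, hg, hyg, hag, -⟩ := hB.exists_triple_pair hy haB hya
  have := hF.eq_of_adj_block hQ hyQ hx haQ hf hg hyf hxf hyg hag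
  exact hxB (this ▸ haB)

theorem Closed.normal_inter_union (hF : Closed F) {Q B : Finset V} (hQ : IsBlock F Q)
    (hB : IsBlock F B) {a : V} (haQ : a ∈ Q) (haB : a ∈ B) {e : Finset V} (he : e ∈ normal F)
    {x y : V} (hx : x ∈ e) (hy : y ∈ e) (hxU : x ∈ Q ∪ B) (hyU : y ∈ Q ∪ B) : x = y := by
  by_contra hxy
  have heF := (mem_normal.1 he).1
  have h1 : ¬ (x ∈ Q ∧ y ∈ Q) := fun h => hF.not_block_pair he hQ hxy hx hy h.1 h.2
  have h2 : ¬ (x ∈ B ∧ y ∈ B) := fun h => hF.not_block_pair he hB hxy hx hy h.1 h.2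
  rw [Finset.mem_union] at hxU hyU
  by_cases h3 : x ∈ Q
  · exact hF.not_joined hQ hB haQ haB heF hx hy h3 (by tauto) (by tauto) (by tauto)
  · exact hF.not_joined hQ hB haQ haB heF hy hx (by tauto) (by tauto) (by tauto) h3

theorem Closed.block_inter_union (hF : Closed F) {Q B C : Finset V} (hQ : IsBlock F Q)
    (hB : IsBlock F B) (hC : IsBlock F C) (hCQ : C ≠ Q) (hCB : C ≠ B) {a : V} (haQ : a ∈ Q)
    (haB : a ∈ B) {x y : V} (hx : x ∈ C) (hy : y ∈ C) (hxU : x ∈ Q ∪ B) (hyU : y ∈ Q ∪ B) :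
    x = y := by
  by_contra hxy
  obtain ⟨e, he, hxe, hye, -⟩ := hC.exists_triple_pair hx hy hxy
  have h1 : ¬ (x ∈ Q ∧ y ∈ Q) := fun h => hCQ (hF.block_eq hC hQ hxy hx hy h.1 h.2)
  have h2 : ¬ (x ∈ B ∧ y ∈ B) := fun h => hCB (hF.block_eq hC hB hxy hx hy h.1 h.2)
  rw [Finset.mem_union] at hxU hyU
  by_cases h3 : x ∈ Q
  · exact hF.not_joined hQ hB haQ haB he hxe hye h3 (by tauto) (by tauto) (by tauto)
  · exact hF.not_joined hQ hB haQ haB he hye hxe (by tauto) (by tauto) (by tauto) h3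

theorem Closed.card_union_blocks (hF : Closed F) {Q B : Finset V} (hQ : IsBlock F Q)
    (hB : IsBlock F B) (hQB : Q ≠ B) {a : V} (haQ : a ∈ Q) (haB : a ∈ B) : (Q ∪ B).card = 7 := by
  have h1 : Q ∩ B = {a} := by
    ext x
    rw [Finset.mem_inter, Finset.mem_singleton]
    refine ⟨fun h => ?_, by rintro rfl; exact ⟨haQ, haB⟩⟩
    by_contra hxa
    exact hQB (hF.block_eq hQ hB hxa h.1 haQ h.2 haB)
  have h2 := Finset.card_union_add_card_inter Q B
  rw [h1, hQ.1, hB.1, Finset.card_singleton] at h2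
  omega

theorem card_sdiff_of_inter {T U : Finset V} (h : ∀ x ∈ T, ∀ y ∈ T, x ∈ U → y ∈ U → x = y) :
    T.card ≤ (T \ U).card + 1 := by
  have h1 : (T ∩ U).card ≤ 1 := Finset.card_le_one.2 fun x hx y hy => by
    rw [Finset.mem_inter] at hx hy
    exact h x hx.1 y hy.1 hx.2 hy.2
  have := Finset.card_inter_add_card_sdiff T U
  omega

theorem blocks_eq_pair {Q B : Finset V} (hQ : IsBlock F Q) (hB : IsBlock F B)
    (h : ∀ C, IsBlock F C → C = Q ∨ C = B) : blocks F = {Q, B} := by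
  ext C
  rw [mem_blocks, Finset.mem_insert, Finset.mem_singleton]
  exact ⟨h C, by rintro (rfl | rfl) <;> assumption⟩

/-- Two blocks sharing a vertex leave three further vertices for every other block, and two
further vertices for every triple outside the blocks. -/
theorem Closed.sharing_blocks (hF : Closed F) {S : Finset V} (hS : ∀ e ∈ F, e ⊆ S)
    {Q B : Finset V} (hQ : IsBlock F Q) (hB : IsBlock F B) (hQB : Q ≠ B) {a : V} (haQ : a ∈ Q)
    (haB : a ∈ B) : (S \ (Q ∪ B)).card + 7 = S.card ∧
      (∀ C, IsBlock F C → C ≠ Q → C ≠ B → 3 ≤ (C \ (Q ∪ B)).card ∧ C \ (Q ∪ B) ⊆ S \ (Q ∪ B)) ∧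
      (∀ e ∈ normal F, 2 ≤ (e \ (Q ∪ B)).card ∧ e \ (Q ∪ B) ⊆ S \ (Q ∪ B)) := by
  refine ⟨?_, fun C hC hCQ hCB => ⟨?_, ?_⟩, fun e he => ⟨?_, ?_⟩⟩
  · rw [← hF.card_union_blocks hQ hB hQB haQ haB]
    exact Finset.card_sdiff_add_card_eq_card (Finset.union_subset (hQ.subset hS) (hB.subset hS))
  · have := card_sdiff_of_inter (T := C) (U := Q ∪ B) fun x hx y hy =>
      hF.block_inter_union hQ hB hC hCQ hCB haQ haB hx hy
    have := hC.1
    omega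
  · exact Finset.sdiff_subset_sdiff (hC.subset hS) (le_refl _)
  · have := card_sdiff_of_inter (T := e) (U := Q ∪ B) fun x hx y hy =>
      hF.normal_inter_union hQ hB haQ haB he hx hy
    have := hF.card_eq e (mem_normal.1 he).1
    omega
  · exact Finset.sdiff_subset_sdiff (hS e (mem_normal.1 he).1) (le_refl _)

theorem Closed.sharing_eight (hF : Closed F) {S : Finset V} (hS : ∀ e ∈ F, e ⊆ S)
    (hn : S.card = 8) {Q B : Finset V} (hQ : IsBlock F Q) (hB : IsBlock F B) (hQB : Q ≠ B) {a : V}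
    (haQ : a ∈ Q) (haB : a ∈ B) : blocks F = {Q, B} ∧ normal F = ∅ := by
  obtain ⟨h1, h2, h3⟩ := hF.sharing_blocks hS hQ hB hQB haQ haB
  constructor
  · refine blocks_eq_pair hQ hB fun C hC => ?_
    by_contra! h
    have := h2 C hC h.1 h.2
    have := Finset.card_le_card this.2
    omega
  · refine Finset.eq_empty_of_forall_notMem fun e he => ?_
    have := h3 e he
    have := Finset.card_le_card this.2
    omega

theorem Closed.sharing_nine (hF : Closed F) {S : Finset V} (hS : ∀ e ∈ F, e ⊆ S)
    (hn : S.card = 9) (hcard : 10 ≤ F.card) {Q B : Finset V} (hQ : IsBlock F Q) (hB : IsBlock F B)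
    (hQB : Q ≠ B) {a : V} (haQ : a ∈ Q) (haB : a ∈ B) : blocks F = {Q, B} ∧
      ∃ x ∈ Q, ∃ y ∈ B, x ≠ a ∧ y ≠ a ∧ ∃ w w', S \ (Q ∪ B) = {w, w'} ∧
        normal F = {{x, w, w'}, {y, w, w'}} := by
  obtain ⟨h1, h2, h3⟩ := hF.sharing_blocks hS hQ hB hQB haQ haB
  have hbl : blocks F = {Q, B} := by
    refine blocks_eq_pair hQ hB fun C hC => ?_
    by_contra! h
    have := h2 C hC h.1 h.2
    have := Finset.card_le_card this.2
    omega
  refine ⟨hbl, ?_⟩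
  have hm := hF.card_eq_normal_add
  rw [hbl, Finset.card_pair hQB] at hm
  obtain ⟨w, w', hww, hW⟩ := Finset.card_eq_two.1 (by omega : (S \ (Q ∪ B)).card = 2)
  have hw : w ∉ Q ∪ B := (Finset.mem_sdiff.1 (by rw [hW]; simp : w ∈ S \ (Q ∪ B))).2
  have hw' : w' ∉ Q ∪ B := (Finset.mem_sdiff.1 (by rw [hW]; simp : w' ∈ S \ (Q ∪ B))).2
  have hshape : ∀ e ∈ normal F, ∃ u ∈ Q ∪ B, e = {u, w, w'} := by
    intro e he
    have h4 := h3 e he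
    have h5 : e \ (Q ∪ B) = {w, w'} := by
      rw [← hW]
      exact Finset.eq_of_subset_of_card_le h4.2 (by omega)
    have hwe : w ∈ e := (Finset.mem_sdiff.1 (by rw [h5]; simp : w ∈ e \ (Q ∪ B))).1
    have hwe' : w' ∈ e := (Finset.mem_sdiff.1 (by rw [h5]; simp : w' ∈ e \ (Q ∪ B))).1
    obtain ⟨u, hu, hu', rfl⟩ := exists_third (hF.card_eq e (mem_normal.1 he).1) hwe hwe' hww
    refine ⟨u, ?_, by grind⟩
    by_contra huU
    have : u ∈ ({w, w', u} : Finset V) \ (Q ∪ B) := Finset.mem_sdiff.2 ⟨by simp, huU⟩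
    rw [h5] at this
    simp [hu, hu'] at this
  have huniq : ∀ T, IsBlock F T → T ⊆ Q ∪ B → ∀ u ∈ T, ∀ u' ∈ T,
      ({u, w, w'} : Finset V) ∈ normal F → ({u', w, w'} : Finset V) ∈ normal F → u = u' := by
    intro T hT hTU u hu u' hu' hf hg
    exact hF.eq_of_adj_block hT (fun h => hw (hTU h)) hu hu' (mem_normal.1 hf).1 (mem_normal.1 hg).1
      (by simp) (by simp) (by simp) (by simp)
  have hQu := huniq Q hQ Finset.subset_union_left
  have hBu := huniq B hB Finset.subset_union_right
  obtain ⟨e, he, f, hf, hef⟩ := Finset.one_lt_card.1 (by omega : 1 < (normal F).card)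
  obtain ⟨x, hx, rfl⟩ := hshape e he
  obtain ⟨y, hy, rfl⟩ := hshape f hf
  have hxy : x ≠ y := by rintro rfl; exact hef rfl
  have key : ∀ x y, x ∈ Q → y ∈ B → x ≠ y → ({x, w, w'} : Finset V) ∈ normal F →
      ({y, w, w'} : Finset V) ∈ normal F → ∃ x ∈ Q, ∃ y ∈ B, x ≠ a ∧ y ≠ a ∧
        ∃ w w', S \ (Q ∪ B) = {w, w'} ∧ normal F = {{x, w, w'}, {y, w, w'}} := by
    intro x y hx hy hxy he hf
    refine ⟨x, hx, y, hy, ?_, ?_, w, w', hW, ?_⟩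
    · rintro rfl
      exact hxy (hBu x haB y hy he hf)
    · rintro rfl
      exact hxy (hQu x hx y haQ he hf)
    · ext g
      rw [Finset.mem_insert, Finset.mem_singleton]
      constructor
      · intro hg
        obtain ⟨u, hu, rfl⟩ := hshape g hg
        rcases Finset.mem_union.1 hu with h | h
        · exact Or.inl (by rw [hQu u h x hx hg he])
        · exact Or.inr (by rw [hBu u h y hy hg hf])
      · rintro (rfl | rfl) <;> assumption
  rcases Finset.mem_union.1 hx with h | h <;> rcases Finset.mem_union.1 hy with h' | h'
  · exact (hxy (hQu x h y h' he hf)).elim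
  · exact key x y h h' hxy he hf
  · exact key y x h' h hxy.symm hf he
  · exact (hxy (hBu x h y h' he hf)).elim

theorem Closed.sharing_ten (hF : Closed F) {S : Finset V} (hS : ∀ e ∈ F, e ⊆ S)
    (hn : S.card = 10) (hcard : 12 ≤ F.card) {Q B : Finset V} (hQ : IsBlock F Q) (hB : IsBlock F B)
    (hQB : Q ≠ B) {a : V} (haQ : a ∈ Q) (haB : a ∈ B) : normal F = ∅ ∧
      ∃ C u, IsBlock F C ∧ C ≠ Q ∧ C ≠ B ∧ blocks F = {Q, B, C} ∧ u ∈ C ∧ u ∈ Q ∪ B ∧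
        Q ∪ B ∪ C = S := by
  obtain ⟨h1, h2, h3⟩ := hF.sharing_blocks hS hQ hB hQB haQ haB
  have hW : (S \ (Q ∪ B)).card = 3 := by omega
  by_cases hC : ∃ C, IsBlock F C ∧ C ≠ Q ∧ C ≠ B
  · have hsub : ∀ C, IsBlock F C → C ≠ Q → C ≠ B → S \ (Q ∪ B) ⊆ C := by
      intro C hC hCQ hCB
      have h4 := h2 C hC hCQ hCB
      rw [← Finset.eq_of_subset_of_card_le h4.2 (by omega)]
      exact Finset.sdiff_subset
    obtain ⟨C, hC, hCQ, hCB⟩ := hC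
    have hsC := hsub C hC hCQ hCB
    refine ⟨?_, C, ?_⟩
    · refine Finset.eq_empty_of_forall_notMem fun e he => ?_
      have h4 := h3 e he
      obtain ⟨x, hx, y, hy, hxy⟩ := Finset.one_lt_card.1 (by omega : 1 < (e \ (Q ∪ B)).card)
      exact hF.not_block_pair he hC hxy (Finset.mem_sdiff.1 hx).1 (Finset.mem_sdiff.1 hy).1
        (hsC (h4.2 hx)) (hsC (h4.2 hy))
    · have hne : ¬ C ⊆ S \ (Q ∪ B) := fun h => by
        have := Finset.card_le_card h
        have := hC.1
        omega
      obtain ⟨u, hu, huW⟩ := Finset.not_subset.1 hne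
      have huS := hC.subset hS hu
      refine ⟨u, hC, hCQ, hCB, ?_, hu, ?_, ?_⟩
      · ext C'
        simp only [mem_blocks, Finset.mem_insert, Finset.mem_singleton]
        constructor
        · intro hC'
          by_contra! h
          have hsC' := hsub C' hC' h.1 h.2.1
          obtain ⟨x, hx, y, hy, hxy⟩ := Finset.one_lt_card.1 (by omega : 1 < (S \ (Q ∪ B)).card)
          exact h.2.2 (hF.block_eq hC' hC hxy (hsC' hx) (hsC' hy) (hsC hx) (hsC hy))
        · rintro (rfl | rfl | rfl) <;> assumption
      · by_contra h
        exact huW (Finset.mem_sdiff.2 ⟨huS, h⟩)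
      · refine Finset.Subset.antisymm (Finset.union_subset (Finset.union_subset (hQ.subset hS)
          (hB.subset hS)) (hC.subset hS)) fun x hx => ?_
        by_cases h : x ∈ Q ∪ B
        · exact Finset.mem_union_left _ h
        · exact Finset.mem_union_right _ (hsC (Finset.mem_sdiff.2 ⟨hx, h⟩))
  · exfalso
    push Not at hC
    have hbl : blocks F = {Q, B} := blocks_eq_pair hQ hB fun C h => by
      by_contra! h'
      exact h'.2 (hC C h h'.1)
    have hm := hF.card_eq_normal_add
    rw [hbl, Finset.card_pair hQB] at hm
    -- Two triples meeting the same block share their vertex in it and a further vertex, and no other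
    -- triple is possible.
    have hside : ∀ T, IsBlock F T → T ⊆ Q ∪ B →
        ((normal F).filter fun e => ∃ u ∈ T, u ∈ e).card ≤ 1 := by
      intro T hT hTU
      by_contra! hlt
      obtain ⟨e, he, f, hf, hef⟩ := Finset.one_lt_card.1 hlt
      rw [Finset.mem_filter] at he hf
      obtain ⟨he, u, huT, hue⟩ := he
      obtain ⟨hf, u', huT', huf⟩ := hf
      have he2 := h3 e he
      have hf2 := h3 f hf
      have hI := Finset.card_union_add_card_inter (e \ (Q ∪ B)) (f \ (Q ∪ B))
      have hUc := Finset.card_le_card (Finset.union_subset he2.2 hf2.2)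
      obtain ⟨w, hw⟩ := Finset.card_pos.1
        (by omega : 0 < ((e \ (Q ∪ B)) ∩ (f \ (Q ∪ B))).card)
      simp only [Finset.mem_inter, Finset.mem_sdiff] at hw
      have heF := (mem_normal.1 he).1
      have hfF := (mem_normal.1 hf).1
      have huu : u = u' := hF.eq_of_adj_block hT (fun h => hw.1.2 (hTU h)) huT huT' heF hfF hw.1.1
        hue hw.2.1 huf
      subst huu
      have huw : u ≠ w := by rintro rfl; exact hw.1.2 (hTU huT)
      have he3 := hF.card_eq e heF
      have hf3 := hF.card_eq f hfF
      have heu : e.erase u ⊆ S \ (Q ∪ B) := by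
        intro x hx
        rw [Finset.mem_erase] at hx
        refine Finset.mem_sdiff.2 ⟨hS e heF hx.2, fun h => hx.1 ?_⟩
        exact hF.normal_inter_union hQ hB haQ haB he hx.2 hue h (hTU huT)
      have hfu : f.erase u ⊆ S \ (Q ∪ B) := by
        intro x hx
        rw [Finset.mem_erase] at hx
        refine Finset.mem_sdiff.2 ⟨hS f hfF hx.2, fun h => hx.1 ?_⟩
        exact hF.normal_inter_union hQ hB haQ haB hf hx.2 huf h (hTU huT)
      have hWe : S \ (Q ∪ B) ⊆ e ∪ f := by
        have h4 : (e.erase u) ∪ (f.erase u) = S \ (Q ∪ B) := by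
          refine Finset.eq_of_subset_of_card_le (Finset.union_subset heu hfu) ?_
          rw [hW]
          by_contra hlt
          have i0 : (e.erase u).card = 2 := by rw [Finset.card_erase_of_mem hue, he3]
          have i0' : (f.erase u).card = 2 := by rw [Finset.card_erase_of_mem huf, hf3]
          have i1 : e.erase u = e.erase u ∪ f.erase u :=
            Finset.eq_of_subset_of_card_le Finset.subset_union_left (by omega)
          have i2 : f.erase u = e.erase u ∪ f.erase u :=
            Finset.eq_of_subset_of_card_le Finset.subset_union_right (by omega)
          apply hef
          rw [← Finset.insert_erase hue, ← Finset.insert_erase huf, i1, ← i2]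
        rw [← h4]
        exact Finset.union_subset_union (Finset.erase_subset _ _) (Finset.erase_subset _ _)
      have hrest : normal F ⊆ {e, f} := by
        intro g hg
        by_contra hgn
        rw [Finset.mem_insert, Finset.mem_singleton, not_or] at hgn
        have hg2 := h3 g hg
        obtain ⟨p, hp, q, hq, hpq⟩ := Finset.one_lt_card.1 (by omega : 1 < (g \ (Q ∪ B)).card)
        have hgF := (mem_normal.1 hg).1
        have h5 := hF.pair_subset he hf hef huw hue hw.1.1 huf hw.2.1 hgF hgn.1 hgn.2 hpq
          (hWe (hg2.2 hp)) (hWe (hg2.2 hq)) (Finset.mem_sdiff.1 hp).1 (Finset.mem_sdiff.1 hq).1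
        obtain ⟨z, hzu, hzw, hgz⟩ := exists_third (hF.card_eq g hgF) h5.1 h5.2 huw
        have hzg : z ∈ g := by rw [hgz]; simp
        have hzW : z ∈ S \ (Q ∪ B) := Finset.mem_sdiff.2 ⟨hS g hgF hzg, fun h =>
          hzu (hF.normal_inter_union hQ hB haQ haB hg hzg h5.1 h (hTU huT))⟩
        rcases Finset.mem_union.1 (hWe hzW) with h | h
        · exact hgn.1 (eq_of_subset_card (hF.card_eq g hgF) he3
            (by rw [hgz]; simp [Finset.insert_subset_iff, hue, hw.1.1, h]))
        · exact hgn.2 (eq_of_subset_card (hF.card_eq g hgF) hf3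
            (by rw [hgz]; simp [Finset.insert_subset_iff, huf, hw.2.1, h]))
      have := Finset.card_le_card hrest
      have := Finset.card_le_two (a := e) (b := f)
      omega
    have hcov : normal F ⊆ ((normal F).filter fun e => ∃ u ∈ Q, u ∈ e) ∪
        ((normal F).filter fun e => ∃ u ∈ B, u ∈ e) ∪ {S \ (Q ∪ B)} := by
      intro e he
      simp only [Finset.mem_union, Finset.mem_filter, Finset.mem_singleton]
      by_cases h4 : ∃ u ∈ Q, u ∈ e
      · exact Or.inl (Or.inl ⟨he, h4⟩)
      by_cases h5 : ∃ u ∈ B, u ∈ e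
      · exact Or.inl (Or.inr ⟨he, h5⟩)
      refine Or.inr (eq_of_subset_card (hF.card_eq e (mem_normal.1 he).1) hW fun x hx => ?_)
      refine Finset.mem_sdiff.2 ⟨hS e (mem_normal.1 he).1 hx, fun h => ?_⟩
      rcases Finset.mem_union.1 h with h | h
      · exact h4 ⟨x, h, hx⟩
      · exact h5 ⟨x, h, hx⟩
    have i1 := hside Q hQ Finset.subset_union_left
    have i2 := hside B hB Finset.subset_union_right
    have i3 := Finset.card_le_card hcov
    have i4 := Finset.card_union_le (((normal F).filter fun e => ∃ u ∈ Q, u ∈ e) ∪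
        ((normal F).filter fun e => ∃ u ∈ B, u ∈ e)) {S \ (Q ∪ B)}
    have i5 := Finset.card_union_le ((normal F).filter fun e => ∃ u ∈ Q, u ∈ e)
        ((normal F).filter fun e => ∃ u ∈ B, u ∈ e)
    rw [Finset.card_singleton] at i4
    omega

/-! ### Two disjoint blocks -/

theorem Closed.blocks_of_disjoint (hF : Closed F) {S : Finset V} (hS : ∀ e ∈ F, e ⊆ S)
    (hn : S.card ≤ 10) {Q B : Finset V} (hQ : IsBlock F Q) (hB : IsBlock F B) (hQB : Q ≠ B)
    (hdis : ∀ Q B, IsBlock F Q → IsBlock F B → Q ≠ B → Disjoint Q B) :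
    blocks F = {Q, B} ∧ (S \ (Q ∪ B)).card + 8 = S.card ∧ F.card = (normal F).card + 8 := by
  have h1 : (Q ∪ B).card = 8 := by
    rw [Finset.card_union_of_disjoint (hdis Q B hQ hB hQB), hQ.1, hB.1]
  have hbl : blocks F = {Q, B} := blocks_eq_pair hQ hB fun C hC => by
    by_contra! h
    have h2 : Disjoint (Q ∪ B) C := Finset.disjoint_union_left.2
      ⟨(hdis C Q hC hQ h.1).symm, (hdis C B hC hB h.2).symm⟩
    have h3 := Finset.card_le_card (Finset.union_subset (Finset.union_subset (hQ.subset hS)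
      (hB.subset hS)) (hC.subset hS))
    rw [Finset.card_union_of_disjoint h2, h1, hC.1] at h3
    omega
  refine ⟨hbl, ?_, ?_⟩
  · rw [← h1]
    exact Finset.card_sdiff_add_card_eq_card (Finset.union_subset (hQ.subset hS) (hB.subset hS))
  · have hm := hF.card_eq_normal_add
    rw [hbl, Finset.card_pair hQB] at hm
    omega

/-- A triple outside two disjoint blocks that has at most one vertex `w` outside their union
consists of `w` and one vertex of each block. -/
theorem Closed.exists_transversal (hF : Closed F) {Q B : Finset V} (hQ : IsBlock F Q)
    (hB : IsBlock F B) {e : Finset V} (he : e ∈ normal F) {w : V}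
    (hw : ∀ x ∈ e, x ∉ Q ∪ B → x = w) : w ∈ e ∧ w ∉ Q ∪ B ∧ ∃ x ∈ Q, ∃ y ∈ B, e = {w, x, y} := by
  have he3 := hF.card_eq e (mem_normal.1 he).1
  have hq : ∀ x ∈ e, ∀ y ∈ e, x ≠ y → ¬ (x ∈ Q ∧ y ∈ Q) := fun x hx y hy hxy h =>
    hF.not_block_pair he hQ hxy hx hy h.1 h.2
  have hb : ∀ x ∈ e, ∀ y ∈ e, x ≠ y → ¬ (x ∈ B ∧ y ∈ B) := fun x hx y hy hxy h =>
    hF.not_block_pair he hB hxy hx hy h.1 h.2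
  have hex : ∃ x ∈ e, x ∉ Q ∪ B := by
    by_contra! h
    have h1 : (e ∩ Q).card ≤ 1 := Finset.card_le_one.2 fun x hx y hy => by
      rw [Finset.mem_inter] at hx hy
      by_contra hxy
      exact hq x hx.1 y hy.1 hxy ⟨hx.2, hy.2⟩
    have h2 : (e ∩ B).card ≤ 1 := Finset.card_le_one.2 fun x hx y hy => by
      rw [Finset.mem_inter] at hx hy
      by_contra hxy
      exact hb x hx.1 y hy.1 hxy ⟨hx.2, hy.2⟩
    have h3 : e ⊆ (e ∩ Q) ∪ (e ∩ B) := fun x hx => by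
      have := h x hx
      rw [Finset.mem_union] at this
      rw [Finset.mem_union, Finset.mem_inter, Finset.mem_inter]
      tauto
    have h4 := Finset.card_le_card h3
    have h5 := Finset.card_union_le (e ∩ Q) (e ∩ B)
    omega
  obtain ⟨x, hx, hxU⟩ := hex
  obtain rfl := hw x hx hxU
  obtain ⟨p, q, hp, hq', hpq, hee⟩ := exists_two_of_mem he3 hx
  have hpe : p ∈ e := by rw [hee]; simp
  have hqe : q ∈ e := by rw [hee]; simp
  have hpU : p ∈ Q ∪ B := by
    by_contra h
    exact hp (hw p hpe h)
  have hqU : q ∈ Q ∪ B := by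
    by_contra h
    exact hq' (hw q hqe h)
  have k1 := hq p hpe q hqe hpq
  have k2 := hb p hpe q hqe hpq
  refine ⟨hx, hxU, ?_⟩
  rw [Finset.mem_union] at hpU hqU
  by_cases hpQ : p ∈ Q
  · exact ⟨p, hpQ, q, by tauto, hee⟩
  · exact ⟨q, by tauto, p, by tauto, by rw [hee, Finset.pair_comm]⟩

/-- A vertex `w` outside two blocks is joined to at most one vertex of each, so there is at most one
transversal triple through `w`. -/
theorem Closed.card_transversal_le (hF : Closed F) {Q B : Finset V} (hQ : IsBlock F Q)
    (hB : IsBlock F B) (w : V) :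
    ((normal F).filter fun e => ∀ x ∈ e, x ∉ Q ∪ B → x = w).card ≤ 1 := by
  refine Finset.card_le_one.2 fun e he f hf => ?_
  rw [Finset.mem_filter] at he hf
  obtain ⟨hwe, hwU, x, hx, y, hy, hee⟩ := hF.exists_transversal hQ hB he.1 he.2
  obtain ⟨hwf, -, x', hx', y', hy', hff⟩ := hF.exists_transversal hQ hB hf.1 hf.2
  rw [Finset.mem_union, not_or] at hwU
  have heF := (mem_normal.1 he.1).1
  have hfF := (mem_normal.1 hf.1).1
  have h1 : x = x' := hF.eq_of_adj_block hQ hwU.1 hx hx' heF hfF hwe (by rw [hee]; simp) hwf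
    (by rw [hff]; simp)
  have h2 : y = y' := hF.eq_of_adj_block hB hwU.2 hy hy' heF hfF hwe (by rw [hee]; simp) hwf
    (by rw [hff]; simp)
  rw [hee, hff, h1, h2]

theorem Closed.disjoint_eight (hF : Closed F) {S : Finset V} (hS : ∀ e ∈ F, e ⊆ S)
    (hn : S.card = 8) {Q B : Finset V} (hQ : IsBlock F Q) (hB : IsBlock F B) (hQB : Q ≠ B)
    (hdis : ∀ Q B, IsBlock F Q → IsBlock F B → Q ≠ B → Disjoint Q B) :
    blocks F = {Q, B} ∧ normal F = ∅ := by
  obtain ⟨h1, h2, -⟩ := hF.blocks_of_disjoint hS (by omega) hQ hB hQB hdis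
  refine ⟨h1, Finset.eq_empty_of_forall_notMem fun e he => ?_⟩
  have h3 : S \ (Q ∪ B) = ∅ := Finset.card_eq_zero.1 (by omega)
  have heF := (mem_normal.1 he).1
  have h4 : ∀ x ∈ e, x ∈ Q ∪ B := fun x hx => by
    by_contra h
    have : x ∈ S \ (Q ∪ B) := Finset.mem_sdiff.2 ⟨hS e heF hx, h⟩
    simp [h3] at this
  obtain ⟨x, hx⟩ := Finset.card_pos.1 (by rw [hF.card_eq e heF]; norm_num : 0 < e.card)
  have h5 := hF.exists_transversal hQ hB he (w := x) fun y hy h => (h (h4 y hy)).elim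
  exact h5.2.1 (h4 x hx)

theorem Closed.disjoint_nine (hF : Closed F) {S : Finset V} (hS : ∀ e ∈ F, e ⊆ S)
    (hn : S.card = 9) {Q B : Finset V} (hQ : IsBlock F Q) (hB : IsBlock F B) (hQB : Q ≠ B)
    (hdis : ∀ Q B, IsBlock F Q → IsBlock F B → Q ≠ B → Disjoint Q B) : F.card < 10 := by
  obtain ⟨-, h2, h3⟩ := hF.blocks_of_disjoint hS (by omega) hQ hB hQB hdis
  obtain ⟨w, hw⟩ := Finset.card_eq_one.1 (by omega : (S \ (Q ∪ B)).card = 1)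
  have h4 : normal F ⊆ (normal F).filter fun e => ∀ x ∈ e, x ∉ Q ∪ B → x = w := by
    intro e he
    refine Finset.mem_filter.2 ⟨he, fun x hx hxU => ?_⟩
    have : x ∈ S \ (Q ∪ B) := Finset.mem_sdiff.2 ⟨hS e (mem_normal.1 he).1 hx, hxU⟩
    simpa [hw] using this
  have := Finset.card_le_card h4
  have := hF.card_transversal_le hQ hB w
  omega

theorem Closed.disjoint_ten (hF : Closed F) {S : Finset V} (hS : ∀ e ∈ F, e ⊆ S)
    (hn : S.card = 10) {Q B : Finset V} (hQ : IsBlock F Q) (hB : IsBlock F B) (hQB : Q ≠ B)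
    (hdis : ∀ Q B, IsBlock F Q → IsBlock F B → Q ≠ B → Disjoint Q B) : F.card < 12 := by
  by_contra! hcard
  obtain ⟨-, h2, h3⟩ := hF.blocks_of_disjoint hS (by omega) hQ hB hQB hdis
  obtain ⟨w, w', hww, hW⟩ := Finset.card_eq_two.1 (by omega : (S \ (Q ∪ B)).card = 2)
  have hwU : w ∉ Q ∪ B := (Finset.mem_sdiff.1 (by rw [hW]; simp : w ∈ S \ (Q ∪ B))).2
  have hwU' : w' ∉ Q ∪ B := (Finset.mem_sdiff.1 (by rw [hW]; simp : w' ∈ S \ (Q ∪ B))).2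
  have hcase : ∀ e ∈ normal F, ∀ x ∈ e, x ∉ Q ∪ B → x = w ∨ x = w' := by
    intro e he x hx hxU
    have : x ∈ S \ (Q ∪ B) := Finset.mem_sdiff.2 ⟨hS e (mem_normal.1 he).1 hx, hxU⟩
    simpa [hW] using this
  have hpair : ∀ T, IsBlock F T → T ⊆ Q ∪ B →
      ((normal F).filter fun e => w ∈ e ∧ w' ∈ e ∧ ∃ x ∈ T, x ∈ e).card ≤ 1 := by
    intro T hT hTU
    refine Finset.card_le_one.2 fun e he f hf => ?_
    rw [Finset.mem_filter] at he hf
    obtain ⟨he, h1, h2, x, hx, hxe⟩ := he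
    obtain ⟨hf, i1, i2, y, hy, hyf⟩ := hf
    have heF := (mem_normal.1 he).1
    have hfF := (mem_normal.1 hf).1
    obtain rfl := hF.eq_of_adj_block hT (fun h => hwU (hTU h)) hx hy heF hfF h1 hxe i1 hyf
    have h4 : ({w, w', x} : Finset V).card = 3 := Finset.card_eq_three.2 ⟨w, w', x, hww,
      by rintro rfl; exact hwU (hTU hx), by rintro rfl; exact hwU' (hTU hx), rfl⟩
    rw [← eq_of_subset_card h4 (hF.card_eq e heF)
        (by simp [Finset.insert_subset_iff, h1, h2, hxe]),
      ← eq_of_subset_card h4 (hF.card_eq f hfF)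
        (by simp [Finset.insert_subset_iff, i1, i2, hyf])]
  set N1 := (normal F).filter fun e => ∀ x ∈ e, x ∉ Q ∪ B → x = w with hN1
  set N2 := (normal F).filter fun e => ∀ x ∈ e, x ∉ Q ∪ B → x = w' with hN2
  set N3 := (normal F).filter fun e => w ∈ e ∧ w' ∈ e ∧ ∃ x ∈ Q, x ∈ e with hN3
  set N4 := (normal F).filter fun e => w ∈ e ∧ w' ∈ e ∧ ∃ x ∈ B, x ∈ e with hN4
  have c1 : N1.card ≤ 1 := hF.card_transversal_le hQ hB w
  have c2 : N2.card ≤ 1 := hF.card_transversal_le hQ hB w'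
  have c3 : N3.card ≤ 1 := hpair Q hQ Finset.subset_union_left
  have c4 : N4.card ≤ 1 := hpair B hB Finset.subset_union_right
  have hcov : normal F ⊆ N1 ∪ N2 ∪ (N3 ∪ N4) := by
    intro e he
    have hc := hcase e he
    simp only [hN1, hN2, hN3, hN4, Finset.mem_union, Finset.mem_filter, he, true_and]
    by_cases hwe : w ∈ e
    · by_cases hwe' : w' ∈ e
      · right
        obtain ⟨u, hu, hu', hee⟩ := exists_third (hF.card_eq e (mem_normal.1 he).1) hwe hwe' hww
        have hue : u ∈ e := by rw [hee]; simp
        have huU : u ∈ Q ∪ B := by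
          by_contra h
          exact (hc u hue h).elim hu hu'
        rcases Finset.mem_union.1 huU with h | h
        · exact Or.inl ⟨hwe, hwe', u, h, hue⟩
        · exact Or.inr ⟨hwe, hwe', u, h, hue⟩
      · exact Or.inl (Or.inl fun x hx hxU =>
          (hc x hx (by rwa [Finset.mem_union])).resolve_right fun h => hwe' (h ▸ hx))
    · exact Or.inl (Or.inr fun x hx hxU =>
        (hc x hx (by rwa [Finset.mem_union])).resolve_left fun h => hwe (h ▸ hx))
  have i1 := Finset.card_le_card hcov
  have i2 := Finset.card_union_le (N1 ∪ N2) (N3 ∪ N4)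
  have i3 := Finset.card_union_le N1 N2
  have i4 := Finset.card_union_le N3 N4
  -- All four kinds occur, and three of the triples form a triangle in no block.
  obtain ⟨e, he⟩ := Finset.card_pos.1 (by omega : 0 < N1.card)
  obtain ⟨f, hf⟩ := Finset.card_pos.1 (by omega : 0 < N3.card)
  obtain ⟨g, hg⟩ := Finset.card_pos.1 (by omega : 0 < N4.card)
  rw [hN1, Finset.mem_filter] at he
  rw [hN3, Finset.mem_filter] at hf
  rw [hN4, Finset.mem_filter] at hg
  obtain ⟨hwe, -, x, hx, y, hy, hee⟩ := hF.exists_transversal hQ hB he.1 he.2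
  obtain ⟨hf, f1, f2, x', hx', hxf⟩ := hf
  obtain ⟨hg, g1, g2, y', hy', hyg⟩ := hg
  have heF := (mem_normal.1 he.1).1
  have hfF := (mem_normal.1 hf).1
  have hgF := (mem_normal.1 hg).1
  rw [Finset.mem_union, not_or] at hwU hwU'
  have hxe : x ∈ e := by rw [hee]; simp
  have hye : y ∈ e := by rw [hee]; simp
  obtain rfl := hF.eq_of_adj_block hQ hwU.1 hx hx' heF hfF hwe hxe f1 hxf
  obtain rfl := hF.eq_of_adj_block hB hwU.2 hy hy' heF hgF hwe hye g1 hyg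
  have hd := Finset.disjoint_left.1 (hdis Q B hQ hB hQB)
  have hxy : x ≠ y := by rintro rfl; exact hd hx hy
  have hxw : x ≠ w' := by rintro rfl; exact hwU'.1 hx
  have hyw : y ≠ w' := by rintro rfl; exact hwU'.2 hy
  have hwx : w ≠ x := by rintro rfl; exact hwU.1 hx
  have hwe' : w' ∉ e := by
    intro h
    rcases mem_triple.1 (hee ▸ h) with h | h | h
    · exact hww h.symm
    · exact hxw h.symm
    · exact hyw h.symm
  have hfg : f ≠ g := by
    rintro rfl
    obtain ⟨u, hu, hu', hff⟩ := exists_third (hF.card_eq f hfF) f1 f2 hww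
    have h1 := (mem_triple.1 (hff ▸ hxf)).resolve_left hwx.symm
    have h2 := (mem_triple.1 (hff ▸ hyg)).resolve_left (by rintro rfl; exact hwU.2 hy)
    exact hxy ((h1.resolve_left hxw).trans (h2.resolve_left hyw).symm)
  obtain ⟨Q', hQ', h, -⟩ := hF.exists_block x y w' e g f hxy hyw hxw heF hgF hfF
    (by rintro rfl; exact hwe' g2) hfg.symm (by rintro rfl; exact hwe' f2) hxe hye hyg g2 hxf f2
  exact (mem_normal.1 he.1).2 Q' hQ' h

/-! ### Extremal systems with blocks on eight, nine and ten vertices -/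

theorem exists_sharing_or_disjoint {W : Type*} (F : Finset (Finset W)) :
    (∃ Q B a, IsBlock F Q ∧ IsBlock F B ∧ Q ≠ B ∧ a ∈ Q ∧ a ∈ B) ∨
      ∀ Q B, IsBlock F Q → IsBlock F B → Q ≠ B → Disjoint Q B := by
  by_contra! h
  obtain ⟨Q, B, hQ, hB, hQB, hd⟩ := h.2
  obtain ⟨a, haQ, haB⟩ := Finset.not_disjoint_iff.1 hd
  exact h.1 Q B a hQ hB hQB haQ haB

/-- A system with at least `8` triples and a block consists of two blocks. -/
theorem Closed.eight_with_block (hF : Closed F) {S : Finset V} (hS : ∀ e ∈ F, e ⊆ S)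
    (hn : S.card = 8) (hcard : 8 ≤ F.card) (hQ : ∃ Q, IsBlock F Q) :
    ∃ Q B, Q ≠ B ∧ blocks F = {Q, B} ∧ normal F = ∅ ∧ (Disjoint Q B ∨ ∃ a, a ∈ Q ∧ a ∈ B) := by
  obtain ⟨Q, hQ⟩ := hQ
  rcases exists_sharing_or_disjoint F with ⟨Q, B, a, hQ, hB, hQB, haQ, haB⟩ | hdis
  · obtain ⟨h1, h2⟩ := hF.sharing_eight hS hn hQ hB hQB haQ haB
    exact ⟨Q, B, hQB, h1, h2, Or.inr ⟨a, haQ, haB⟩⟩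
  · by_cases hu : ∀ B, IsBlock F B → B = Q
    · have := hF.card_lt_of_unique_block_eight hS hQ hu hn
      omega
    · push Not at hu
      obtain ⟨B, hB, hBQ⟩ := hu
      obtain ⟨h1, h2⟩ := hF.disjoint_eight hS hn hQ hB hBQ.symm hdis
      exact ⟨Q, B, hBQ.symm, h1, h2, Or.inl (hdis Q B hQ hB hBQ.symm)⟩

/-- A system with at least `10` triples and a block consists of two blocks sharing a vertex and two
triples joining the blocks to the two remaining vertices. -/
theorem Closed.nine_with_block (hF : Closed F) {S : Finset V} (hS : ∀ e ∈ F, e ⊆ S)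
    (hn : S.card = 9) (hcard : 10 ≤ F.card) (hQ : ∃ Q, IsBlock F Q) :
    ∃ Q B a, Q ≠ B ∧ a ∈ Q ∧ a ∈ B ∧ blocks F = {Q, B} ∧
      ∃ x ∈ Q, ∃ y ∈ B, x ≠ a ∧ y ≠ a ∧ ∃ w w', S \ (Q ∪ B) = {w, w'} ∧
        normal F = {{x, w, w'}, {y, w, w'}} := by
  obtain ⟨Q, hQ⟩ := hQ
  rcases exists_sharing_or_disjoint F with ⟨Q, B, a, hQ, hB, hQB, haQ, haB⟩ | hdis
  · exact ⟨Q, B, a, hQB, haQ, haB, hF.sharing_nine hS hn hcard hQ hB hQB haQ haB⟩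
  · by_cases hu : ∀ B, IsBlock F B → B = Q
    · have := hF.card_lt_of_unique_block hS hQ hu (by omega)
      rw [hn] at this
      omega
    · push Not at hu
      obtain ⟨B, hB, hBQ⟩ := hu
      have := hF.disjoint_nine hS hn hQ hB hBQ.symm hdis
      omega

/-- A system with at least `12` triples and a block consists of three blocks, which share the vertex
`a = u` or form a path through `a ≠ u`. -/
theorem Closed.ten_with_block (hF : Closed F) {S : Finset V} (hS : ∀ e ∈ F, e ⊆ S)
    (hn : S.card = 10) (hcard : 12 ≤ F.card) (hQ : ∃ Q, IsBlock F Q) :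
    ∃ Q B C a u, Q ≠ B ∧ C ≠ Q ∧ C ≠ B ∧ a ∈ Q ∧ a ∈ B ∧ u ∈ B ∧ u ∈ C ∧ blocks F = {Q, B, C} ∧
      normal F = ∅ ∧ Q ∪ B ∪ C = S := by
  obtain ⟨Q, hQ⟩ := hQ
  rcases exists_sharing_or_disjoint F with ⟨Q, B, a, hQ, hB, hQB, haQ, haB⟩ | hdis
  · obtain ⟨h1, C, u, hC, hCQ, hCB, h2, huC, huU, h3⟩ :=
      hF.sharing_ten hS hn hcard hQ hB hQB haQ haB
    rcases Finset.mem_union.1 huU with h | h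
    · exact ⟨B, Q, C, a, u, hQB.symm, hCB, hCQ, haB, haQ, h, huC, by rw [h2, Finset.insert_comm],
        h1, by rw [Finset.union_comm B Q, h3]⟩
    · exact ⟨Q, B, C, a, u, hQB, hCQ, hCB, haQ, haB, h, huC, h2, h1, h3⟩
  · by_cases hu : ∀ B, IsBlock F B → B = Q
    · have := hF.card_lt_of_unique_block hS hQ hu (by omega)
      rw [hn] at this
      omega
    · push Not at hu
      obtain ⟨B, hB, hBQ⟩ := hu
      have := hF.disjoint_ten hS hn hQ hB hBQ.symm hdis
      omega

end

section

variable {V : Type*} [DecidableEq V] {F : Finset (Finset V)} {c : Finset V → V}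

/-! ### Eleven to fifteen vertices -/

theorem Closed.card_le_of_no_block (hF : Closed F) {S : Finset V} (hS : ∀ e ∈ F, e ⊆ S)
    (hb : ∀ Q, ¬ IsBlock F Q) : F.card ≤ S.card ^ 2 / 8 := by
  have := hF.card_normal_le hS
  rw [normal_eq_self hb] at this
  omega

theorem Closed.card_le_eight (hF : Closed F) {S : Finset V} (hS : ∀ e ∈ F, e ⊆ S)
    (hn : S.card = 8) : F.card ≤ 8 := by
  by_contra! h
  by_cases hQ : ∃ Q, IsBlock F Q
  · obtain ⟨Q, B, hQB, h1, h2, -⟩ := hF.eight_with_block hS hn (by omega) hQ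
    have := hF.card_eq_normal_add
    rw [h1, h2, Finset.card_pair hQB, Finset.card_empty] at this
    omega
  · push Not at hQ
    have := hF.card_le_of_no_block hS hQ
    rw [hn] at this
    omega

theorem Closed.card_le_nine (hF : Closed F) {S : Finset V} (hS : ∀ e ∈ F, e ⊆ S)
    (hn : S.card = 9) : F.card ≤ 10 := by
  by_contra! h
  by_cases hQ : ∃ Q, IsBlock F Q
  · obtain ⟨Q, B, a, hQB, -, -, h1, x, -, y, -, -, -, w, w', -, h2⟩ :=
      hF.nine_with_block hS hn (by omega) hQ
    have := hF.card_eq_normal_add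
    rw [h1, h2, Finset.card_pair hQB] at this
    have := Finset.card_le_two (a := ({x, w, w'} : Finset V)) (b := {y, w, w'})
    omega
  · push Not at hQ
    have := hF.card_le_of_no_block hS hQ
    rw [hn] at this
    omega

theorem Closed.card_le_ten (hF : Closed F) {S : Finset V} (hS : ∀ e ∈ F, e ⊆ S)
    (hn : S.card = 10) : F.card ≤ 12 := by
  by_contra! h
  by_cases hQ : ∃ Q, IsBlock F Q
  · obtain ⟨Q, B, C, a, u, hQB, -, -, -, -, -, -, h1, h2, -⟩ :=
      hF.ten_with_block hS hn (by omega) hQ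
    have := hF.card_eq_normal_add
    rw [h1, h2, Finset.card_empty] at this
    have := Finset.card_le_three (a := Q) (b := B) (c := C)
    omega
  · push Not at hQ
    have := hF.card_le_of_no_block hS hQ
    rw [hn] at this
    omega

/-- In an extremal system without blocks, and in a system that is a union of blocks, every triple
shares a pair with another triple. -/
theorem Closed.exists_sharing (hF : Closed F) {S : Finset V} (hS : ∀ e ∈ F, e ⊆ S)
    (hn : 8 ≤ S.card) (hcard : S.card ^ 2 / 8 ≤ F.card)
    (h : (∀ Q, ¬ IsBlock F Q) ∨ normal F = ∅) {g : Finset V} (hg : g ∈ F) :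
    ∃ f ∈ F, f ≠ g ∧ ∃ x y, x ≠ y ∧ x ∈ f ∧ y ∈ f ∧ x ∈ g ∧ y ∈ g := by
  rcases h with hb | hm
  · obtain ⟨P, hP, -, hk⟩ := hF.exists_isPairSystem hb hS hn hcard
    exact hP.exists_sharing hk hg
  · have hgn : g ∉ normal F := by rw [hm]; exact Finset.notMem_empty g
    rw [mem_normal] at hgn
    push Not at hgn
    obtain ⟨Q, hQ, hgQ⟩ := hgn hg
    have hg3 := hF.card_eq g hg
    obtain ⟨x, y, z, hxy, hxz, hyz, rfl⟩ := Finset.card_eq_three.1 hg3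
    obtain ⟨w, hw, hwg⟩ := Finset.exists_mem_notMem_of_card_lt_card
      (by rw [hg3, hQ.1]; norm_num : ({x, y, z} : Finset V).card < Q.card)
    have hx : x ∈ Q := hgQ (by simp)
    have hy : y ∈ Q := hgQ (by simp)
    refine ⟨{x, y, w}, hQ.triple_mem hx hy hw hxy (by rintro rfl; simp at hwg)
      (by rintro rfl; simp at hwg), fun h => hwg (h ▸ by simp), x, y, hxy, by simp, by simp,
      by simp, by simp⟩

theorem card_del_singleton (F : Finset (Finset V)) (x : V) :
    (del F {x}).card + (star F x).card = F.card := by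
  have : del F {x} = F.filter fun e => ¬ x ∈ e := by
    ext e
    simp [mem_del]
  rw [this, star, add_comm, Finset.card_filter_add_card_filter_not]

/-- Vertices of a block have large degree in extremal systems: otherwise deleting the vertex leaves
an extremal system with a triple all of whose pairs are private. -/
theorem Closed.lt_add_card_star (hF : Closed F) {S : Finset V} (hS : ∀ e ∈ F, e ⊆ S) {n : ℕ}
    (hn : S.card = n + 1) (h8 : 8 ≤ n)
    (hprev : ∀ F' : Finset (Finset V), ∀ S', Closed F' → (∀ e ∈ F', e ⊆ S') → S'.card = n →
      n ^ 2 / 8 ≤ F'.card → (∀ Q, ¬ IsBlock F' Q) ∨ normal F' = ∅)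
    {Q : Finset V} (hQ : IsBlock F Q) {x : V} (hx : x ∈ Q) :
    F.card < n ^ 2 / 8 + (star F x).card := by
  by_contra! hle
  have h1 := card_del_singleton F x
  have hSx : (S \ {x}).card = n := by
    rw [Finset.card_sdiff_of_subset (by simpa using hQ.subset hS hx), hn]; simp
  have hF' := hF.closed_del {x}
  have hcard : n ^ 2 / 8 ≤ (del F {x}).card := by omega
  have hg : Q.erase x ∈ del F {x} := by
    refine mem_del.2 ⟨hQ.mem (Finset.erase_subset _ _) ?_, by simp⟩
    rw [Finset.card_erase_of_mem hx, hQ.1]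
  obtain ⟨f, hf, hfg, a, b, hab, haf, hbf, hag, hbg⟩ := hF'.exists_sharing (del_subset_sdiff hS)
    (by omega) (by rw [hSx]; exact hcard) (hprev _ _ hF' (del_subset_sdiff hS) hSx hcard) hg
  rw [mem_del, Finset.disjoint_singleton_right] at hf
  have hfQ := hF.subset_of_two_mem hQ hf.1 hab haf hbf (Finset.mem_erase.1 hag).2
    (Finset.mem_erase.1 hbg).2
  refine hfg (eq_of_subset_card (hF.card_eq f hf.1) (by rw [Finset.card_erase_of_mem hx, hQ.1])
    fun u hu => Finset.mem_erase.2 ⟨by rintro rfl; exact hf.2 hu, hfQ hu⟩)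

/-- Closed systems with at least `n ^ 2 / 8` triples, supported on `n` vertices of `V`, have no
block. -/
def ExtremalBlockFree (V : Type*) [DecidableEq V] (n : ℕ) : Prop :=
  ∀ (F : Finset (Finset V)) (S : Finset V), Closed F → (∀ e ∈ F, e ⊆ S) → S.card = n →
    n ^ 2 / 8 ≤ F.card → ∀ Q, ¬ IsBlock F Q

/-- The constraints on the numbers of triples, neighbours and blocks at the vertices of a block; `m`
is the number of triples at `x` outside the blocks. -/
theorem Closed.block_constraints (hF : Closed F) {S : Finset V} (hS : ∀ e ∈ F, e ⊆ S)
    {Q : Finset V} (hQ : IsBlock F Q) :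
    (∀ x ∈ Q, ∃ m b, (star F x).card = m + 3 * b ∧ 1 ≤ b ∧ (blocksAt F x).card = b ∧
      (star F x).card ≤ (nbr F x).card ∧ (m = 0 ∨ (star F x).card < (nbr F x).card)) ∧
    ∑ x ∈ Q, (nbr F x).card ≤ S.card + 8 ∧
    F.card + 8 = (del F Q).card + ∑ x ∈ Q, (star F x).card := by
  refine ⟨fun x hx => ⟨_, _, hF.card_star x, Finset.card_pos.2 ⟨Q, mem_blocksAt.2 ⟨hQ, hx⟩⟩, rfl,
    (hF.card_star_le x).1, ?_⟩, hF.sum_card_nbr_le hS hQ, hF.card_add_eight hQ⟩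
  rcases Finset.eq_empty_or_nonempty ((normal F).filter fun e => x ∈ e) with h | h
  · exact Or.inl (by rw [h, Finset.card_empty])
  · exact Or.inr ((hF.card_star_le x).2 h)

theorem sum_four {g : V → ℕ} {x y u v : V} (hux : u ≠ x) (huy : u ≠ y) (hvx : v ≠ x) (hvy : v ≠ y)
    (huv : u ≠ v) (hxy : x ≠ y) : ∑ t ∈ ({x, y, u, v} : Finset V), g t = g x + g y + g u + g v := by
  rw [Finset.sum_insert (by simp [hxy, hux.symm, hvx.symm]),
    Finset.sum_insert (by simp [huy.symm, hvy.symm]), Finset.sum_pair huv]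
  ring

theorem IsBlock.exists_eq {Q : Finset V} (hQ : IsBlock F Q) : ∃ x y u v, u ≠ x ∧ u ≠ y ∧ v ≠ x ∧
    v ≠ y ∧ u ≠ v ∧ x ≠ y ∧ Q = {x, y, u, v} := by
  obtain ⟨x, hx, y, hy, hxy⟩ := Finset.one_lt_card.1 (by have := hQ.1; omega : 1 < Q.card)
  obtain ⟨u, v, h1, h2, h3, h4, h5, h6⟩ := exists_other_two hQ.1 hx hy hxy
  exact ⟨x, y, u, v, h1, h2, h3, h4, h5, hxy, h6⟩

/-- The degree count at a block `Q`. If the vertices of `Q` have degree at least `L` and total degree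
at least `M`, then `∑ deg ≤ ∑ |nbr| ≤ n + 8`, where the first inequality is strict at every vertex in
a triple outside the blocks, and the degree is divisible by `3` at the other vertices. For the listed
values this is impossible. -/
theorem Closed.not_block_of_bounds (hF : Closed F) {S : Finset V} (hS : ∀ e ∈ F, e ⊆ S)
    {Q : Finset V} (hQ : IsBlock F Q) {L M : ℕ} (hL : ∀ x ∈ Q, L ≤ (star F x).card)
    (hM : M + (del F Q).card ≤ F.card + 8)
    (hnum : S.card = 11 ∧ L = 4 ∧ M = 17 ∨ S.card = 12 ∧ L = 4 ∧ M = 18 ∨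
      S.card = 13 ∧ L = 4 ∧ M = 19 ∨ S.card = 15 ∧ L = 5 ∧ M = 21) : False := by
  obtain ⟨h1, h2, h3⟩ := hF.block_constraints hS hQ
  obtain ⟨x, y, u, v, hux, huy, hvx, hvy, huv, hxy, rfl⟩ := hQ.exists_eq
  rw [sum_four hux huy hvx hvy huv hxy] at h2 h3
  obtain ⟨m1, b1, i1, j1, -, k1, l1⟩ := h1 x (by simp)
  obtain ⟨m2, b2, i2, j2, -, k2, l2⟩ := h1 y (by simp)
  obtain ⟨m3, b3, i3, j3, -, k3, l3⟩ := h1 u (by simp)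
  obtain ⟨m4, b4, i4, j4, -, k4, l4⟩ := h1 v (by simp)
  have o1 := hL x (by simp)
  have o2 := hL y (by simp)
  have o3 := hL u (by simp)
  have o4 := hL v (by simp)
  generalize (star F x).card = t1 at *
  generalize (star F y).card = t2 at *
  generalize (star F u).card = t3 at *
  generalize (star F v).card = t4 at *
  clear h1 hL hQ hS hF
  rcases hnum with ⟨h, rfl, rfl⟩ | ⟨h, rfl, rfl⟩ | ⟨h, rfl, rfl⟩ | ⟨h, rfl, rfl⟩ <;>
    rcases l1 with rfl | l1 <;> rcases l2 with rfl | l2 <;> rcases l3 with rfl | l3 <;>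
    rcases l4 with rfl | l4 <;> omega

/-- If deleting a block `Q` leaves a block `B`, each vertex of `Q` is in a triple outside `Q`, which
contains one of the three vertices outside `Q ∪ B`. Distinct vertices of `Q` cannot share the latter.
If it leaves no block, the degree count applies. -/
theorem extremalBlockFree_eleven : ExtremalBlockFree V 11 := by
  intro F S hF hS hn hcard Q hQ
  norm_num at hcard
  have hL : ∀ x ∈ Q, 4 ≤ (star F x).card := by
    intro x hx
    have := hF.lt_add_card_star hS (n := 10) hn (by norm_num) (fun F' S' hF' hS' hn' hc' => by
      by_cases h : ∃ Q, IsBlock F' Q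
      · obtain ⟨-, -, -, -, -, -, -, -, -, -, -, -, -, h, -⟩ := hF'.ten_with_block hS' hn' hc' h
        exact Or.inr h
      · push Not at h
        exact Or.inl h) hQ hx
    norm_num at this
    omega
  have hQS := hQ.subset hS
  have hQc : (S \ Q).card = 7 := by rw [Finset.card_sdiff_of_subset hQS, hn, hQ.1]
  by_cases hb : ∃ B, IsBlock (del F Q) B
  · obtain ⟨B, hB⟩ := hb
    rw [isBlock_del] at hB
    have hex : ∀ x ∈ Q, ∃ w, w ∈ (S \ Q) \ B ∧ ∃ e ∈ F, x ∈ e ∧ w ∈ e := by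
      intro x hx
      have h1 : ∃ e ∈ star F x, ¬ e ⊆ Q := by
        by_contra! h
        have h2 : star F x ⊆ (Q.powersetCard 3).filter fun e => x ∈ e := fun e he => by
          have h3 := mem_star.1 he
          exact Finset.mem_filter.2 ⟨Finset.mem_powersetCard.2 ⟨h e he, hF.card_eq e h3.1⟩, h3.2⟩
        have := Finset.card_le_card h2
        rw [card_block_triples_at hQ.1 hx] at this
        have := hL x hx
        omega
      obtain ⟨e, he, heQ⟩ := h1
      rw [mem_star] at he
      have h2 : (e ∩ B).card ≤ 1 := Finset.card_le_one.2 fun p hp q hq => by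
        rw [Finset.mem_inter] at hp hq
        by_contra hpq
        exact Finset.disjoint_left.1 hB.2
          (hF.subset_of_two_mem hB.1 he.1 hpq hp.1 hq.1 hp.2 hq.2 he.2) hx
      have h3 : (e ∩ Q).card ≤ 1 := Finset.card_le_one.2 fun p hp q hq => by
        rw [Finset.mem_inter] at hp hq
        by_contra hpq
        exact heQ (hF.subset_of_two_mem hQ he.1 hpq hp.1 hq.1 hp.2 hq.2)
      have h4 := hF.card_eq e he.1
      by_contra! hno
      have h5 : e ⊆ (e ∩ B) ∪ (e ∩ Q) := by
        intro p hp
        rw [Finset.mem_union, Finset.mem_inter, Finset.mem_inter]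
        by_contra! hpn
        exact hno p (Finset.mem_sdiff.2 ⟨Finset.mem_sdiff.2 ⟨hS e he.1 hp, hpn.2 hp⟩, hpn.1 hp⟩) e
          he.1 he.2 hp
      have := Finset.card_le_card h5
      have := Finset.card_union_le (e ∩ B) (e ∩ Q)
      omega
    obtain ⟨v, -⟩ := Finset.card_pos.1 (by omega : 0 < S.card)
    have : Nonempty V := ⟨v⟩
    choose! w hw hadj using hex
    have hinj : Set.InjOn w (Q : Set V) := by
      intro x hx y hy hxy
      obtain ⟨e, he, hxe, hwe⟩ := hadj x hx
      obtain ⟨f, hf, hyf, hwf⟩ := hadj y hy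
      exact hF.eq_of_adj_block hQ (Finset.mem_sdiff.1 (Finset.mem_sdiff.1 (hw x hx)).1).2 hx hy he
        hf hwe hxe (hxy ▸ hwf) hyf
    have h1 := Finset.card_le_card (Finset.image_subset_iff.2 hw)
    have h2 : B ⊆ S \ Q := fun x hx => Finset.mem_sdiff.2
      ⟨hB.1.subset hS hx, Finset.disjoint_left.1 hB.2 hx⟩
    rw [Finset.card_image_of_injOn hinj, Finset.card_sdiff_of_subset h2, hQ.1, hB.1.1, hQc] at h1
    omega
  · push Not at hb
    have hd := (hF.closed_del Q).card_le_of_no_block (del_subset_sdiff hS) hb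
    rw [hQc] at hd
    exact hF.not_block_of_bounds hS hQ hL (M := 17) (by omega) (by simp [hn])

theorem ExtremalBlockFree.lt_add_card_star {n : ℕ} (h : ExtremalBlockFree V n) (h8 : 8 ≤ n)
    (hF : Closed F) {S : Finset V} (hS : ∀ e ∈ F, e ⊆ S) (hn : S.card = n + 1) {Q : Finset V}
    (hQ : IsBlock F Q) {x : V} (hx : x ∈ Q) : F.card < n ^ 2 / 8 + (star F x).card :=
  hF.lt_add_card_star hS hn h8 (fun F' S' hF' hS' hn' hc' => Or.inl (h F' S' hF' hS' hn' hc')) hQ hx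

theorem ExtremalBlockFree.card_le {n : ℕ} (h : ExtremalBlockFree V n) (hF : Closed F)
    {S : Finset V} (hS : ∀ e ∈ F, e ⊆ S) (hn : S.card = n) : F.card ≤ n ^ 2 / 8 := by
  by_contra! hlt
  have := hF.card_le_of_no_block hS (h F S hF hS hn hlt.le)
  rw [hn] at this
  omega

theorem extremalBlockFree_twelve : ExtremalBlockFree V 12 := by
  intro F S hF hS hn hcard Q hQ
  norm_num at hcard
  have hQc : (S \ Q).card = 8 := by rw [Finset.card_sdiff_of_subset (hQ.subset hS), hn, hQ.1]
  have hd := (hF.closed_del Q).card_le_eight (del_subset_sdiff hS) hQc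
  exact hF.not_block_of_bounds hS hQ (L := 4) (M := 18) (fun x hx => by
    have := extremalBlockFree_eleven.lt_add_card_star (by norm_num) hF hS hn hQ hx
    norm_num at this
    omega) (by omega) (by simp [hn])

theorem extremalBlockFree_thirteen : ExtremalBlockFree V 13 := by
  intro F S hF hS hn hcard Q hQ
  norm_num at hcard
  have hQc : (S \ Q).card = 9 := by rw [Finset.card_sdiff_of_subset (hQ.subset hS), hn, hQ.1]
  have hd := (hF.closed_del Q).card_le_nine (del_subset_sdiff hS) hQc
  exact hF.not_block_of_bounds hS hQ (L := 4) (M := 19) (fun x hx => by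
    have := extremalBlockFree_twelve.lt_add_card_star (by norm_num) hF hS hn hQ hx
    norm_num at this
    omega) (by omega) (by simp [hn])

/-- Two vertices `x`, `y` of degree four in a block, two of whose triples are common, can be deleted.
If a third vertex of the block is in another block, that block survives. -/
theorem Closed.false_of_two_small (hF : Closed F) {S : Finset V} (hS : ∀ e ∈ F, e ⊆ S)
    (hn : S.card = 14) (hcard : 24 ≤ F.card) {Q : Finset V} (hQ : IsBlock F Q) {x y z : V}
    (hx : x ∈ Q) (hy : y ∈ Q) (hz : z ∈ Q) (hxy : x ≠ y) (hzx : z ≠ x) (hzy : z ≠ y)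
    (htx : (star F x).card = 4) (hty : (star F y).card = 4) (hb : 2 ≤ (blocksAt F z).card) :
    False := by
  obtain ⟨C, hC, hCQ⟩ := Finset.exists_mem_ne (by omega : 1 < (blocksAt F z).card) Q
  rw [mem_blocksAt] at hC
  have hd : ∀ u ∈ Q, u ≠ z → u ∉ C := fun u hu huz huC =>
    hCQ (hF.block_eq hC.1 hQ huz huC hC.2 hu hz)
  have hblock : IsBlock (del F {x, y}) C := by
    refine isBlock_del.2 ⟨hC.1, ?_⟩
    rw [Finset.disjoint_insert_right, Finset.disjoint_singleton_right]
    exact ⟨hd x hx hzx.symm, hd y hy hzy.symm⟩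
  have hSc : (S \ {x, y}).card = 12 := by
    rw [Finset.card_sdiff_of_subset, hn, Finset.card_pair hxy]
    simp [Finset.insert_subset_iff, hQ.subset hS hx, hQ.subset hS hy]
  refine extremalBlockFree_twelve (del F {x, y}) (S \ {x, y}) (hF.closed_del _)
    (del_subset_sdiff hS) hSc ?_ C hblock
  norm_num
  obtain ⟨u, v, hux, huy, hvx, hvy, huv, hQe⟩ := exists_other_two hQ.1 hx hy hxy
  have hu : u ∈ Q := by rw [hQe]; simp
  have hv : v ∈ Q := by rw [hQe]; simp
  have h1 : 1 < (star F x ∩ star F y).card := by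
    refine Finset.one_lt_card.2 ⟨{x, y, u}, ?_, {x, y, v}, ?_, ?_⟩
    · rw [Finset.mem_inter, mem_star, mem_star]
      have := hQ.triple_mem hx hy hu hxy hux.symm huy.symm
      exact ⟨⟨this, by simp⟩, this, by simp⟩
    · rw [Finset.mem_inter, mem_star, mem_star]
      have := hQ.triple_mem hx hy hv hxy hvx.symm hvy.symm
      exact ⟨⟨this, by simp⟩, this, by simp⟩
    · intro h
      rcases mem_triple.1 (h ▸ (by simp : u ∈ ({x, y, u} : Finset V))) with h | h | h
      · exact hux h
      · exact huy h
      · exact huv h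
  have h2 := Finset.card_union_add_card_inter (star F x) (star F y)
  have h3 : F ⊆ del F {x, y} ∪ (star F x ∪ star F y) := by
    intro e he
    simp only [Finset.mem_union, mem_del, mem_star, he, true_and, Finset.disjoint_insert_right,
      Finset.disjoint_singleton_right]
    tauto
  have h4 := Finset.card_le_card h3
  have h5 := Finset.card_union_le (del F {x, y}) (star F x ∪ star F y)
  omega

/-- Here the degree count leaves one case: two vertices of the block have degree `4`, and the other
two are in two blocks. Deleting the former leaves an extremal system on twelve vertices with a
block. -/
theorem extremalBlockFree_fourteen : ExtremalBlockFree V 14 := by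
  intro F S hF hS hn hcard Q hQ
  norm_num at hcard
  have hQc : (S \ Q).card = 10 := by rw [Finset.card_sdiff_of_subset (hQ.subset hS), hn, hQ.1]
  have hd := (hF.closed_del Q).card_le_ten (del_subset_sdiff hS) hQc
  have hL : ∀ x ∈ Q, 4 ≤ (star F x).card := fun x hx => by
    have := extremalBlockFree_thirteen.lt_add_card_star (by norm_num) hF hS hn hQ hx
    norm_num at this
    omega
  have hsmall : ∀ x ∈ Q, ∀ y ∈ Q, ∀ z ∈ Q, x ≠ y → z ≠ x → z ≠ y → (star F x).card = 4 →
      (star F y).card = 4 → (blocksAt F z).card < 2 := by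
    intro x hx y hy z hz hxy hzx hzy htx hty
    by_contra! hb
    exact hF.false_of_two_small hS hn hcard hQ hx hy hz hxy hzx hzy htx hty hb
  obtain ⟨h1, h2, h3⟩ := hF.block_constraints hS hQ
  obtain ⟨x, y, u, v, hux, huy, hvx, hvy, huv, hxy, rfl⟩ := hQ.exists_eq
  have s1 := hsmall x (by simp) y (by simp) u (by simp) hxy hux huy
  have s2 := hsmall x (by simp) u (by simp) y (by simp) hux.symm hxy.symm huy.symm
  have s3 := hsmall x (by simp) v (by simp) y (by simp) hvx.symm hxy.symm hvy.symm
  have s4 := hsmall y (by simp) u (by simp) x (by simp) huy.symm hxy hux.symm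
  have s5 := hsmall y (by simp) v (by simp) x (by simp) hvy.symm hxy hvx.symm
  have s6 := hsmall u (by simp) v (by simp) x (by simp) huv hux.symm hvx.symm
  rw [sum_four hux huy hvx hvy huv hxy] at h2 h3
  obtain ⟨m1, b1, i1, j1, e1, k1, l1⟩ := h1 x (by simp)
  obtain ⟨m2, b2, i2, j2, e2, k2, l2⟩ := h1 y (by simp)
  obtain ⟨m3, b3, i3, j3, e3, k3, l3⟩ := h1 u (by simp)
  obtain ⟨m4, b4, i4, j4, e4, k4, l4⟩ := h1 v (by simp)
  have o1 := hL x (by simp)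
  have o2 := hL y (by simp)
  have o3 := hL u (by simp)
  have o4 := hL v (by simp)
  rw [e1] at s4 s5 s6
  rw [e2] at s2 s3
  rw [e3] at s1
  generalize (star F x).card = t1 at *
  generalize (star F y).card = t2 at *
  generalize (star F u).card = t3 at *
  generalize (star F v).card = t4 at *
  clear h1 hL hQ hS hF hsmall
  have key : (t1 = 4 ∧ t2 = 4 ∧ 2 ≤ b3) ∨ (t1 = 4 ∧ t3 = 4 ∧ 2 ≤ b2) ∨ (t1 = 4 ∧ t4 = 4 ∧ 2 ≤ b2) ∨
      (t2 = 4 ∧ t3 = 4 ∧ 2 ≤ b1) ∨ (t2 = 4 ∧ t4 = 4 ∧ 2 ≤ b1) ∨ (t3 = 4 ∧ t4 = 4 ∧ 2 ≤ b1) := by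
    clear s1 s2 s3 s4 s5 s6
    -- A vertex in no triple outside the blocks has degree `3 * b ≥ 4`, so `b ≥ 2`.
    have c1 : t1 < (nbr F x).card ∨ 6 ≤ t1 ∧ 2 ≤ b1 := by omega
    have c2 : t2 < (nbr F y).card ∨ 6 ≤ t2 ∧ 2 ≤ b2 := by omega
    have c3 : t3 < (nbr F u).card ∨ 6 ≤ t3 ∧ 2 ≤ b3 := by omega
    have c4 : t4 < (nbr F v).card ∨ 6 ≤ t4 ∧ 2 ≤ b4 := by omega
    clear l1 l2 l3 l4 i1 i2 i3 i4
    rcases c1 with c1 | c1 <;> rcases c2 with c2 | c2 <;> rcases c3 with c3 | c3 <;>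
      rcases c4 with c4 | c4 <;> first
        | (exfalso; omega)
        | exact Or.inl ⟨by omega, by omega, by omega⟩
        | exact Or.inr (Or.inl ⟨by omega, by omega, by omega⟩)
        | exact Or.inr (Or.inr (Or.inl ⟨by omega, by omega, by omega⟩))
        | exact Or.inr (Or.inr (Or.inr (Or.inl ⟨by omega, by omega, by omega⟩)))
        | exact Or.inr (Or.inr (Or.inr (Or.inr (Or.inl ⟨by omega, by omega, by omega⟩))))
        | exact Or.inr (Or.inr (Or.inr (Or.inr (Or.inr ⟨by omega, by omega, by omega⟩))))
  rcases key with ⟨p, q, r⟩ | ⟨p, q, r⟩ | ⟨p, q, r⟩ | ⟨p, q, r⟩ | ⟨p, q, r⟩ | ⟨p, q, r⟩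
  · exact absurd (s1 p q) (by omega)
  · exact absurd (s2 p q) (by omega)
  · exact absurd (s3 p q) (by omega)
  · exact absurd (s4 p q) (by omega)
  · exact absurd (s5 p q) (by omega)
  · exact absurd (s6 p q) (by omega)

theorem extremalBlockFree_fifteen : ExtremalBlockFree V 15 := by
  intro F S hF hS hn hcard Q hQ
  norm_num at hcard
  have hQc : (S \ Q).card = 11 := by rw [Finset.card_sdiff_of_subset (hQ.subset hS), hn, hQ.1]
  have hd := extremalBlockFree_eleven.card_le (hF.closed_del Q) (del_subset_sdiff hS) hQc
  norm_num at hd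
  exact hF.not_block_of_bounds hS hQ (L := 5) (M := 21) (fun x hx => by
    have := extremalBlockFree_fourteen.lt_add_card_star (by norm_num) hF hS hn hQ hx
    norm_num at this
    omega) (by omega) (by simp [hn])

end

section

variable {V : Type*} [DecidableEq V] {F : Finset (Finset V)} {c : Finset V → V}

/-! ### The weighted degree count for sixteen and more vertices -/

/-- The excess of a vertex in `b` blocks with `d` neighbours in the graph of private pairs and block
pairs, where `D = n - 2 * d`. The coefficients are chosen such that the excesses add up to at most
`n * (n ^ 2 - 8 * |F|)`, see `Closed.sum_excess_le`. -/
def excess (n b D : ℤ) : ℤ := D ^ 2 - 6 * b * D + 4 * b * (n - 12)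

/-- The defect `n - 2 * d` of a vertex, with `n = |S|` and `d` the number of its neighbours in the
graph of private pairs and block pairs. -/
def defect (F : Finset (Finset V)) (c : Finset V → V) (S : Finset V) (x : V) : ℤ :=
  S.card - 2 * (gnbr F c x).card

theorem Closed.defect_eq (hF : Closed F) (S : Finset V) (x : V) : defect F c S x =
    S.card - 2 * (hnbr F c x).card - 6 * (blocksAt F x).card := by
  rw [defect, card_gnbr hF]
  push_cast
  ring

/-- With `h` private pairs at a vertex, the excess is
`n ^ 2 - 4 * n * d + 4 * d * (h + 6 * b) - (2 * n + 48) * b`. The sums of `d * h` and `d * b` are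
bounded through the private pairs and through the blocks, and the other sums are known. -/
theorem Closed.sum_excess_le (hF : Closed F) (hc : IsCenters F c) {S : Finset V}
    (hS : ∀ e ∈ F, e ⊆ S) :
    ∑ x ∈ S, excess S.card (blocksAt F x).card (defect F c S x) ≤
      S.card * ((S.card : ℤ) ^ 2 - 8 * F.card) := by
  have h1 : (2 : ℤ) * ∑ x ∈ S, ((gnbr F c x).card : ℤ) * (hnbr F c x).card ≤
      S.card * ∑ x ∈ S, ((hnbr F c x).card : ℤ) := by
    exact_mod_cast hF.sum_gnbr_mul_hnbr_le hc hS
  have h2 : ∑ x ∈ S, ((gnbr F c x).card : ℤ) * (blocksAt F x).card ≤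
      (S.card + 8) * (blocks F).card := by
    exact_mod_cast hF.sum_gnbr_mul_blocksAt_le (c := c) hS
  have h3 : ∑ x ∈ S, ((hnbr F c x).card : ℤ) = 4 * (normal F).card := by
    exact_mod_cast sum_card_hnbr hF hc hS
  have h4 : ∑ x ∈ S, ((blocksAt F x).card : ℤ) = 4 * (blocks F).card := by
    exact_mod_cast sum_card_blocksAt hS
  have h5 : (F.card : ℤ) = (normal F).card + 4 * (blocks F).card := by
    exact_mod_cast hF.card_eq_normal_add
  have h6 : ∀ x ∈ S, excess S.card (blocksAt F x).card (defect F c S x) =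
      (S.card : ℤ) ^ 2 + (4 * (((gnbr F c x).card : ℤ) * (hnbr F c x).card) +
        (24 * (((gnbr F c x).card : ℤ) * (blocksAt F x).card) +
          (-(4 * S.card) * ((hnbr F c x).card : ℤ) +
            (-(14 * S.card + 48)) * ((blocksAt F x).card : ℤ)))) := by
    intro x _
    have h := card_gnbr (c := c) hF x
    have h' : ((gnbr F c x).card : ℤ) = (hnbr F c x).card + 3 * (blocksAt F x).card := by
      exact_mod_cast h
    rw [excess, defect, h']
    ring
  rw [Finset.sum_congr rfl h6]
  simp only [Finset.sum_add_distrib, ← Finset.mul_sum, h3, h4, Finset.sum_const, nsmul_eq_mul]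
  rw [h3] at h1
  rw [h5]
  nlinarith

/-- The condition on `D` says that a vertex in `b` blocks has at least `3 * b` neighbours. The excess,
as a quadratic polynomial in `D`, is minimal at `D = 3 * b`, or at the end `n - 6 * b` of the range
if `9 * b > n`. -/
theorem two_le_excess {n b D : ℤ} (hn : 17 ≤ n) (hb : 1 ≤ b) (hD : D ≤ n - 6 * b) :
    2 ≤ excess n b D := by
  unfold excess
  by_cases h : 9 * b ≤ n
  · nlinarith [sq_nonneg (D - 3 * b), mul_nonneg (by omega : 0 ≤ b - 1) (by omega : 0 ≤ n - 9 * b)]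
  · have h1 : 0 ≤ (n - 6 * b - D) * (12 * b - n - D) :=
      mul_nonneg (by omega) (by omega)
    have h2 : 2 ≤ n ^ 2 - 14 * b * n + 72 * b ^ 2 - 48 * b := by
      rcases eq_or_lt_of_le hn with h | h
      · subst h
        have : 2 ≤ b := by omega
        nlinarith
      · nlinarith [sq_nonneg (144 * b - (14 * n + 48))]
    linarith

theorem four_mul_lt_excess {n b D : ℤ} (hn : 18 ≤ n) (hb : 1 ≤ b) (hD : D ≤ n - 6 * b) :
    4 * n < 7 * excess n b D := by
  unfold excess
  by_cases h : 9 * b ≤ n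
  · have h1 : 4 * n < 7 * (b * (4 * n - 48 - 9 * b)) := by
      rcases (by omega : b = 1 ∨ b = 2 ∨ 3 ≤ b) with rfl | rfl | h3
      · omega
      · omega
      · nlinarith [mul_nonneg (by omega : 0 ≤ b - 3) (by omega : 0 ≤ n - 9 * b)]
    nlinarith [sq_nonneg (D - 3 * b)]
  · have h1 : 0 ≤ (n - 6 * b - D) * (12 * b - n - D) :=
      mul_nonneg (by omega) (by omega)
    have h2 : 4 * n < 7 * (n ^ 2 - 14 * b * n + 72 * b ^ 2 - 48 * b) := by
      nlinarith [sq_nonneg (144 * b - (14 * n + 48))]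
    linarith

theorem excess_sixteen {b D : ℤ} (hb : 1 ≤ b) (hD : D ≤ 16 - 6 * b) :
    0 ≤ excess 16 b D ∧ (excess 16 b D ≤ 0 → b = 2 ∧ D = 4) := by
  unfold excess
  rcases (by omega : b = 1 ∨ b = 2 ∨ 3 ≤ b) with rfl | rfl | h3
  · have : 0 < D ^ 2 - 6 * 1 * D + 4 * 1 * (16 - 12) := by nlinarith [sq_nonneg (D - 3)]
    omega
  · have h1 : 0 ≤ (4 - D) * (8 - D) := mul_nonneg (by omega) (by omega)
    refine ⟨by nlinarith, fun h => ⟨rfl, ?_⟩⟩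
    have h2 : (4 - D) * (8 - D) = 0 := by nlinarith
    rcases mul_eq_zero.1 h2 with h | h <;> omega
  · have h1 : 0 ≤ (16 - 6 * b - D) * (12 * b - 16 - D) := mul_nonneg (by omega) (by omega)
    have h2 : 0 < (16 : ℤ) ^ 2 - 14 * b * 16 + 72 * b ^ 2 - 48 * b := by nlinarith
    have : 0 < D ^ 2 - 6 * b * D + 4 * b * (16 - 12) := by linarith
    omega

theorem IsBlock.one_le_card_blocksAt {Q : Finset V} (hQ : IsBlock F Q) {x : V} (hx : x ∈ Q) :
    1 ≤ (blocksAt F x).card :=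
  Finset.card_pos.2 ⟨Q, mem_blocksAt.2 ⟨hQ, hx⟩⟩

theorem Closed.seven_le_card_union (hF : Closed F) {Q B : Finset V} (hQ : IsBlock F Q)
    (hB : IsBlock F B) (hQB : Q ≠ B) : 7 ≤ (Q ∪ B).card := by
  have h1 : (Q ∩ B).card ≤ 1 := Finset.card_le_one.2 fun x hx y hy => by
    rw [Finset.mem_inter] at hx hy
    by_contra hxy
    exact hQB (hF.block_eq hQ hB hxy hx.1 hy.1 hx.2 hy.2)
  have h2 := Finset.card_union_add_card_inter Q B
  rw [hQ.1, hB.1] at h2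
  omega

/-- The sum of the excesses is at most `n * (n ^ 2 % 8)`. It is larger if there is a block: for odd `n`
because the defects are odd, and for `n ≡ 2` modulo `4` because there are two blocks, hence at
least seven vertices of excess more than `4 * n / 7`. -/
theorem extremalBlockFree_of_le {n : ℕ} (hn : 17 ≤ n) : ExtremalBlockFree V n := by
  intro F S hF hS hSn hcard Q hQ
  obtain ⟨x, hx⟩ := Finset.card_pos.1 (by have := hQ.1; omega : 0 < Q.card)
  have : Nonempty V := ⟨x⟩
  obtain ⟨c, hc⟩ := hF.exists_centers
  have hsum := hF.sum_excess_le hc hS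
  have hD : ∀ y, defect F c S y ≤ S.card - 6 * (blocksAt F y).card := fun y => by
    rw [hF.defect_eq]
    omega
  have hxS := hQ.subset hS hx
  have hr : n ^ 2 ≤ 8 * F.card + n ^ 2 % 8 := by omega
  have hrz : (n : ℤ) ^ 2 - 8 * F.card ≤ (n ^ 2 % 8 : ℕ) := by
    have : ((n ^ 2 : ℕ) : ℤ) ≤ 8 * F.card + (n ^ 2 % 8 : ℕ) := by exact_mod_cast hr
    push_cast at this ⊢
    linarith
  have hsum' := hsum.trans (mul_le_mul_of_nonneg_left (hSn ▸ hrz) (by positivity))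
  rw [hSn] at hsum' hD
  set p : V → ℤ := fun y => excess n (blocksAt F y).card (defect F c S y) with hp
  have hblock : ∀ y, 1 ≤ (blocksAt F y).card → 2 ≤ p y := fun y hy =>
    two_le_excess (by exact_mod_cast hn) (by exact_mod_cast hy) (hD y)
  have hfree : ∀ y, (blocksAt F y).card = 0 → p y = defect F c S y ^ 2 := fun y hy => by
    rw [hp]
    simp [excess, hy]
  have hnonneg : ∀ y, 0 ≤ p y := fun y => by
    rcases Nat.eq_zero_or_pos (blocksAt F y).card with h | h
    · rw [hfree y h]; positivity
    · linarith [hblock y h]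
  have hpx := hblock x (hQ.one_le_card_blocksAt hx)
  rcases Nat.even_or_odd n with he | ho
  · rcases (by rcases he with ⟨k, rfl⟩; omega : n % 4 = 0 ∨ n % 4 = 2) with h | h
    · have h0 : n ^ 2 % 8 = 0 := by
        obtain ⟨k, rfl⟩ : 4 ∣ n := Nat.dvd_of_mod_eq_zero h
        rw [mul_pow]; omega
      rw [h0] at hsum'
      have h1 := Finset.single_le_sum (f := p) (fun y _ => hnonneg y) hxS
      simp only [Nat.cast_zero, mul_zero] at hsum'
      linarith
    · have h4 : n ^ 2 % 8 = 4 := by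
        obtain ⟨k, hk⟩ : ∃ k, n = 4 * k + 2 := ⟨n / 4, by omega⟩
        rw [hk, show (4 * k + 2) ^ 2 = 8 * (2 * k ^ 2 + 2 * k) + 4 by ring]
        omega
      rw [h4] at hsum'
      have hB : ∃ B, IsBlock F B ∧ B ≠ Q := by
        by_contra! hu
        have := hF.card_lt_of_unique_block hS hQ hu (by omega)
        rw [hSn] at this
        omega
      obtain ⟨B, hB, hBQ⟩ := hB
      have h7 := hF.seven_le_card_union hQ hB hBQ.symm
      have hU : Q ∪ B ⊆ S := Finset.union_subset (hQ.subset hS) (hB.subset hS)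
      have h1 : ∑ y ∈ Q ∪ B, p y ≤ ∑ y ∈ S, p y :=
        Finset.sum_le_sum_of_subset_of_nonneg hU fun y _ _ => hnonneg y
      have h2 : (Q ∪ B).card • (4 * (n : ℤ) + 1) ≤ ∑ y ∈ Q ∪ B, 7 * p y := by
        refine Finset.card_nsmul_le_sum _ _ _ fun y hy => ?_
        have hy1 : 1 ≤ (blocksAt F y).card := by
          rcases Finset.mem_union.1 hy with hy | hy
          · exact hQ.one_le_card_blocksAt hy
          · exact hB.one_le_card_blocksAt hy
        exact four_mul_lt_excess (by omega) (by exact_mod_cast hy1) (hD y)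
      rw [← Finset.mul_sum, nsmul_eq_mul] at h2
      have h7' : (7 : ℤ) ≤ (Q ∪ B).card := by exact_mod_cast h7
      push_cast at hsum'
      nlinarith
  · have h0 : n ^ 2 % 8 = 1 := by
      have h1 := Nat.eight_dvd_sq_sub_one_of_odd ho
      have h2 : 0 < n ^ 2 := by positivity
      omega
    rw [h0] at hsum'
    have hge : ∀ y, 1 ≤ p y := fun y => by
      rcases Nat.eq_zero_or_pos (blocksAt F y).card with h | h
      · rw [hfree y h]
        have hne : defect F c S y ≠ 0 := by
          rw [defect, hSn]
          obtain ⟨k, rfl⟩ := ho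
          push_cast
          omega
        have := sq_pos_of_ne_zero hne
        omega
      · linarith [hblock y h]
    have h1 : ∑ y ∈ S, (1 : ℤ) < ∑ y ∈ S, p y :=
      Finset.sum_lt_sum (fun y _ => hge y) ⟨x, hxS, by linarith⟩
    simp only [Finset.sum_const, nsmul_eq_mul, mul_one, hSn, Nat.cast_one] at h1 hsum'
    linarith

/-- Equality in the bound for sixteen vertices forces every vertex of a block to have excess zero. -/
theorem Closed.sixteen_card_le (hF : Closed F) {S : Finset V} (hS : ∀ e ∈ F, e ⊆ S)
    (hSn : S.card = 16) : F.card ≤ 32 ∧ (32 ≤ F.card → ∀ x ∈ S, 1 ≤ (blocksAt F x).card →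
      (blocksAt F x).card = 2 ∧ ∀ e ∈ normal F, x ∉ e) := by
  obtain ⟨v, -⟩ := Finset.card_pos.1 (by omega : 0 < S.card)
  have : Nonempty V := ⟨v⟩
  obtain ⟨c, hc⟩ := hF.exists_centers
  have hsum := hF.sum_excess_le hc hS
  have hD : ∀ y, defect F c S y ≤ S.card - 6 * (blocksAt F y).card := fun y => by
    rw [hF.defect_eq]
    omega
  rw [hSn] at hsum
  rw [hSn] at hD
  push_cast at hsum hD
  have hnonneg : ∀ y, 0 ≤ excess 16 (blocksAt F y).card (defect F c S y) := fun y => by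
    rcases Nat.eq_zero_or_pos (blocksAt F y).card with h | h
    · simp only [excess, h]
      push_cast
      nlinarith [sq_nonneg (defect F c S y)]
    · exact (excess_sixteen (by exact_mod_cast h) (hD y)).1
  have h0 := Finset.sum_nonneg fun y (_ : y ∈ S) => hnonneg y
  refine ⟨by omega, fun h32 x hx hb => ?_⟩
  have h1 := Finset.single_le_sum (f := fun y => excess 16 (blocksAt F y).card (defect F c S y))
    (fun y _ => hnonneg y) hx
  obtain ⟨h2, h3⟩ := (excess_sixteen (by exact_mod_cast hb) (hD x)).2 (by
    linarith)
  have h4 : (blocksAt F x).card = 2 := by exact_mod_cast h2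
  refine ⟨h4, fun e he hxe => ?_⟩
  have h5 : (hnbr F c x).card = 0 := by
    rw [hF.defect_eq, hSn] at h3
    push_cast at h3
    omega
  rw [card_hnbr hF hc, Finset.sum_eq_zero_iff] at h5
  have := h5 e he
  rw [if_pos hxe] at this
  split_ifs at this

end

section

variable {V : Type*} [DecidableEq V] {F : Finset (Finset V)}

/-! ### The lattice on sixteen vertices -/

/-- If every vertex of a block `Q` is in exactly one further block, the further blocks are pairwise
disjoint. Hence they cover sixteen vertices; `r` sends a vertex to its representative in `Q`. -/
theorem Closed.exists_retraction (hF : Closed F) {S : Finset V} (hS : ∀ e ∈ F, e ⊆ S)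
    (hSn : S.card = 16) {Q : Finset V} (hQ : IsBlock F Q)
    (hb : ∀ x ∈ Q, (blocksAt F x).card = 2) :
    ∃ r : V → V, (∀ z ∈ S, r z ∈ Q) ∧ ∀ x ∈ Q, r x = x ∧ IsBlock F (S.filter fun z => r z = x) := by
  have h1 : ∀ x ∈ Q, ∃ B, IsBlock F B ∧ x ∈ B ∧ B ≠ Q := fun x hx => by
    obtain ⟨B, hB, hBQ⟩ := Finset.exists_mem_ne (by rw [hb x hx]; norm_num) Q
    rw [mem_blocksAt] at hB
    exact ⟨B, hB.1, hB.2, hBQ⟩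
  choose! B hB hxB hBQ using h1
  have hQB : ∀ x ∈ Q, ∀ z ∈ Q, z ∈ B x → z = x := fun x hx z hz hzB => by
    by_contra hne
    exact hBQ x hx (hF.block_eq (hB x hx) hQ hne hzB (hxB x hx) hz hx)
  have huniq : ∀ x ∈ Q, ∀ y ∈ Q, ∀ z, z ∈ B x → z ∈ B y → x = y := by
    intro x hx y hy z hzx hzy
    by_cases hz : z ∈ Q
    · exact (hQB x hx z hz hzx).symm.trans (hQB y hy z hz hzy)
    · obtain ⟨e, he, hxe, hze, -⟩ := (hB x hx).exists_triple_pair (hxB x hx) hzx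
        (by rintro rfl; exact hz hx)
      obtain ⟨f, hf, hyf, hzf, -⟩ := (hB y hy).exists_triple_pair (hxB y hy) hzy
        (by rintro rfl; exact hz hy)
      exact hF.eq_of_adj_block hQ hz hx hy he hf hze hxe hzf hyf
  have hcover : Q.biUnion B = S := by
    refine Finset.eq_of_subset_of_card_le
      (Finset.biUnion_subset.2 fun x hx => (hB x hx).subset hS) ?_
    rw [Finset.card_biUnion fun x hx y hy hxy => Finset.disjoint_left.2 fun z hzx hzy =>
      hxy (huniq x hx y hy z hzx hzy), Finset.sum_congr rfl fun x hx => (hB x hx).1, hSn]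
    simp [hQ.1]
  have h2 : ∀ z ∈ S, ∃ x ∈ Q, z ∈ B x := fun z hz => by
    rw [← hcover] at hz
    exact Finset.mem_biUnion.1 hz
  have : Nonempty V := by
    obtain ⟨x, -⟩ := Finset.card_pos.1 (by omega : 0 < S.card)
    exact ⟨x⟩
  choose! r hr hzr using h2
  refine ⟨r, hr, fun x hx => ?_⟩
  have hrx : ∀ z ∈ S, z ∈ B x → r z = x := fun z hz hzx =>
    huniq _ (hr z hz) x hx z (hzr z hz) hzx
  refine ⟨hrx x (hQ.subset hS hx) (hxB x hx), ?_⟩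
  have : (S.filter fun z => r z = x) = B x := by
    ext z
    rw [Finset.mem_filter]
    exact ⟨fun h => h.2 ▸ hzr z h.1, fun h => ⟨(hB x hx).subset hS h,
      hrx z ((hB x hx).subset hS h) h⟩⟩
  rw [this]
  exact hB x hx

theorem exists_fin_coordinate {Q : Finset V} (hQ : Q.card = 4) {S : Finset V} {r : V → V}
    (hr : ∀ z ∈ S, r z ∈ Q) : ∃ ρ : V → Fin 4, ∀ z ∈ S, ∀ w ∈ S, ρ z = ρ w ↔ r z = r w := by
  refine ⟨fun z => if h : r z ∈ Q then Q.equivFinOfCardEq hQ ⟨r z, h⟩ else 0,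
    fun z hz w hw => ?_⟩
  simp only [hr z hz, hr w hw, dif_pos, EmbeddingLike.apply_eq_iff_eq, Subtype.mk.injEq]

theorem mem_Q44 {e : Finset (Fin 4 × Fin 4)} : e ∈ Q44 ↔ e.card = 3 ∧
    ((∃ i, ∀ p ∈ e, p.1 = i) ∨ ∃ j, ∀ p ∈ e, p.2 = j) := by
  simp only [Q44, completeOn, Finset.mem_biUnion, Finset.mem_union, Finset.mem_image,
    Finset.mem_univ, true_and, Finset.mem_powersetCard]
  constructor
  · rintro ⟨q, ⟨i, rfl⟩ | ⟨i, rfl⟩, h1, h2⟩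
    · exact ⟨h2, Or.inl ⟨i, fun p hp => (Finset.mem_filter.1 (h1 hp)).2⟩⟩
    · exact ⟨h2, Or.inr ⟨i, fun p hp => (Finset.mem_filter.1 (h1 hp)).2⟩⟩
  · rintro ⟨h2, ⟨i, h⟩ | ⟨i, h⟩⟩
    · exact ⟨_, Or.inl ⟨i, rfl⟩, fun p hp => Finset.mem_filter.2 ⟨Finset.mem_univ _, h p hp⟩, h2⟩
    · exact ⟨_, Or.inr ⟨i, rfl⟩, fun p hp => Finset.mem_filter.2 ⟨Finset.mem_univ _, h p hp⟩, h2⟩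

/-- The representatives with respect to a block `Q` and to a block `C ≠ Q` meeting it are coordinates
for which the blocks are exactly the lines. -/
theorem Closed.iso_lattice [Fintype V] (hF : Closed F) (hV : Fintype.card V = 16)
    (hcard : 32 ≤ F.card) {Q : Finset V} (hQ : IsBlock F Q) : Iso F Q44 := by
  have hS : ∀ e ∈ F, e ⊆ (Finset.univ : Finset V) := fun e _ => Finset.subset_univ e
  have hSn : (Finset.univ : Finset V).card = 16 := hV
  have hb : ∀ x, 1 ≤ (blocksAt F x).card → _ := fun x =>
    (hF.sixteen_card_le hS hSn).2 hcard x (Finset.mem_univ x)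
  have hb2 : ∀ B, IsBlock F B → ∀ x ∈ B, (blocksAt F x).card = 2 := fun B hB x hx =>
    (hb x (hB.one_le_card_blocksAt hx)).1
  obtain ⟨r, hrQ, hr⟩ := hF.exists_retraction hS hSn hQ (hb2 Q hQ)
  obtain ⟨x₀, hx₀⟩ := Finset.card_pos.1 (by have := hQ.1; omega : 0 < Q.card)
  have hC := (hr x₀ hx₀).2
  set C := Finset.univ.filter fun z => r z = x₀ with hCdef
  obtain ⟨s, hsC, hs⟩ := hF.exists_retraction hS hSn hC (hb2 C hC)
  have hall : ∀ z : V, 1 ≤ (blocksAt F z).card := fun z =>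
    (hr (r z) (hrQ z (Finset.mem_univ z))).2.one_le_card_blocksAt (by simp)
  have hnormal : normal F = ∅ := by
    refine Finset.eq_empty_of_forall_notMem fun e he => ?_
    obtain ⟨x, hx⟩ := Finset.card_pos.1
      (by rw [hF.card_eq e (mem_normal.1 he).1]; norm_num : 0 < e.card)
    exact (hb x (hall x)).2 e he hx
  -- A line of the first direction is not a line of the second direction.
  have hne : ∀ x ∈ Q, ∀ y ∈ C, (Finset.univ.filter fun z => r z = x) ≠
      Finset.univ.filter fun z => s z = y := by
    intro x hx y hy h
    have h1 : r y = x := by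
      have : y ∈ Finset.univ.filter fun z => s z = y := by simp [(hs y hy).1]
      rw [← h] at this
      simpa using this
    have h2 : r y = x₀ := by
      rw [hCdef] at hy
      simpa using hy
    obtain ⟨w, hw, hwy⟩ := Finset.exists_mem_ne (by rw [hC.1]; norm_num : 1 < C.card) y
    have h3 : w ∈ Finset.univ.filter fun z => r z = x := by
      rw [hCdef] at hw
      rw [← h1, h2]
      exact hw
    rw [h] at h3
    have h4 : s w = y := by simpa using h3
    exact hwy ((hs w hw).1.symm.trans h4)
  have hinj : ∀ z w, r z = r w → s z = s w → z = w := by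
    intro z w h1 h2
    by_contra hzw
    have hz1 := hrQ z (Finset.mem_univ z)
    have hz2 := hsC z (Finset.mem_univ z)
    exact hne _ hz1 _ hz2 (hF.block_eq (hr _ hz1).2 (hs _ hz2).2 hzw (by simp) (by simp [h1])
      (by simp) (by simp [h2]))
  have hblock : ∀ B, IsBlock F B → ∃ z, B = (Finset.univ.filter fun w => r w = r z) ∨
      B = Finset.univ.filter fun w => s w = s z := by
    intro B hB
    obtain ⟨z, hz⟩ := Finset.card_pos.1 (by have := hB.1; omega : 0 < B.card)
    refine ⟨z, ?_⟩
    have hz1 := hrQ z (Finset.mem_univ z)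
    have hz2 := hsC z (Finset.mem_univ z)
    have h1 : ({Finset.univ.filter fun w => r w = r z, Finset.univ.filter fun w => s w = s z} :
        Finset (Finset V)) ⊆ blocksAt F z := by
      intro D hD
      rw [Finset.mem_insert, Finset.mem_singleton] at hD
      rw [mem_blocksAt]
      rcases hD with rfl | rfl
      · exact ⟨(hr _ hz1).2, by simp⟩
      · exact ⟨(hs _ hz2).2, by simp⟩
    have h2 := Finset.eq_of_subset_of_card_le h1 (by
      rw [hb2 B hB z hz, Finset.card_pair (hne _ hz1 _ hz2)])
    have h3 := mem_blocksAt.2 ⟨hB, hz⟩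
    rw [← h2] at h3
    simpa using h3
  obtain ⟨ρ, hρ⟩ := exists_fin_coordinate hQ.1 hrQ
  obtain ⟨τ, hτ⟩ := exists_fin_coordinate hC.1 hsC
  have hbij : Function.Bijective fun z => (ρ z, τ z) := by
    rw [Fintype.bijective_iff_injective_and_card]
    refine ⟨fun z w h => ?_, by simp [hV]⟩
    rw [Prod.mk.injEq] at h
    exact hinj z w ((hρ z (Finset.mem_univ z) w (Finset.mem_univ w)).1 h.1)
      ((hτ z (Finset.mem_univ z) w (Finset.mem_univ w)).1 h.2)
  refine ⟨Equiv.ofBijective _ hbij, fun e => ?_⟩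
  rw [mem_Q44, Finset.card_map]
  simp only [Finset.forall_mem_map, Equiv.coe_toEmbedding, Equiv.ofBijective_apply]
  constructor
  · intro he
    have h3 := hF.card_eq e he
    refine ⟨h3, ?_⟩
    have h1 : e ∉ normal F := by rw [hnormal]; exact Finset.notMem_empty e
    rw [mem_normal] at h1
    push Not at h1
    obtain ⟨B, hB, heB⟩ := h1 he
    obtain ⟨z, h | h⟩ := hblock B hB
    · refine Or.inl ⟨ρ z, fun w hw => (hρ w (Finset.mem_univ w) z (Finset.mem_univ z)).2 ?_⟩
      have := heB hw
      rw [h] at this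
      simpa using this
    · refine Or.inr ⟨τ z, fun w hw => (hτ w (Finset.mem_univ w) z (Finset.mem_univ z)).2 ?_⟩
      have := heB hw
      rw [h] at this
      simpa using this
  · rintro ⟨h3, ⟨i, h⟩ | ⟨i, h⟩⟩ <;>
      obtain ⟨z, hz⟩ := Finset.card_pos.1 (by rw [h3]; norm_num : 0 < e.card)
    · exact (hr _ (hrQ z (Finset.mem_univ z))).2.mem (fun w hw => by
        simpa using (hρ w (Finset.mem_univ w) z (Finset.mem_univ z)).1
          ((h w hw).trans (h z hz).symm)) h3
    · exact (hs _ (hsC z (Finset.mem_univ z))).2.mem (fun w hw => by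
        simpa using (hτ w (Finset.mem_univ w) z (Finset.mem_univ z)).1
          ((h w hw).trans (h z hz).symm)) h3

end

section

variable {V : Type*} [DecidableEq V] {F : Finset (Finset V)}

/-! ### Freeness in terms of triangles -/

/-- Triple systems in which three distinct triples forming a triangle span at most four vertices. By
`weak_iff` these are the systems in which `A`, `B` and `D` do not occur. -/
structure Weak (F : Finset (Finset V)) : Prop where
  card_eq : ∀ e ∈ F, e.card = 3
  card_le : ∀ e ∈ F, ∀ f ∈ F, ∀ g ∈ F, e ≠ f → f ≠ g → e ≠ g → ∀ x ∈ e ∩ g, ∀ y ∈ e ∩ f,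
    ∀ z ∈ f ∩ g, x ≠ y → y ≠ z → x ≠ z → (e ∪ f ∪ g).card ≤ 4

theorem not_weak_of_map {m : ℕ} {T : Finset (Finset (Fin m))} (φ : Fin m ↪ V)
    (hφ : ∀ e ∈ T, e.map φ ∈ F)
    (hT : ∃ e ∈ T, ∃ f ∈ T, ∃ g ∈ T, e ≠ f ∧ f ≠ g ∧ e ≠ g ∧ ∃ x ∈ e ∩ g,
      ∃ y ∈ e ∩ f, ∃ z ∈ f ∩ g, x ≠ y ∧ y ≠ z ∧ x ≠ z ∧ 4 < (e ∪ f ∪ g).card) : ¬ Weak F := by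
  obtain ⟨e, he, f, hf, g, hg, hef, hfg, heg, x, hx, y, hy, z, hz, hxy, hyz, hxz, h4⟩ := hT
  intro hw
  have hi : ∀ s t : Finset (Fin m), s ≠ t → s.map φ ≠ t.map φ := fun s t hst h =>
    hst (Finset.map_injective φ h)
  have h1 := hw.card_le _ (hφ e he) _ (hφ f hf) _ (hφ g hg) (hi _ _ hef) (hi _ _ hfg) (hi _ _ heg)
    (φ x) (by rw [← Finset.map_inter]; exact Finset.mem_map_of_mem φ hx)
    (φ y) (by rw [← Finset.map_inter]; exact Finset.mem_map_of_mem φ hy)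
    (φ z) (by rw [← Finset.map_inter]; exact Finset.mem_map_of_mem φ hz)
    (fun h => hxy (φ.injective h)) (fun h => hyz (φ.injective h)) (fun h => hxz (φ.injective h))
  rw [← Finset.map_union, ← Finset.map_union, Finset.card_map] at h1
  omega

theorem contains_A {x y z u v w : V} (h : [x, y, z, u, v, w].Nodup) (h1 : {x, y, u} ∈ F)
    (h2 : {x, z, v} ∈ F) (h3 : {y, z, w} ∈ F) : Contains F .A := by
  have key : ∃ f : Fin 6 ↪ V, ∀ e ∈ ({{0, 1, 3}, {0, 2, 4}, {1, 2, 5}} : Finset (Finset (Fin 6))),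
      e.map f ∈ F := by
    refine ⟨⟨![x, y, z, u, v, w], List.nodup_ofFn.1 (by simpa [List.ofFn_succ] using h)⟩, ?_⟩
    simp [h1, h2, h3]
  exact key

theorem contains_B {x y z u v : V} (h : [x, y, z, v, u].Nodup) (h1 : {x, y, u} ∈ F)
    (h2 : {x, z, v} ∈ F) (h3 : {y, z, v} ∈ F) : Contains F .B := by
  have key : ∃ f : Fin 5 ↪ V, ∀ e ∈ ({{0, 1, 4}, {0, 2, 3}, {1, 2, 3}} : Finset (Finset (Fin 5))),
      e.map f ∈ F := by
    refine ⟨⟨![x, y, z, v, u], List.nodup_ofFn.1 (by simpa [List.ofFn_succ] using h)⟩, ?_⟩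
    simp [h1, h2, h3]
  exact key

theorem contains_D {x y z v w : V} (h : [x, y, z, v, w].Nodup) (h1 : {x, y, z} ∈ F)
    (h2 : {x, z, v} ∈ F) (h3 : {y, z, w} ∈ F) : Contains F .D := by
  have key : ∃ f : Fin 5 ↪ V, ∀ e ∈ ({{0, 1, 2}, {0, 2, 3}, {1, 2, 4}} : Finset (Finset (Fin 5))),
      e.map f ∈ F := by
    refine ⟨⟨![x, y, z, v, w], List.nodup_ofFn.1 (by simpa [List.ofFn_succ] using h)⟩, ?_⟩
    simp [h1, h2, h3]
  exact key

/-- A triangle on `x, y, z` consists of `{x, y, u}`, `{y, z, w}`, `{x, z, v}`. It is a copy of `D` if one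
of the triples is `{x, y, z}`, and otherwise a copy of `A`, `B` or the configuration on four vertices
according to the coincidences among `u, v, w`. -/
theorem weak_iff : Weak F ↔ IsTripleSystem F ∧ IsFree {Config.A, Config.B, Config.D} F := by
  constructor
  · intro h
    refine ⟨h.card_eq, fun X hX hc => ?_⟩
    rcases hX with rfl | rfl | rfl
    · obtain ⟨φ, hφ⟩ := hc
      exact not_weak_of_map (m := 6) (T := {{0, 1, 3}, {0, 2, 4}, {1, 2, 5}}) φ hφ (by decide) h
    · obtain ⟨φ, hφ⟩ := hc
      exact not_weak_of_map (m := 5) (T := {{0, 1, 4}, {0, 2, 3}, {1, 2, 3}}) φ hφ (by decide) h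
    · obtain ⟨φ, hφ⟩ := hc
      exact not_weak_of_map (m := 5) (T := {{0, 1, 2}, {0, 2, 3}, {1, 2, 4}}) φ hφ (by decide) h
  · rintro ⟨h3, hfree⟩
    have hA : ¬ Contains F .A := hfree _ (by simp)
    have hB : ¬ Contains F .B := hfree _ (by simp)
    have hD : ¬ Contains F .D := hfree _ (by simp)
    refine ⟨h3, fun e he f hf g hg hef hfg heg x hx y hy z hz hxy hyz hxz => ?_⟩
    rw [Finset.mem_inter] at hx hy hz
    obtain ⟨u, hux, huy, rfl⟩ := exists_third (h3 e he) hx.1 hy.1 hxy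
    obtain ⟨w, hwy, hwz, rfl⟩ := exists_third (h3 f hf) hy.2 hz.1 hyz
    obtain ⟨v, hvx, hvz, rfl⟩ := exists_third (h3 g hg) hx.2 hz.2 hxz
    clear hx hy hz
    have hcard : ∀ p q r s : V,
        ({x, y, u} ∪ {y, z, w} ∪ {x, z, v} : Finset V) ⊆ {p, q, r, s} →
        ({x, y, u} ∪ {y, z, w} ∪ {x, z, v} : Finset V).card ≤ 4 := fun p q r s h =>
      (Finset.card_le_card h).trans Finset.card_le_four
    have c1 : ∀ p q r : V, ({p, q, r} : Finset V) = {q, p, r} := fun p q r =>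
      Finset.insert_comm _ _ _
    have c2 : ∀ p q r : V, ({p, q, r} : Finset V) = {p, r, q} := fun p q r => by
      rw [Finset.pair_comm]
    by_cases huz : u = z
    · subst huz
      by_cases hvw : v = w
      · exact hcard x y u v (by subst hvw; intro t; simp)
      · refine absurd (contains_D (x := x) (y := y) (z := u) (v := v) (w := w) ?_ he hg hf) hD
        have : v ≠ y := by rintro rfl; exact heg (c2 _ _ _)
        have : w ≠ x := by rintro rfl; exact hef (by rw [c1 w, c2])
        simp
        grind
    by_cases hwx : w = x
    · subst hwx
      by_cases huv : u = v
      · exact hcard w y z u (by subst huv; intro t; simp; tauto)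
      · refine absurd (contains_D (x := y) (y := z) (z := w) (v := u) (w := v) ?_ hf
          (c1 w y u ▸ he) (c1 w z v ▸ hg)) hD
        have : v ≠ y := by rintro rfl; exact hfg (by rw [c2, c1, c2, c1, c2])
        simp
        grind
    by_cases hvy : v = y
    · subst hvy
      by_cases huw : u = w
      · exact hcard x v z u (by subst huw; intro t; simp; tauto)
      · refine absurd (contains_D (x := x) (y := z) (z := v) (v := u) (w := w) ?_ hg he
          (c1 v z w ▸ hf)) hD
        simp
        grind
    by_cases huv : u = v
    · subst huv
      by_cases huw : u = w
      · exact hcard x y z u (by subst huw; intro t; simp; tauto)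
      · refine absurd (contains_B (x := y) (y := z) (z := x) (v := u) (u := w) ?_ hf
          (c1 x y u ▸ he) (c1 x z u ▸ hg)) hB
        simp
        grind
    by_cases huw : u = w
    · subst huw
      refine absurd (contains_B (x := x) (y := z) (z := y) (v := u) (u := v) ?_ hg he
        (c1 y z u ▸ hf)) hB
      simp
      grind
    by_cases hvw : v = w
    · subst hvw
      refine absurd (contains_B (x := x) (y := y) (z := z) (v := v) (u := u) ?_ he hg hf) hB
      simp
      grind
    refine absurd (contains_A (x := x) (y := y) (z := z) (u := u) (v := v) (w := w) ?_ he hg hf) hA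
    simp
    grind

theorem Weak.subset_union (h : Weak F) {f g k : Finset V} (hf : f ∈ F) (hg : g ∈ F) (hk : k ∈ F)
    (hfg : f ≠ g) (hgk : g ≠ k) (hfk : f ≠ k) (h4 : (g ∪ k).card = 4) {p q r : V} (hpf : p ∈ f)
    (hqf : q ∈ f) (hqg : q ∈ g) (hrg : r ∈ g) (hrk : r ∈ k) (hpk : p ∈ k) (hpq : p ≠ q)
    (hqr : q ≠ r) (hpr : p ≠ r) : f ⊆ g ∪ k := by
  have h1 := h.card_le f hf g hg k hk hfg hgk hfk p (by simp [*]) q (by simp [*]) r (by simp [*])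
    hpq hqr hpr
  rw [Finset.union_assoc] at h1
  rw [Finset.eq_of_subset_of_card_le Finset.subset_union_right (by omega : (f ∪ (g ∪ k)).card ≤ _)]
  exact Finset.subset_union_left

/-- Three triples of a four-set behave as the complete system: a triple with two vertices in the
four-set lies in it. -/
theorem Weak.subset_of_two_mem (h : Weak F) {a b d e : V} (hab : a ≠ b) (had : a ≠ d) (hae : a ≠ e)
    (hbd : b ≠ d) (hbe : b ≠ e) (hde : d ≠ e) (h1 : {a, b, d} ∈ F) (h2 : {a, b, e} ∈ F)
    (h3 : {a, d, e} ∈ F) {f : Finset V} (hf : f ∈ F) {u v : V} (huv : u ≠ v) (huf : u ∈ f)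
    (hvf : v ∈ f) (hu : u ∈ ({a, b, d, e} : Finset V)) (hv : v ∈ ({a, b, d, e} : Finset V)) :
    f ⊆ {a, b, d, e} := by
  have e1 : ({a, b, d} : Finset V) ∪ {a, b, e} = {a, b, d, e} := by ext t; simp
  have e2 : ({a, b, d} : Finset V) ∪ {a, d, e} = {a, b, d, e} := by ext t; simp
  have e3 : ({a, b, e} : Finset V) ∪ {a, d, e} = {a, b, d, e} := by ext t; simp; tauto
  have h4 : ({a, b, d, e} : Finset V).card = 4 := by
    rw [Finset.card_insert_of_notMem (by simp [hab, had, hae]),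
      Finset.card_eq_three.2 ⟨b, d, e, hbd, hbe, hde, rfl⟩]
  have n1 : ({a, b, d} : Finset V) ≠ {a, b, e} := fun h => by
    have : d ∈ ({a, b, e} : Finset V) := h ▸ by simp
    simp [had.symm, hbd.symm, hde] at this
  have n2 : ({a, b, d} : Finset V) ≠ {a, d, e} := fun h => by
    have : b ∈ ({a, d, e} : Finset V) := h ▸ by simp
    simp [hab.symm, hbd, hbe] at this
  have n3 : ({a, b, e} : Finset V) ≠ {a, d, e} := fun h => by
    have : b ∈ ({a, d, e} : Finset V) := h ▸ by simp
    simp [hab.symm, hbd, hbe] at this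
  by_cases f1 : f = {a, b, d}
  · rw [f1, ← e1]; exact Finset.subset_union_left
  by_cases f2 : f = {a, b, e}
  · rw [f2, ← e1]; exact Finset.subset_union_right
  by_cases f3 : f = {a, d, e}
  · rw [f3, ← e2]; exact Finset.subset_union_right
  have k1 : ∀ p q r, p ∈ f → q ∈ f → _ := fun p q r hp hq hqg hrg hrk hpk => e1 ▸
    h.subset_union hf h1 h2 f1 n1 f2 (by rw [e1, h4]) hp hq (r := r) hqg hrg hrk hpk
  have k2 : ∀ p q r, p ∈ f → q ∈ f → _ := fun p q r hp hq hqg hrg hrk hpk => e2 ▸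
    h.subset_union hf h1 h3 f1 n2 f3 (by rw [e2, h4]) hp hq (r := r) hqg hrg hrk hpk
  have k3 : ∀ p q r, p ∈ f → q ∈ f → _ := fun p q r hp hq hqg hrg hrk hpk => e3 ▸
    h.subset_union hf h2 h3 f2 n3 f3 (by rw [e3, h4]) hp hq (r := r) hqg hrg hrk hpk
  simp only [Finset.mem_insert, Finset.mem_singleton] at hu hv
  rcases hu with rfl | rfl | rfl | rfl <;> rcases hv with rfl | rfl | rfl | rfl
  · exact absurd rfl huv
  · exact k2 _ _ d huf hvf (by simp) (by simp) (by simp) (by simp) hab hbd had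
  · exact k1 _ _ b huf hvf (by simp) (by simp) (by simp) (by simp) had hbd.symm hab
  · exact k1 _ _ b hvf huf (by simp) (by simp) (by simp) (by simp) hae.symm hab hbe.symm
  · exact k2 _ _ d hvf huf (by simp) (by simp) (by simp) (by simp) hab hbd had
  · exact absurd rfl huv
  · exact k3 _ _ e hvf huf (by simp) (by simp) (by simp) (by simp) hbd.symm hbe hde
  · exact k2 _ _ d hvf huf (by simp) (by simp) (by simp) (by simp) hbe.symm hbd hde.symm
  · exact k1 _ _ b hvf huf (by simp) (by simp) (by simp) (by simp) had hbd.symm hab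
  · exact k3 _ _ e huf hvf (by simp) (by simp) (by simp) (by simp) hbd.symm hbe hde
  · exact absurd rfl huv
  · exact k1 _ _ b hvf huf (by simp) (by simp) (by simp) (by simp) hde.symm hbd.symm hbe.symm
  · exact k1 _ _ b huf hvf (by simp) (by simp) (by simp) (by simp) hae.symm hab hbe.symm
  · exact k2 _ _ d huf hvf (by simp) (by simp) (by simp) (by simp) hbe.symm hbd hde.symm
  · exact k1 _ _ b huf hvf (by simp) (by simp) (by simp) (by simp) hde.symm hbd.symm hbe.symm
  · exact absurd rfl huv

/-- The fourth triple of a four-set can be added to the other three: a triangle containing it lies in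
the four-set. -/
theorem Weak.insert_fourth (h : Weak F) {a b d e : V} (hab : a ≠ b) (had : a ≠ d) (hae : a ≠ e)
    (hbd : b ≠ d) (hbe : b ≠ e) (hde : d ≠ e) (h1 : {a, b, d} ∈ F) (h2 : {a, b, e} ∈ F)
    (h3 : {a, d, e} ∈ F) : Weak (insert {b, d, e} F) := by
  have hQ : ∀ f ∈ F, ∀ u ∈ f, ∀ v ∈ f, u ≠ v → u ∈ ({a, b, d, e} : Finset V) →
      v ∈ ({a, b, d, e} : Finset V) → f ⊆ {a, b, d, e} := fun f hf u hu v hv huv huQ hvQ =>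
    h.subset_of_two_mem hab had hae hbd hbe hde h1 h2 h3 hf huv hu hv huQ hvQ
  have hpair : ∀ x ∈ ({b, d, e} : Finset V), ∀ y ∈ ({b, d, e} : Finset V), x ≠ y →
      ∃ k ∈ F, k ⊆ {a, b, d, e} ∧ x ∈ k ∧ y ∈ k := by
    intro x hx y hy hxy
    have s1 : ({a, b, d} : Finset V) ⊆ {a, b, d, e} := by intro t; simp; tauto
    have s2 : ({a, b, e} : Finset V) ⊆ {a, b, d, e} := by intro t; simp; tauto
    have s3 : ({a, d, e} : Finset V) ⊆ {a, b, d, e} := by intro t; simp; tauto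
    rcases mem_triple.1 hx with rfl | rfl | rfl <;> rcases mem_triple.1 hy with rfl | rfl | rfl
    · exact absurd rfl hxy
    · exact ⟨_, h1, s1, by simp, by simp⟩
    · exact ⟨_, h2, s2, by simp, by simp⟩
    · exact ⟨_, h1, s1, by simp, by simp⟩
    · exact absurd rfl hxy
    · exact ⟨_, h3, s3, by simp, by simp⟩
    · exact ⟨_, h2, s2, by simp, by simp⟩
    · exact ⟨_, h3, s3, by simp, by simp⟩
    · exact absurd rfl hxy
  have hT : ({b, d, e} : Finset V) ⊆ {a, b, d, e} := Finset.subset_insert _ _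
  have key : ∀ f ∈ F, ∀ g ∈ F, f ≠ g → ∀ x ∈ ({b, d, e} : Finset V), ∀ y ∈ ({b, d, e} : Finset V),
      ∀ z, x ∈ g → y ∈ f → z ∈ f → z ∈ g → x ≠ y → y ≠ z → x ≠ z →
      f ⊆ {a, b, d, e} ∧ g ⊆ {a, b, d, e} := by
    intro f hf g hg hfg x hx y hy z hxg hyf hzf hzg hxy hyz hxz
    by_cases hz : z ∈ ({a, b, d, e} : Finset V)
    · exact ⟨hQ f hf y hyf z hzf hyz (hT hy) hz, hQ g hg x hxg z hzg hxz (hT hx) hz⟩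
    · exfalso
      obtain ⟨k, hk, hkQ, hxk, hyk⟩ := hpair x hx y hy hxy
      have hzk : z ∉ k := fun h => hz (hkQ h)
      have h5 := h.card_le f hf g hg k hk hfg (fun h => hzk (h ▸ hzg)) (fun h => hzk (h ▸ hzf))
        y (by simp [*]) z (by simp [*]) x (by simp [*]) hyz hxz.symm hxy.symm
      have h6 : insert z k ⊆ f ∪ g ∪ k := Finset.insert_subset (by simp [hzf])
        Finset.subset_union_right
      have h7 := Finset.eq_of_subset_of_card_le h6 (by
        rw [Finset.card_insert_of_notMem hzk, h.card_eq k hk]; omega)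
      have h8 : f.erase z ⊆ k := fun t ht => by
        rw [Finset.mem_erase] at ht
        have : t ∈ insert z k := by rw [h7]; simp [ht.2]
        exact (Finset.mem_insert.1 this).resolve_left ht.1
      obtain ⟨t, ht, hty⟩ := Finset.exists_mem_ne (by
        rw [Finset.card_erase_of_mem hzf, h.card_eq f hf]; norm_num : 1 < (f.erase z).card) y
      exact hz (hQ f hf y hyf t (Finset.mem_erase.1 ht).2 hty.symm (hT hy) (hkQ (h8 ht)) hzf)
  have hfin : ∀ f ∈ F, ∀ g ∈ F, f ≠ g → ∀ x ∈ ({b, d, e} : Finset V),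
      ∀ y ∈ ({b, d, e} : Finset V), ∀ z, x ∈ g → y ∈ f → z ∈ f → z ∈ g → x ≠ y → y ≠ z → x ≠ z →
      ({b, d, e} ∪ f ∪ g).card ≤ 4 := by
    intro f hf g hg hfg x hx y hy z hxg hyf hzf hzg hxy hyz hxz
    obtain ⟨h5, h6⟩ := key f hf g hg hfg x hx y hy z hxg hyf hzf hzg hxy hyz hxz
    exact (Finset.card_le_card (Finset.union_subset (Finset.union_subset hT h5) h6)).trans
      Finset.card_le_four
  refine ⟨fun f hf => ?_, fun f hf g hg k hk hfg hgk hfk x hx y hy z hz hxy hyz hxz => ?_⟩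
  · rcases Finset.mem_insert.1 hf with rfl | hf
    · exact Finset.card_eq_three.2 ⟨b, d, e, hbd, hbe, hde, rfl⟩
    · exact h.card_eq f hf
  · rw [Finset.mem_inter] at hx hy hz
    rcases Finset.mem_insert.1 hf with rfl | hf'
    · exact hfin g (Finset.mem_of_mem_insert_of_ne hg hfg.symm) k
        (Finset.mem_of_mem_insert_of_ne hk hfk.symm) hgk x hx.1 y hy.1 z hx.2 hy.2 hz.1 hz.2 hxy hyz
        hxz
    rcases Finset.mem_insert.1 hg with rfl | hg'
    · rw [Finset.union_comm f]
      exact hfin f hf' k (Finset.mem_of_mem_insert_of_ne hk hgk.symm) hfk z hz.1 y hy.2 x hz.2 hy.1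
        hx.1 hx.2 hyz.symm hxy.symm hxz.symm
    rcases Finset.mem_insert.1 hk with rfl | hk'
    · rw [Finset.union_comm, ← Finset.union_assoc]
      exact hfin f hf' g hg' hfg z hz.2 x hx.2 y hz.1 hx.1 hy.1 hy.2 hxz.symm hxy hyz.symm
    · exact h.card_le f hf' g hg' k hk' hfg hgk hfk x (by simp [hx]) y (by simp [hy]) z
        (by simp [hz]) hxy hyz hxz

end

section

variable {V : Type*} [DecidableEq V] {F : Finset (Finset V)}

/-! ### Systems of maximum size -/

theorem exists_eq_erase {Q e : Finset V} (hQ : Q.card = 4) (he : e.card = 3) (heQ : e ⊆ Q) :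
    ∃ p ∈ Q, e = Q.erase p := by
  obtain ⟨p, hp, hpe⟩ := Finset.exists_mem_notMem_of_card_lt_card (by omega : e.card < Q.card)
  refine ⟨p, hp, eq_of_subset_card he (by rw [Finset.card_erase_of_mem hp, hQ]) fun t ht => ?_⟩
  exact Finset.mem_erase.2 ⟨by rintro rfl; exact hpe ht, heQ ht⟩

/-- Systems of maximum size are closed, since the fourth triple can be added to three triples of a
four-set. -/
theorem Weak.closed (h : Weak F) (hmax : ∀ G : Finset (Finset V), Weak G → G.card ≤ F.card) :
    Closed F := by
  refine ⟨h.card_eq, fun x y z e f g hxy hyz hxz he hf hg hef hfg heg hxe hye hyf hzf hxg hzg => ?_⟩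
  have h4 := h.card_le e he f hf g hg hef hfg heg x (by simp [*]) y (by simp [*]) z (by simp [*])
    hxy hyz hxz
  have he3 := h.card_eq e he
  have hf3 := h.card_eq f hf
  have hg3 := h.card_eq g hg
  have heQ : e ⊆ e ∪ f ∪ g := fun t ht => by simp [ht]
  have hfQ : f ⊆ e ∪ f ∪ g := fun t ht => by simp [ht]
  have hgQ : g ⊆ e ∪ f ∪ g := fun t ht => by simp [ht]
  have hQ4 : (e ∪ f ∪ g).card = 4 := by
    by_contra hne
    have h3 := Finset.card_le_card heQ
    have h5 := Finset.eq_of_subset_of_card_le heQ (by omega)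
    exact hef (eq_of_subset_card hf3 he3 (h5 ▸ hfQ)).symm
  generalize e ∪ f ∪ g = Q at *
  refine ⟨Q, ⟨hQ4, fun t ht => ?_⟩, heQ, hfQ, hgQ⟩
  rw [Finset.mem_powersetCard] at ht
  by_contra htF
  obtain ⟨p, hp, rfl⟩ := exists_eq_erase hQ4 he3 heQ
  obtain ⟨q, hq, rfl⟩ := exists_eq_erase hQ4 hf3 hfQ
  obtain ⟨r, hr, rfl⟩ := exists_eq_erase hQ4 hg3 hgQ
  obtain ⟨s, hs, rfl⟩ := exists_eq_erase hQ4 ht.2 ht.1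
  have hpq : p ≠ q := by rintro rfl; exact hef rfl
  have hqr : q ≠ r := by rintro rfl; exact hfg rfl
  have hpr : p ≠ r := by rintro rfl; exact heg rfl
  have hsp : s ≠ p := by rintro rfl; exact htF he
  have hsq : s ≠ q := by rintro rfl; exact htF hf
  have hsr : s ≠ r := by rintro rfl; exact htF hg
  have hQ : Q = {s, p, q, r} := by
    refine (Finset.eq_of_subset_of_card_le (by simp [Finset.insert_subset_iff, *]) ?_).symm
    rw [hQ4, Finset.card_insert_of_notMem (by simp [*]),
      Finset.card_eq_three.2 ⟨p, q, r, hpq, hpr, hqr, rfl⟩]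
  have e1 : Q.erase p = {s, q, r} := by rw [hQ]; ext t; simp; grind
  have e2 : Q.erase q = {s, p, r} := by rw [hQ]; ext t; simp; grind
  have e3 : Q.erase r = {s, p, q} := by rw [hQ]; ext t; simp; grind
  have e4 : Q.erase s = {p, q, r} := by rw [hQ]; ext t; simp; grind
  rw [e1] at he
  rw [e2] at hf
  rw [e3] at hg
  rw [e4] at htF
  have := hmax _ (h.insert_fourth hsp hsq hsr hpq hpr hqr hg hf he)
  rw [Finset.card_insert_of_notMem htF] at this
  omega

theorem isExtremal_iff {n : ℕ} {F : Finset (Finset (Fin n))} :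
    IsExtremal {Config.A, Config.B, Config.D} F ↔
      Weak F ∧ F.card = ex n {Config.A, Config.B, Config.D} := by
  rw [IsExtremal, weak_iff, and_assoc]

theorem Weak.card_le_ex {n : ℕ} {F : Finset (Finset (Fin n))} (h : Weak F) :
    F.card ≤ ex n {Config.A, Config.B, Config.D} := by
  obtain ⟨h1, h2⟩ := weak_iff.1 h
  exact (isGreatest_ex n _).2 ⟨F, h1, h2, rfl⟩

theorem exists_isExtremal (n : ℕ) : ∃ F : Finset (Finset (Fin n)),
    IsExtremal {Config.A, Config.B, Config.D} F :=
  (isGreatest_ex n _).1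

theorem IsExtremal.closed {n : ℕ} {F : Finset (Finset (Fin n))}
    (h : IsExtremal {Config.A, Config.B, Config.D} F) : Closed F := by
  rw [isExtremal_iff] at h
  exact h.1.closed fun G hG => h.2 ▸ hG.card_le_ex

theorem Closed.card_le_sq_div (hF : Closed F) {S : Finset V} (hS : ∀ e ∈ F, e ⊆ S)
    (hn : 8 ≤ S.card) : F.card ≤ S.card ^ 2 / 8 := by
  by_cases h17 : 17 ≤ S.card
  · exact (extremalBlockFree_of_le h17).card_le hF hS rfl
  · obtain ⟨n, hSn⟩ : ∃ n, S.card = n := ⟨_, rfl⟩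
    rw [hSn] at hn h17 ⊢
    interval_cases n
    · exact hF.card_le_eight hS hSn
    · exact hF.card_le_nine hS hSn
    · exact hF.card_le_ten hS hSn
    · exact extremalBlockFree_eleven.card_le hF hS hSn
    · exact extremalBlockFree_twelve.card_le hF hS hSn
    · exact extremalBlockFree_thirteen.card_le hF hS hSn
    · exact extremalBlockFree_fourteen.card_le hF hS hSn
    · exact extremalBlockFree_fifteen.card_le hF hS hSn
    · exact (hF.sixteen_card_le hS hSn).1

/-! ### The systems `F_{n,k}` -/

/-- There is no triangle at all: a triple contains only one vertex outside the pairs, and two vertices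
in pairs are in a common triple only if they form a pair. -/
theorem IsPairSystem.weak {S : Finset V} {P : Finset (Finset V)} (h : IsPairSystem S P F) :
    Weak F := by
  have h3 : ∀ e ∈ F, e.card = 3 := by
    intro e he
    obtain ⟨A, hA, b, -, hb, rfl⟩ := (h.mem_iff e).1 he
    rw [Finset.card_insert_of_notMem (hb A hA), h.card_eq A hA]
  have h2 : ∀ e ∈ F, ∃ A ∈ P, ∃ b, (∀ A' ∈ P, b ∉ A') ∧ e = insert b A := fun e he => by
    obtain ⟨A, hA, b, -, hb, rfl⟩ := (h.mem_iff e).1 he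
    exact ⟨A, hA, b, hb, rfl⟩
  have hA : ∀ A ∈ P, ∀ A' ∈ P, ∀ u, u ∈ A → u ∈ A' → A = A' := fun A hA A' hA' u hu hu' => by
    by_contra hne
    exact Finset.disjoint_left.1 (h.disjoint A hA A' hA' hne) hu hu'
  have h2' : ∀ A ∈ P, ∀ u ∈ A, ∀ v ∈ A, ∀ w ∈ A, u ≠ v → v ≠ w → u ≠ w → False := by
    intro A hA u hu v hv w hw huv hvw huw
    have h1 : ({u, v, w} : Finset V) ⊆ A := by simp [Finset.insert_subset_iff, *]
    have := Finset.card_le_card h1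
    rw [Finset.card_eq_three.2 ⟨u, v, w, huv, huw, hvw, rfl⟩, h.card_eq A hA] at this
    omega
  refine ⟨h3, fun e he f hf g hg hef hfg heg x hx y hy z hz hxy hyz hxz => ?_⟩
  exfalso
  rw [Finset.mem_inter] at hx hy hz
  obtain ⟨A, hAP, a, ha, rfl⟩ := h2 e he
  obtain ⟨B, hBP, b, hb, rfl⟩ := h2 f hf
  obtain ⟨C, hCP, c, hc, rfl⟩ := h2 g hg
  simp only [Finset.mem_insert] at hx hy hz
  obtain ⟨hx1, hx2⟩ := hx
  obtain ⟨hy1, hy2⟩ := hy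
  obtain ⟨hz1, hz2⟩ := hz
  rcases hx1 with rfl | hx1
  · have hx2' := hx2.resolve_right (ha C hCP)
    subst hx2'
    have hy1' := hy1.resolve_left hxy.symm
    have hz2' := hz2.resolve_left hxz.symm
    rcases hy2 with rfl | hy2
    · exact hb A hAP hy1'
    rcases hz1 with rfl | hz1
    · exact hb C hCP hz2'
    have e1 := hA A hAP B hBP y hy1' hy2
    have e2 := hA C hCP B hBP z hz2' hz1
    exact heg (by rw [e1, e2])
  · have hx2' : x ∈ C := hx2.resolve_left (by rintro rfl; exact hc A hAP hx1)
    rcases hy1 with rfl | hy1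
    · have hy2' := hy2.resolve_right (ha B hBP)
      subst hy2'
      have hz1' := hz1.resolve_left hyz.symm
      have hz2' : z ∈ C := hz2.resolve_left (by rintro rfl; exact hc B hBP hz1')
      have e1 := hA A hAP C hCP x hx1 hx2'
      have e2 := hA B hBP C hCP z hz1' hz2'
      exact hef (by rw [e1, e2])
    · have hy2' : y ∈ B := hy2.resolve_left (by rintro rfl; exact hb A hAP hy1)
      have e1 := hA A hAP C hCP x hx1 hx2'
      have e2 := hA A hAP B hBP y hy1 hy2'
      subst e1 e2
      have hzA : z ∉ A := fun hzA => h2' A hAP x hx1 y hy1 z hzA hxy hyz hxz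
      have e3 := hz1.resolve_right hzA
      have e4 := hz2.resolve_right hzA
      exact hfg (by rw [← e3, ← e4])

theorem IsPairSystem.isF {n : ℕ} {F P : Finset (Finset (Fin n))}
    (h : IsPairSystem Finset.univ P F) (h1 : 1 ≤ P.card) (h2 : 2 * P.card < n) :
    IsF P.card F := by
  let φ := P.equivFin
  refine ⟨h1, h2, fun i => (φ.symm i : Finset (Fin n)), fun i => h.card_eq _ (φ.symm i).2,
    fun i j hij => h.disjoint _ (φ.symm i).2 _ (φ.symm j).2 fun he =>
      hij (φ.symm.injective (Subtype.ext he)), fun e => ?_⟩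
  rw [h.mem_iff]
  constructor
  · rintro ⟨A, hA, b, -, hb, rfl⟩
    exact ⟨φ ⟨A, hA⟩, b, fun j => hb _ (φ.symm j).2, by simp⟩
  · rintro ⟨i, b, hb, rfl⟩
    exact ⟨_, (φ.symm i).2, b, Finset.mem_univ b, fun A hA => by simpa using hb (φ ⟨A, hA⟩), rfl⟩

theorem IsF.exists_isPairSystem {n k : ℕ} {F : Finset (Finset (Fin n))} (h : IsF k F) :
    ∃ P, IsPairSystem Finset.univ P F ∧ P.card = k := by
  obtain ⟨-, -, A, h2, hdisj, hF⟩ := h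
  have hinj : Function.Injective A := fun i j hij => by
    by_contra hne
    have := hdisj i j hne
    rw [hij, disjoint_self, Finset.bot_eq_empty] at this
    have h0 := h2 j
    rw [this] at h0
    simp at h0
  refine ⟨Finset.univ.image A, ⟨?_, fun _ _ => Finset.subset_univ _, ?_, fun e => ?_⟩, ?_⟩
  · simpa using h2
  · simp only [Finset.mem_image, Finset.mem_univ, true_and]
    rintro _ ⟨i, rfl⟩ _ ⟨j, rfl⟩ hne
    exact hdisj i j fun hij => hne (by rw [hij])
  · rw [hF]
    simp
  · rw [Finset.card_image_of_injective _ hinj, Finset.card_fin]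

theorem IsF.weak {n k : ℕ} {F : Finset (Finset (Fin n))} (h : IsF k F) : Weak F := by
  obtain ⟨P, hP, -⟩ := h.exists_isPairSystem
  exact hP.weak

theorem IsF.card_eq {n k : ℕ} {F : Finset (Finset (Fin n))} (h : IsF k F) :
    F.card = k * (n - 2 * k) := by
  obtain ⟨P, hP, rfl⟩ := h.exists_isPairSystem
  rw [hP.card_triples, Finset.card_fin]

theorem exists_isF {n k : ℕ} (h1 : 1 ≤ k) (h2 : 2 * k < n) :
    ∃ F : Finset (Finset (Fin n)), IsF k F := by
  classical
  let A : Fin k → Finset (Fin n) := fun i =>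
    {⟨2 * i, by have := i.2; omega⟩, ⟨2 * i + 1, by have := i.2; omega⟩}
  refine ⟨Finset.univ.filter fun e => ∃ i, ∃ b, (∀ j, b ∉ A j) ∧ e = insert b (A i), h1, h2, A,
    fun i => Finset.card_pair (by simp), fun i j hij => ?_, fun e => by simp⟩
  rw [Finset.disjoint_left]
  intro x hx hx'
  simp only [A, Finset.mem_insert, Finset.mem_singleton, Fin.ext_iff] at hx hx'
  exact hij (Fin.ext (by omega))

/-! ### The optimal number of pairs -/

theorem sq_mod_eight (n : ℕ) : n % 4 = 0 ∧ n ^ 2 % 8 = 0 ∨ n % 2 = 1 ∧ n ^ 2 % 8 = 1 ∨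
    n % 4 = 2 ∧ n ^ 2 % 8 = 4 := by
  rw [Nat.pow_mod]
  have : n % 8 < 8 := Nat.mod_lt _ (by norm_num)
  obtain ⟨r, hr⟩ : ∃ r, n % 8 = r := ⟨_, rfl⟩
  rw [hr] at this ⊢
  interval_cases r <;> norm_num <;> omega

/-- The residue `n ^ 2 % 8` is the square of the distance of `n` to the multiples of `4`. -/
theorem sq_mod_eight_le (n j : ℕ) : ((n ^ 2 % 8 : ℕ) : ℤ) ≤ (4 * j - n) ^ 2 := by
  rcases sq_mod_eight n with ⟨h, h'⟩ | ⟨h, h'⟩ | ⟨h, h'⟩ <;> rw [h']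
  · push_cast; positivity
  · have : 1 ≤ (4 * (j : ℤ) - n) ∨ (4 * (j : ℤ) - n) ≤ -1 := by omega
    rcases this with h | h <;> push_cast <;> nlinarith
  · have : 2 ≤ (4 * (j : ℤ) - n) ∨ (4 * (j : ℤ) - n) ≤ -2 := by omega
    rcases this with h | h <;> push_cast <;> nlinarith

theorem exists_sq_eq_mod_eight {n : ℕ} (hn : 8 ≤ n) : ∃ j : ℕ, 1 ≤ j ∧ 2 * j < n ∧
    (4 * (j : ℤ) - n) ^ 2 = ((n ^ 2 % 8 : ℕ) : ℤ) := by
  refine ⟨(n + 2) / 4, by omega, by omega, ?_⟩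
  rcases sq_mod_eight n with ⟨h, h'⟩ | ⟨h, h'⟩ | ⟨h, h'⟩ <;> rw [h']
  · have : (4 * (((n + 2) / 4 : ℕ) : ℤ) - n) = 0 := by omega
    rw [this]; rfl
  · have : (4 * (((n + 2) / 4 : ℕ) : ℤ) - n) = 1 ∨ (4 * (((n + 2) / 4 : ℕ) : ℤ) - n) = -1 := by
      omega
    rcases this with h | h <;> rw [h] <;> rfl
  · have : (4 * (((n + 2) / 4 : ℕ) : ℤ) - n) = 2 := by omega
    rw [this]; rfl

/-- The number of triples of `F_{n,k}` is `(n ^ 2 - (4 * k - n) ^ 2) / 8`. -/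
theorem mul_eq_iff {n k : ℕ} (h2 : 2 * k < n) :
    k * (n - 2 * k) = n ^ 2 / 8 ↔ (4 * (k : ℤ) - n) ^ 2 = ((n ^ 2 % 8 : ℕ) : ℤ) := by
  obtain ⟨m, rfl⟩ : ∃ m, n = 2 * k + m := ⟨n - 2 * k, by omega⟩
  rw [Nat.add_sub_cancel_left]
  have h1 : (8 : ℤ) * (((2 * k + m) ^ 2 / 8 : ℕ) : ℤ) + (((2 * k + m) ^ 2 % 8 : ℕ) : ℤ) =
      (2 * k + m) ^ 2 := by
    exact_mod_cast Nat.div_add_mod ((2 * k + m) ^ 2) 8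
  rw [← Nat.cast_inj (R := ℤ)]
  push_cast at h1 ⊢
  constructor <;> intro h <;> nlinarith

/-- The numbers of pairs closest to `n / 4` are those for which `F_{n,k}` has `n ^ 2 / 8` triples. -/
theorem isOptimal_iff {n k : ℕ} (hn : 8 ≤ n) (h2 : 2 * k < n) :
    IsOptimal n k ↔ k * (n - 2 * k) = n ^ 2 / 8 := by
  have key : ∀ j : ℕ, |(k : ℚ) - n / 4| ≤ |(j : ℚ) - n / 4| ↔
      (4 * (k : ℤ) - n) ^ 2 ≤ (4 * (j : ℤ) - n) ^ 2 := by
    intro j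
    rw [← sq_le_sq, ← Int.cast_le (R := ℚ)]
    push_cast
    constructor <;> intro h <;> linarith
  rw [mul_eq_iff h2]
  constructor
  · intro h
    obtain ⟨j, hj1, hj2, hj⟩ := exists_sq_eq_mod_eight hn
    exact le_antisymm (hj ▸ (key j).1 (h j hj1 hj2)) (sq_mod_eight_le n k)
  · intro h j _ _
    rw [key, h]
    exact sq_mod_eight_le n j

theorem ex_eq {n : ℕ} (hn : 8 ≤ n) : ex n {Config.A, Config.B, Config.D} = n ^ 2 / 8 := by
  apply le_antisymm
  · obtain ⟨F, hF⟩ := exists_isExtremal n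
    rw [← (isExtremal_iff.1 hF).2]
    simpa using hF.closed.card_le_sq_div (S := Finset.univ) (fun e _ => Finset.subset_univ e)
      (by simpa using hn)
  · obtain ⟨k, hk1, hk2, hk⟩ := exists_sq_eq_mod_eight hn
    obtain ⟨F, hF⟩ := exists_isF hk1 hk2
    rw [← (mul_eq_iff hk2).2 hk, ← hF.card_eq]
    exact hF.weak.card_le_ex

theorem IsExtremal.exists_isF {n : ℕ} (hn : 8 ≤ n) {F : Finset (Finset (Fin n))}
    (h : IsExtremal {Config.A, Config.B, Config.D} F) (hb : ∀ Q, ¬ IsBlock F Q) :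
    ∃ k, 1 ≤ k ∧ 2 * k < n ∧ k * (n - 2 * k) = n ^ 2 / 8 ∧ IsF k F := by
  have hcard := (isExtremal_iff.1 h).2
  rw [ex_eq hn] at hcard
  obtain ⟨P, hP, h1, h2⟩ := h.closed.exists_isPairSystem hb (S := Finset.univ)
    (fun e _ => Finset.subset_univ e) (by simpa using hn) (by simp [hcard])
  rw [Finset.card_fin] at h2
  refine ⟨P.card, h1, by omega, ?_, hP.isF h1 (by omega)⟩
  rw [← hcard, hP.card_triples, Finset.card_fin]

theorem IsF.isExtremal {n k : ℕ} (hn : 8 ≤ n) {F : Finset (Finset (Fin n))} (h : IsF k F)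
    (hk : k * (n - 2 * k) = n ^ 2 / 8) : IsExtremal {Config.A, Config.B, Config.D} F :=
  isExtremal_iff.2 ⟨h.weak, by rw [h.card_eq, hk, ex_eq hn]⟩

end

section

variable {V : Type*} [DecidableEq V] {F : Finset (Finset V)}

/-! ### Isomorphisms and the sporadic systems -/

theorem Iso.card_eq {V W : Type*} {F : Finset (Finset V)} {G : Finset (Finset W)} (h : Iso F G) :
    F.card = G.card := by
  obtain ⟨σ, hσ⟩ := h
  refine Finset.card_nbij' (fun e => e.map σ.toEmbedding) (fun e => e.map σ.symm.toEmbedding)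
    (fun e he => (hσ e).1 he) (fun e he => (hσ _).2 ?_) (fun e _ => ?_) fun e _ => ?_
  · simpa [Finset.map_map] using he
  · simp [Finset.map_map]
  · simp [Finset.map_map]

theorem Iso.weak {W : Type*} [DecidableEq W] {G : Finset (Finset W)} (h : Iso F G) (hG : Weak G) :
    Weak F := by
  obtain ⟨σ, hσ⟩ := h
  refine ⟨fun e he => ?_, fun e he f hf g hg hef hfg heg x hx y hy z hz hxy hyz hxz => ?_⟩
  · rw [← hG.card_eq _ ((hσ e).1 he), Finset.card_map]
  · have hi : ∀ s t : Finset V, s ≠ t → s.map σ.toEmbedding ≠ t.map σ.toEmbedding :=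
      fun s t hst h => hst (Finset.map_injective _ h)
    have := hG.card_le _ ((hσ e).1 he) _ ((hσ f).1 hf) _ ((hσ g).1 hg) (hi _ _ hef) (hi _ _ hfg)
      (hi _ _ heg) (σ x) (by rw [← Finset.map_inter]; exact Finset.mem_map_of_mem _ hx)
      (σ y) (by rw [← Finset.map_inter]; exact Finset.mem_map_of_mem _ hy)
      (σ z) (by rw [← Finset.map_inter]; exact Finset.mem_map_of_mem _ hz)
      (σ.injective.ne hxy) (σ.injective.ne hyz) (σ.injective.ne hxz)
    rwa [← Finset.map_union, ← Finset.map_union, Finset.card_map] at this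

/-- An isomorphism from a labelling `v` of the vertices of `F` by those of `G`. -/
theorem iso_of_surjective {n : ℕ} {F G : Finset (Finset (Fin n))} {v : Fin n → Fin n}
    (hv : Function.Surjective v) (h : F = G.image (Finset.image v)) : Iso F G := by
  have hb : Function.Bijective v := ⟨Finite.injective_iff_surjective.2 hv, hv⟩
  refine ⟨(Equiv.ofBijective v hb).symm, fun e => ?_⟩
  rw [h, Finset.mem_image]
  constructor
  · rintro ⟨a, ha, rfl⟩
    convert ha
    ext t
    simp only [Finset.mem_map_equiv, Equiv.symm_symm, Equiv.ofBijective_apply, Finset.mem_image]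
    exact ⟨fun ⟨s, hs, hst⟩ => hb.1 hst ▸ hs, fun ht => ⟨t, ht, rfl⟩⟩
  · intro he
    refine ⟨_, he, ?_⟩
    ext t
    simp only [Finset.mem_image, Finset.mem_map_equiv, Equiv.symm_symm, Equiv.ofBijective_apply]
    constructor
    · rintro ⟨s, hs, rfl⟩
      exact hs
    · intro ht
      obtain ⟨s, rfl⟩ := hv t
      exact ⟨s, ht, rfl⟩

theorem completeOn_image {n : ℕ} {v : Fin n → V} (hv : Function.Injective v)
    (K : Finset (Finset (Fin n))) :
    completeOn (K.image (Finset.image v)) = (completeOn K).image (Finset.image v) := by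
  ext e
  simp only [completeOn, Finset.mem_biUnion, Finset.mem_image, Finset.mem_powersetCard]
  constructor
  · rintro ⟨_, ⟨q, hq, rfl⟩, he, h3⟩
    obtain ⟨a, ha, rfl⟩ := Finset.subset_image_iff.1 he
    refine ⟨a, ⟨q, hq, ?_, ?_⟩, rfl⟩
    · exact_mod_cast ha
    · rwa [Finset.card_image_of_injective _ hv] at h3
  · rintro ⟨a, ⟨q, hq, ha, h3⟩, rfl⟩
    exact ⟨_, ⟨q, hq, rfl⟩, Finset.image_subset_image ha, by
      rwa [Finset.card_image_of_injective _ hv]⟩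

/-- If four-sets share at most one vertex pairwise, and three of them that meet pairwise have a common
vertex, then a triangle in the union of the complete systems on them lies in one of the four-sets. -/
theorem weak_completeOn {K : Finset (Finset V)} (h4 : ∀ Q ∈ K, Q.card = 4)
    (h1 : ∀ Q ∈ K, ∀ B ∈ K, Q ≠ B → (Q ∩ B).card ≤ 1)
    (h3 : ∀ Q ∈ K, ∀ B ∈ K, ∀ C ∈ K, Q ≠ B → B ≠ C → Q ≠ C → (Q ∩ B).Nonempty → (B ∩ C).Nonempty →
      (Q ∩ C).Nonempty → (Q ∩ B ∩ C).Nonempty) : Weak (completeOn K) := by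
  refine ⟨fun e he => ?_, fun e he f hf g hg hef hfg heg x hx y hy z hz hxy hyz hxz => ?_⟩
  · obtain ⟨Q, -, heQ⟩ := Finset.mem_biUnion.1 he
    exact (Finset.mem_powersetCard.1 heQ).2
  · obtain ⟨Q, hQ, heQ⟩ := Finset.mem_biUnion.1 he
    obtain ⟨B, hB, hfB⟩ := Finset.mem_biUnion.1 hf
    obtain ⟨C, hC, hgC⟩ := Finset.mem_biUnion.1 hg
    have heQ := (Finset.mem_powersetCard.1 heQ).1
    have hfB := (Finset.mem_powersetCard.1 hfB).1
    have hgC := (Finset.mem_powersetCard.1 hgC).1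
    rw [Finset.mem_inter] at hx hy hz
    have hu : ∀ Q ∈ K, ∀ B ∈ K, ∀ u v, u ∈ Q → u ∈ B → v ∈ Q → v ∈ B → u ≠ v → Q = B := by
      intro Q hQ B hB u v h5 h6 h7 h8 huv
      by_contra hne
      exact huv (Finset.card_le_one.1 (h1 Q hQ B hB hne) u (Finset.mem_inter.2 ⟨h5, h6⟩) v
        (Finset.mem_inter.2 ⟨h7, h8⟩))
    have hQB : Q = B := by
      by_contra hne
      by_cases hBC : B = C
      · subst hBC
        exact hne (hu Q hQ B hB x y (heQ hx.1) (hgC hx.2) (heQ hy.1) (hfB hy.2) hxy)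
      by_cases hQC : Q = C
      · subst hQC
        exact hne (hu Q hQ B hB y z (heQ hy.1) (hfB hy.2) (hgC hz.2) (hfB hz.1) hyz)
      obtain ⟨w, hw⟩ := h3 Q hQ B hB C hC hne hBC hQC
        ⟨y, Finset.mem_inter.2 ⟨heQ hy.1, hfB hy.2⟩⟩ ⟨z, Finset.mem_inter.2 ⟨hfB hz.1, hgC hz.2⟩⟩
        ⟨x, Finset.mem_inter.2 ⟨heQ hx.1, hgC hx.2⟩⟩
      rw [Finset.mem_inter, Finset.mem_inter] at hw
      have hwy : w = y := by
        by_contra h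
        exact hne (hu Q hQ B hB w y hw.1.1 hw.1.2 (heQ hy.1) (hfB hy.2) h)
      have hwx : w = x := by
        by_contra h
        exact hQC (hu Q hQ C hC w x hw.1.1 hw.2 (heQ hx.1) (hgC hx.2) h)
      exact hxy (hwx.symm.trans hwy)
    subst hQB
    have hQC : Q = C := hu Q hQ C hC x z (heQ hx.1) (hgC hx.2) (hfB hz.1) (hgC hz.2) hxz
    subst hQC
    rw [← h4 Q hQ]
    exact Finset.card_le_card (Finset.union_subset (Finset.union_subset heQ hfB) hgC)

theorem card_completeOn {K : Finset (Finset V)} (h4 : ∀ Q ∈ K, Q.card = 4)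
    (h1 : ∀ Q ∈ K, ∀ B ∈ K, Q ≠ B → (Q ∩ B).card ≤ 1) : (completeOn K).card = 4 * K.card := by
  rw [completeOn, Finset.card_biUnion]
  · rw [Finset.sum_congr rfl fun Q hQ => show (Q.powersetCard 3).card = 4 by
      rw [Finset.card_powersetCard, h4 Q hQ]; rfl]
    simp [mul_comm]
  · intro Q hQ B hB hne
    refine Finset.disjoint_left.2 fun e he he' => ?_
    rw [Finset.mem_powersetCard] at he he'
    have := Finset.card_le_card (Finset.subset_inter he.1 he'.1)
    have := h1 Q hQ B hB hne
    omega

theorem weak_pair {Q B : Finset V} (hQ : Q.card = 4) (hB : B.card = 4) (h : (Q ∩ B).card ≤ 1) :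
    Weak (completeOn {Q, B}) ∧ (completeOn {Q, B}).card = 8 := by
  have h4 : ∀ Q' ∈ ({Q, B} : Finset (Finset V)), Q'.card = 4 := by simp [hQ, hB]
  have h1 : ∀ Q' ∈ ({Q, B} : Finset (Finset V)), ∀ B' ∈ ({Q, B} : Finset (Finset V)), Q' ≠ B' →
      (Q' ∩ B').card ≤ 1 := by
    simp only [Finset.forall_mem_insert, Finset.mem_singleton, forall_eq]
    exact ⟨⟨fun h => absurd rfl h, fun _ => h⟩, fun _ => Finset.inter_comm Q B ▸ h,
      fun h => absurd rfl h⟩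
  have hQB : Q ≠ B := by
    rintro rfl
    rw [Finset.inter_self] at h
    omega
  refine ⟨weak_completeOn h4 h1 ?_, by rw [card_completeOn h4 h1, Finset.card_pair hQB]⟩
  simp only [Finset.mem_insert, Finset.mem_singleton]
  rintro Q' (rfl | rfl) B' (rfl | rfl) C' (rfl | rfl) h1 h2 h3 <;>
    first | exact absurd rfl h1 | exact absurd rfl h2 | exact absurd rfl h3

theorem weak_triple {Q B C : Finset V} (hQ : Q.card = 4) (hB : B.card = 4) (hC : C.card = 4)
    (hQB : (Q ∩ B).card ≤ 1) (hBC : (B ∩ C).card ≤ 1) (hQC : (Q ∩ C).card ≤ 1)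
    (h : (Q ∩ C).Nonempty → (Q ∩ B ∩ C).Nonempty) :
    Weak (completeOn {Q, B, C}) ∧ (completeOn {Q, B, C}).card = 12 := by
  have h4 : ∀ Q' ∈ ({Q, B, C} : Finset (Finset V)), Q'.card = 4 := by simp [hQ, hB, hC]
  have h1 : ∀ Q' ∈ ({Q, B, C} : Finset (Finset V)), ∀ B' ∈ ({Q, B, C} : Finset (Finset V)),
      Q' ≠ B' → (Q' ∩ B').card ≤ 1 := by
    simp only [Finset.mem_insert, Finset.mem_singleton]
    rintro Q' (rfl | rfl | rfl) B' (rfl | rfl | rfl) h1 <;>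
      first | exact absurd rfl h1 | assumption | (rw [Finset.inter_comm]; assumption)
  have hne : ∀ {X Y : Finset V}, X.card = 4 → (X ∩ Y).card ≤ 1 → X ≠ Y := by
    rintro X _ hX h rfl
    rw [Finset.inter_self] at h
    omega
  refine ⟨weak_completeOn h4 h1 ?_, by
    rw [card_completeOn h4 h1, Finset.card_eq_three.2 ⟨Q, B, C, hne hQ hQB, hne hQ hQC, hne hB hBC,
      rfl⟩]⟩
  have key : ∀ X Y Z : Finset V, X ∩ Y ∩ Z = Q ∩ B ∩ C → (Q ∩ C).Nonempty →
      (X ∩ Y ∩ Z).Nonempty := fun X Y Z he hn => he ▸ h hn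
  simp only [Finset.mem_insert, Finset.mem_singleton]
  rintro Q' (rfl | rfl | rfl) B' (rfl | rfl | rfl) C' (rfl | rfl | rfl) h1 h2 h3 h5 h6 h7 <;>
    first
    | exact absurd rfl h1
    | exact absurd rfl h2
    | exact absurd rfl h3
    | (refine key _ _ _ (by ext t; simp only [Finset.mem_inter] <;> tauto) ?_
       first | assumption | (rw [Finset.inter_comm]; assumption))

/-- Two triples sharing a new pair of vertices can be added when their other vertices are not
joined. -/
theorem Weak.insert_pair {p q w w' : V} (h : Weak F) (hp : p ≠ w) (hp' : p ≠ w') (hq : q ≠ w)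
    (hq' : q ≠ w') (hww : w ≠ w') (hpq : p ≠ q) (hw : ∀ e ∈ F, w ∉ e ∧ w' ∉ e)
    (hF : ∀ e ∈ F, p ∈ e → q ∉ e) : Weak (F ∪ {{p, w, w'}, {q, w, w'}}) ∧
      (F ∪ {{p, w, w'}, {q, w, w'}}).card = F.card + 2 := by
  have hne : ({p, w, w'} : Finset V) ≠ {q, w, w'} := fun he => by
    have : p ∈ ({q, w, w'} : Finset V) := he ▸ by simp
    simp [hp, hp', hpq] at this
  have h1 : ∀ e ∈ F, ∀ x ∈ e, x ∈ ({p, w, w'} : Finset V) → x = p := by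
    intro e he x hx hx'
    rcases mem_triple.1 hx' with rfl | rfl | rfl
    · rfl
    · exact absurd hx (hw e he).1
    · exact absurd hx (hw e he).2
  have h2 : ∀ e ∈ F, ∀ x ∈ e, x ∈ ({q, w, w'} : Finset V) → x = q := by
    intro e he x hx hx'
    rcases mem_triple.1 hx' with rfl | rfl | rfl
    · rfl
    · exact absurd hx (hw e he).1
    · exact absurd hx (hw e he).2
  constructor
  · refine ⟨fun e he => ?_, fun e he f hf g hg hef hfg heg x hx y hy z hz hxy hyz hxz => ?_⟩
    · simp only [Finset.mem_union, Finset.mem_insert, Finset.mem_singleton] at he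
      rcases he with he | rfl | rfl
      · exact h.card_eq e he
      · exact Finset.card_eq_three.2 ⟨p, w, w', hp, hp', hww, rfl⟩
      · exact Finset.card_eq_three.2 ⟨q, w, w', hq, hq', hww, rfl⟩
    · simp only [Finset.mem_union, Finset.mem_insert, Finset.mem_singleton] at he hf hg
      by_cases hall : e ∈ F ∧ f ∈ F ∧ g ∈ F
      · exact h.card_le e hall.1 f hall.2.1 g hall.2.2 hef hfg heg x hx y hy z hz hxy hyz hxz
      exfalso
      rw [Finset.mem_inter] at hx hy hz
      generalize ({p, w, w'} : Finset V) = s at *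
      generalize ({q, w, w'} : Finset V) = t at *
      clear hw h
      rcases he with he | rfl | rfl <;> rcases hf with hf | rfl | rfl <;>
        rcases hg with hg | rfl | rfl <;> grind
  · rw [Finset.card_union_of_disjoint, Finset.card_pair hne]
    rw [Finset.disjoint_insert_right, Finset.disjoint_singleton_right]
    exact ⟨fun h => (hw _ h).1 (by simp), fun h => (hw _ h).1 (by simp)⟩

theorem weak_Q8two : Weak Q8two ∧ Q8two.card = 8 :=
  weak_pair (by decide) (by decide) (by decide)

theorem weak_Q8three : Weak Q8three ∧ Q8three.card = 8 :=
  weak_pair (by decide) (by decide) (by decide)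

theorem weak_Q10three : Weak Q10three ∧ Q10three.card = 12 :=
  weak_triple (by decide) (by decide) (by decide) (by decide) (by decide) (by decide) (by decide)

theorem weak_Q10four : Weak Q10four ∧ Q10four.card = 12 :=
  weak_triple (by decide) (by decide) (by decide) (by decide) (by decide) (by decide) (by decide)

theorem weak_Q9two : Weak Q9two ∧ Q9two.card = 10 := by
  have hpair : Weak (completeOn ({{0, 1, 2, 3}, {0, 4, 5, 6}} : Finset (Finset (Fin 9)))) ∧ _ :=
    weak_pair (by decide) (by decide) (by decide)
  have hsub : ∀ e ∈ completeOn ({{0, 1, 2, 3}, {0, 4, 5, 6}} : Finset (Finset (Fin 9))),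
      e ⊆ {0, 1, 2, 3} ∨ e ⊆ {0, 4, 5, 6} := by
    intro e he
    simp only [completeOn, Finset.mem_biUnion, Finset.mem_insert, Finset.mem_singleton,
      Finset.mem_powersetCard] at he
    obtain ⟨Q, rfl | rfl, he⟩ := he
    · exact Or.inl he.1
    · exact Or.inr he.1
  have hn : ∀ {e Q : Finset (Fin 9)} {x : Fin 9}, e ⊆ Q → x ∉ Q → x ∉ e := fun h hx hxe =>
    hx (h hxe)
  obtain ⟨h1, h2⟩ := hpair.1.insert_pair (p := 1) (q := 4) (w := 7) (w' := 8) (by decide)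
    (by decide) (by decide) (by decide) (by decide) (by decide)
    (fun e he => (hsub e he).elim (fun h => ⟨hn h (by decide), hn h (by decide)⟩)
      fun h => ⟨hn h (by decide), hn h (by decide)⟩)
    (fun e he hp => (hsub e he).elim (fun h => hn h (by decide))
      fun h => absurd hp (hn h (by decide)))
  exact ⟨h1, by rw [Q9two, h2, hpair.2]⟩

/-- The rows and columns of the `4 × 4` lattice. -/
def latticeLines : Finset (Finset (Fin 4 × Fin 4)) :=
  (Finset.univ.image fun i : Fin 4 => Finset.univ.filter fun p : Fin 4 × Fin 4 => p.1 = i) ∪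
    (Finset.univ.image fun j : Fin 4 => Finset.univ.filter fun p : Fin 4 × Fin 4 => p.2 = j)

theorem weak_Q44 : Weak Q44 ∧ Q44.card = 32 := by
  have hline : ∀ Q ∈ latticeLines, (∃ i, Q = Finset.univ.filter fun p : Fin 4 × Fin 4 => p.1 = i) ∨
      ∃ j, Q = Finset.univ.filter fun p : Fin 4 × Fin 4 => p.2 = j := by
    intro Q hQ
    simp only [latticeLines, Finset.mem_union, Finset.mem_image, Finset.mem_univ, true_and] at hQ
    exact hQ.imp (fun ⟨i, h⟩ => ⟨i, h.symm⟩) fun ⟨i, h⟩ => ⟨i, h.symm⟩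
  have h4 : ∀ Q ∈ latticeLines, Q.card = 4 := by
    intro Q hQ
    rcases hline Q hQ with ⟨i, rfl⟩ | ⟨i, rfl⟩ <;> revert i <;> decide
  have h1 : ∀ Q ∈ latticeLines, ∀ B ∈ latticeLines, Q ≠ B → (Q ∩ B).card ≤ 1 := by
    intro Q hQ B hB hne
    refine Finset.card_le_one.2 fun x hx y hy => ?_
    rw [Finset.mem_inter] at hx hy
    rcases hline Q hQ with ⟨i, rfl⟩ | ⟨i, rfl⟩ <;> rcases hline B hB with ⟨j, rfl⟩ | ⟨j, rfl⟩ <;>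
      simp only [Finset.mem_filter, Finset.mem_univ, true_and] at hx hy
    · exact absurd (by rw [← hx.1, ← hx.2]) hne
    · exact Prod.ext (hx.1.trans hy.1.symm) (hx.2.trans hy.2.symm)
    · exact Prod.ext (hx.2.trans hy.2.symm) (hx.1.trans hy.1.symm)
    · exact absurd (by rw [← hx.1, ← hx.2]) hne
  refine ⟨weak_completeOn (K := latticeLines) h4 h1 ?_, ?_⟩
  · rintro Q hQ B hB C hC hQB hBC hQC ⟨x, hx⟩ ⟨y, hy⟩ ⟨z, hz⟩
    exfalso
    rw [Finset.mem_inter] at hx hy hz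
    -- Two of three lines are parallel.
    rcases hline Q hQ with ⟨i, rfl⟩ | ⟨i, rfl⟩ <;> rcases hline B hB with ⟨j, rfl⟩ | ⟨j, rfl⟩ <;>
      rcases hline C hC with ⟨k, rfl⟩ | ⟨k, rfl⟩ <;>
      simp only [Finset.mem_filter, Finset.mem_univ, true_and] at hx hy hz <;> first
      | (apply hQB; rw [← hx.1, ← hx.2]; done)
      | (apply hBC; rw [← hy.1, ← hy.2]; done)
      | (apply hQC; rw [← hz.1, ← hz.2])
  · rw [show Q44 = completeOn latticeLines from rfl, card_completeOn h4 h1]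
    decide +kernel

theorem exists_labels {Q : Finset V} (hQ : Q.card = 4) {a : V} (ha : a ∈ Q) :
    ∃ x y z, Q = {a, x, y, z} := by
  obtain ⟨x, y, z, -, -, -, h⟩ := Finset.card_eq_three.1
    (by rw [Finset.card_erase_of_mem ha, hQ] : (Q.erase a).card = 3)
  exact ⟨x, y, z, by rw [← h, Finset.insert_erase ha]⟩

end

section

/-! ### Recognizing the sporadic systems -/

theorem iso_of_labels {n : ℕ} {F K N : Finset (Finset (Fin n))} {v : Fin n → Fin n}
    (hv : Function.Surjective v)
    (h : F = completeOn (K.image (Finset.image v)) ∪ N.image (Finset.image v)) :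
    Iso F (completeOn K ∪ N) := by
  refine iso_of_surjective hv ?_
  rw [h, completeOn_image (Finite.injective_iff_surjective.2 hv), Finset.image_union]

theorem Closed.eq_completeOn_union {V : Type*} [DecidableEq V] {F K N : Finset (Finset V)}
    (hF : Closed F) (hb : blocks F = K) (hn : normal F = N) : F = completeOn K ∪ N := by
  have := hF.eq_normal_union
  rw [hb, hn, Finset.union_comm] at this
  exact this

theorem Closed.iso_eight {F : Finset (Finset (Fin 8))} (hF : Closed F) (hcard : 8 ≤ F.card)
    (hQ : ∃ Q, IsBlock F Q) : Iso F Q8two ∨ Iso F Q8three := by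
  obtain ⟨Q, B, hQB, hb, hn, h⟩ := hF.eight_with_block (S := Finset.univ)
    (fun e _ => Finset.subset_univ e) (by simp) hcard hQ
  have hQ : IsBlock F Q := mem_blocks.1 (hb ▸ by simp)
  have hB : IsBlock F B := mem_blocks.1 (hb ▸ by simp)
  have hFe := hF.eq_completeOn_union hb hn
  rcases h with h | ⟨a, haQ, haB⟩
  · right
    have hU : Q ∪ B = Finset.univ := by
      rw [← Finset.card_eq_iff_eq_univ, Finset.card_union_of_disjoint h, hQ.1, hB.1]
      rfl
    obtain ⟨a, ha⟩ := Finset.card_pos.1 (by rw [hQ.1]; norm_num : 0 < Q.card)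
    obtain ⟨b, hbB⟩ := Finset.card_pos.1 (by rw [hB.1]; norm_num : 0 < B.card)
    obtain ⟨x, y, z, rfl⟩ := exists_labels hQ.1 ha
    obtain ⟨x', y', z', rfl⟩ := exists_labels hB.1 hbB
    rw [Q8three, ← Finset.union_empty (completeOn _)]
    refine iso_of_labels (v := ![a, x, y, z, b, x', y', z']) (fun t => ?_) ?_
    · have ht : t ∈ ({a, x, y, z} ∪ {b, x', y', z'} : Finset (Fin 8)) := hU ▸ Finset.mem_univ t
      simp only [Finset.mem_union, Finset.mem_insert, Finset.mem_singleton] at ht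
      rcases ht with (rfl | rfl | rfl | rfl) | rfl | rfl | rfl | rfl
      exacts [⟨0, rfl⟩, ⟨1, rfl⟩, ⟨2, rfl⟩, ⟨3, rfl⟩, ⟨4, rfl⟩, ⟨5, rfl⟩, ⟨6, rfl⟩, ⟨7, rfl⟩]
    · rw [hFe]
      simp [Finset.image_insert]
  · left
    have h7 := hF.card_union_blocks hQ hB hQB haQ haB
    obtain ⟨w, hw⟩ := Finset.card_eq_one.1
      (by rw [Finset.card_compl, h7]; rfl : ((Q ∪ B)ᶜ).card = 1)
    have hU : ∀ t, t ∈ Q ∪ B ∨ t = w := fun t => by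
      rw [← Finset.mem_singleton, ← hw, Finset.mem_compl]
      exact em _
    obtain ⟨x, y, z, rfl⟩ := exists_labels hQ.1 haQ
    obtain ⟨x', y', z', rfl⟩ := exists_labels hB.1 haB
    rw [Q8two, ← Finset.union_empty (completeOn _)]
    refine iso_of_labels (v := ![a, x, y, z, x', y', z', w]) (fun t => ?_) ?_
    · have ht := hU t
      simp only [Finset.mem_union, Finset.mem_insert, Finset.mem_singleton] at ht
      rcases ht with ((rfl | rfl | rfl | rfl) | rfl | rfl | rfl | rfl) | rfl
      exacts [⟨0, rfl⟩, ⟨1, rfl⟩, ⟨2, rfl⟩, ⟨3, rfl⟩, ⟨0, rfl⟩, ⟨4, rfl⟩, ⟨5, rfl⟩, ⟨6, rfl⟩, ⟨7, rfl⟩]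
    · rw [hFe]
      simp [Finset.image_insert]

theorem Closed.iso_nine {F : Finset (Finset (Fin 9))} (hF : Closed F) (hcard : 10 ≤ F.card)
    (hQ : ∃ Q, IsBlock F Q) : Iso F Q9two := by
  obtain ⟨Q, B, a, hQB, haQ, haB, hb, x, hx, y, hy, hxa, hya, w, w', hw, hn⟩ :=
    hF.nine_with_block (S := Finset.univ) (fun e _ => Finset.subset_univ e) (by simp) hcard hQ
  have hQ : IsBlock F Q := mem_blocks.1 (hb ▸ by simp)
  have hB : IsBlock F B := mem_blocks.1 (hb ▸ by simp)
  have hFe := hF.eq_completeOn_union hb hn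
  have hU : ∀ t, t ∈ Q ∪ B ∨ t = w ∨ t = w' := fun t => by
    have h : t ∈ Finset.univ \ (Q ∪ B) ↔ t ∈ ({w, w'} : Finset (Fin 9)) := by rw [hw]
    rw [Finset.mem_sdiff, Finset.mem_insert, Finset.mem_singleton] at h
    rw [← h]
    by_cases ht : t ∈ Q ∪ B
    · exact Or.inl ht
    · exact Or.inr ⟨Finset.mem_univ t, ht⟩
  obtain ⟨p, q, -, -, -, -, -, rfl⟩ := exists_other_two hQ.1 haQ hx hxa.symm
  obtain ⟨p', q', -, -, -, -, -, rfl⟩ := exists_other_two hB.1 haB hy hya.symm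
  refine iso_of_labels (v := ![a, x, p, q, y, p', q', w, w']) (fun t => ?_) ?_
  · have ht := hU t
    simp only [Finset.mem_union, Finset.mem_insert, Finset.mem_singleton] at ht
    rcases ht with ((rfl | rfl | rfl | rfl) | rfl | rfl | rfl | rfl) | rfl | rfl
    exacts [⟨0, rfl⟩, ⟨1, rfl⟩, ⟨2, rfl⟩, ⟨3, rfl⟩, ⟨0, rfl⟩, ⟨4, rfl⟩, ⟨5, rfl⟩, ⟨6, rfl⟩, ⟨7, rfl⟩,
      ⟨8, rfl⟩]
  · rw [hFe]
    simp [Finset.image_insert]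

theorem Closed.iso_ten {F : Finset (Finset (Fin 10))} (hF : Closed F) (hcard : 12 ≤ F.card)
    (hQ : ∃ Q, IsBlock F Q) : Iso F Q10three ∨ Iso F Q10four := by
  obtain ⟨Q, B, C, a, u, hQB, hCQ, hCB, haQ, haB, huB, huC, hb, hn, hU⟩ :=
    hF.ten_with_block (S := Finset.univ) (fun e _ => Finset.subset_univ e) (by simp) hcard hQ
  have hQ : IsBlock F Q := mem_blocks.1 (hb ▸ by simp)
  have hB : IsBlock F B := mem_blocks.1 (hb ▸ by simp)
  have hC : IsBlock F C := mem_blocks.1 (hb ▸ by simp)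
  have hFe := hF.eq_completeOn_union hb hn
  obtain ⟨x, y, z, rfl⟩ := exists_labels hQ.1 haQ
  obtain ⟨x', y', z', rfl⟩ := exists_labels hC.1 huC
  by_cases hua : u = a
  · subst hua
    left
    obtain ⟨p, q, r, rfl⟩ := exists_labels hB.1 haB
    rw [Q10three, ← Finset.union_empty (completeOn _)]
    refine iso_of_labels (v := ![u, x, y, z, p, q, r, x', y', z']) (fun t => ?_) ?_
    · have ht := Finset.mem_univ t
      rw [← hU] at ht
      simp only [Finset.mem_union, Finset.mem_insert, Finset.mem_singleton] at ht
      rcases ht with ((rfl | rfl | rfl | rfl) | rfl | rfl | rfl | rfl) | rfl | rfl | rfl | rfl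
      exacts [⟨0, rfl⟩, ⟨1, rfl⟩, ⟨2, rfl⟩, ⟨3, rfl⟩, ⟨0, rfl⟩, ⟨4, rfl⟩, ⟨5, rfl⟩, ⟨6, rfl⟩,
        ⟨0, rfl⟩, ⟨7, rfl⟩, ⟨8, rfl⟩, ⟨9, rfl⟩]
    · rw [hFe]
      simp [Finset.image_insert]
  · right
    obtain ⟨p, q, -, -, -, -, -, rfl⟩ := exists_other_two hB.1 haB huB (Ne.symm hua)
    rw [Q10four, ← Finset.union_empty (completeOn _)]
    refine iso_of_labels (v := ![x, y, z, a, p, q, u, x', y', z']) (fun t => ?_) ?_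
    · have ht := Finset.mem_univ t
      rw [← hU] at ht
      simp only [Finset.mem_union, Finset.mem_insert, Finset.mem_singleton] at ht
      rcases ht with ((rfl | rfl | rfl | rfl) | rfl | rfl | rfl | rfl) | rfl | rfl | rfl | rfl
      exacts [⟨3, rfl⟩, ⟨0, rfl⟩, ⟨1, rfl⟩, ⟨2, rfl⟩, ⟨3, rfl⟩, ⟨6, rfl⟩, ⟨4, rfl⟩, ⟨5, rfl⟩,
        ⟨6, rfl⟩, ⟨7, rfl⟩, ⟨8, rfl⟩, ⟨9, rfl⟩]
    · have e1 : ({a, x, y, z} : Finset (Fin 10)) = {x, y, z, a} := by ext t; simp; tauto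
      have e2 : ({a, u, p, q} : Finset (Fin 10)) = {a, p, q, u} := by ext t; simp; tauto
      rw [hFe, e1, e2]
      simp [Finset.image_insert]

theorem isExtremal_of_iso {m n : ℕ} (hn : 8 ≤ n) {F : Finset (Finset (Fin n))} {W : Type*}
    [DecidableEq W] {G : Finset (Finset W)} (hG : Weak G ∧ G.card = m) (hm : m = n ^ 2 / 8)
    (h : Iso F G) : IsExtremal {Config.A, Config.B, Config.D} F :=
  isExtremal_iff.2 ⟨h.weak hG.1, by rw [h.card_eq, hG.2, hm, ex_eq hn]⟩

theorem Closed.not_isBlock {V : Type*} [DecidableEq V] {F : Finset (Finset V)} (hF : Closed F)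
    {S : Finset V} (hS : ∀ e ∈ F, e ⊆ S) (hn : 11 ≤ S.card) (h16 : S.card ≠ 16)
    (hcard : S.card ^ 2 / 8 ≤ F.card) (Q : Finset V) : ¬ IsBlock F Q := by
  obtain ⟨n, hSn⟩ : ∃ n, S.card = n := ⟨_, rfl⟩
  rw [hSn] at hn h16 hcard
  have h : ExtremalBlockFree V n := by
    by_cases h17 : 17 ≤ n
    · exact extremalBlockFree_of_le h17
    · interval_cases n
      exacts [extremalBlockFree_eleven, extremalBlockFree_twelve, extremalBlockFree_thirteen,
        extremalBlockFree_fourteen, extremalBlockFree_fifteen, absurd rfl h16]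
  exact h F S hF hS hSn hcard Q

end

end TripleSystems

theorem theorem10p1 (n : ℕ) (hn : 8 ≤ n) :
    ex n {Config.A, Config.B, Config.D} = n ^ 2 / 8 ∧
    (11 ≤ n → ∀ F : Finset (Finset (Fin n)),
      IsExtremal {Config.A, Config.B, Config.D} F ↔
        (∃ k, IsOptimal n k ∧ IsF k F) ∨ (n = 16 ∧ Iso F Q44)) ∧
    (n = 8 → ∀ F : Finset (Finset (Fin n)),
      IsExtremal {Config.A, Config.B, Config.D} F ↔ IsF 2 F ∨ Iso F Q8two ∨ Iso F Q8three) ∧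
    (n = 9 → ∀ F : Finset (Finset (Fin n)),
      IsExtremal {Config.A, Config.B, Config.D} F ↔ IsF 2 F ∨ Iso F Q9two) ∧
    (n = 10 → ∀ F : Finset (Finset (Fin n)),
      IsExtremal {Config.A, Config.B, Config.D} F ↔
        IsF 2 F ∨ IsF 3 F ∨ Iso F Q10three ∨ Iso F Q10four) := by
  have hcard : ∀ F : Finset (Finset (Fin n)), IsExtremal {Config.A, Config.B, Config.D} F →
      n ^ 2 / 8 ≤ F.card := fun F hF => by rw [(isExtremal_iff.1 hF).2, ex_eq hn]
  refine ⟨ex_eq hn, fun h11 F => ⟨fun hF => ?_, ?_⟩, ?_, ?_, ?_⟩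
  · by_cases hb : ∃ Q, IsBlock F Q
    · obtain ⟨Q, hQ⟩ := hb
      have h16 : n = 16 := by
        by_contra h16
        exact hF.closed.not_isBlock (S := Finset.univ) (fun e _ => Finset.subset_univ e)
          (by simpa using h11) (by simpa using h16) (by simpa using hcard F hF) Q hQ
      subst h16
      exact Or.inr ⟨rfl, hF.closed.iso_lattice (by simp) (hcard F hF) hQ⟩
    · push Not at hb
      obtain ⟨k, -, h2, hk, hFk⟩ := hF.exists_isF hn hb
      exact Or.inl ⟨k, (isOptimal_iff hn h2).2 hk, hFk⟩
  · rintro (⟨k, hk, hF⟩ | ⟨rfl, hF⟩)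
    · exact hF.isExtremal hn ((isOptimal_iff hn hF.2.1).1 hk)
    · exact isExtremal_of_iso hn weak_Q44 rfl hF
  · rintro rfl F
    constructor
    · intro hF
      by_cases hb : ∃ Q, IsBlock F Q
      · exact Or.inr (hF.closed.iso_eight (hcard F hF) hb)
      · push Not at hb
        obtain ⟨k, h1, h2, hk, hFk⟩ := hF.exists_isF hn hb
        have : k ≤ 3 := by omega
        interval_cases k <;> norm_num at hk
        exact Or.inl hFk
    · rintro (hF | hF | hF)
      · exact hF.isExtremal hn rfl
      · exact isExtremal_of_iso hn weak_Q8two rfl hF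
      · exact isExtremal_of_iso hn weak_Q8three rfl hF
  · rintro rfl F
    constructor
    · intro hF
      by_cases hb : ∃ Q, IsBlock F Q
      · exact Or.inr (hF.closed.iso_nine (hcard F hF) hb)
      · push Not at hb
        obtain ⟨k, h1, h2, hk, hFk⟩ := hF.exists_isF hn hb
        have : k ≤ 4 := by omega
        interval_cases k <;> norm_num at hk
        exact Or.inl hFk
    · rintro (hF | hF)
      · exact hF.isExtremal hn rfl
      · exact isExtremal_of_iso hn weak_Q9two rfl hF
  · rintro rfl F
    constructor
    · intro hF
      by_cases hb : ∃ Q, IsBlock F Q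
      · exact Or.inr (Or.inr (hF.closed.iso_ten (hcard F hF) hb))
      · push Not at hb
        obtain ⟨k, h1, h2, hk, hFk⟩ := hF.exists_isF hn hb
        have : k ≤ 4 := by omega
        interval_cases k <;> norm_num at hk
        · exact Or.inl hFk
        · exact Or.inr (Or.inl hFk)
    · rintro (hF | hF | hF | hF)
      · exact hF.isExtremal hn rfl
      · exact hF.isExtremal hn rfl
      · exact isExtremal_of_iso hn weak_Q10three rfl hF
      · exact isExtremal_of_iso hn weak_Q10four rfl hF
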